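/- **Setting.** Let $\psi:\mathbb R\to\mathbb R$ be $C^3$ with $\|\psi''\|_\infty\le\kappa_2$ and $\|\psi'''\|_\infty\le\kappa_3$. Let $s=c(\sigma)>0$ and let $\nu$ be a measure on $\mathbb R$ such that $y\mapsto\exp\{(y\theta-\psi(\theta))/s\}$ is a probability density with respect to $\nu$ for every $\theta\in\mathbb R$ ($\psi$ is the cumulant function). The pairs $(x_i,y_i)\in\mathbb R^p\times\mathbb R$, $i=1,\dots,n$, are i.i.d.; $x_i$ has law $P$, and given $x_i$ the response $y_i$ has density $\exp\{(y\,x_i^T\beta^*-\psi(x_i^T\beta^*))/s\}$ with respect to $\nu$. Put $S=\operatorname{supp}(\beta^*)\ne\emptyset$, $|S|\le k$, $\Sigma_x=\mathbb E[x_ix_i^T]$, $Q^*=\mathbb E[\frac1n\sum_i\psi''(x_i^T\beta^*)x_ix_i^T]$ and $$\mathcal L_n(\beta)=\frac1n\sum_{i=1}^n\big(\psi(x_i^T\beta)-y_ix_i^T\beta\big).$$ Let $|||A|||_\infty$ denote the maximal absolute row sum of $A$. A function $\rho_\lambda:\mathbb R\to\mathbb R$ is *$(\mu,\gamma)$-amenable*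 ($\mu\ge0$, $0<\gamma<\infty$) if it is even with $\rho_\lambda(0)=0$; nondecreasing on $[0,\infty)$; $t\mapsto\rho_\lambda(t)/t$ is nonincreasing on $(0,\infty)$; it is differentiable at every $t\ne0$; $\rho_\lambda(t)+\frac\mu2t^2$ is convex; $\lim_{t\to0^+}\rho_\lambda'(t)=\lambda$; and $\rho'_\lambda(t)=0$ for $t\ge\gamma\lambda$. A point $\tilde\beta$ with $\|\tilde\beta\|_1\le R$ is a *stationary point* of the program $$\min_{\|\beta\|_1\le R}\Big\{\mathcal L_n(\beta)+\sum_{j=1}^p\rho_\lambda(\beta_j)\Big\}\qquad(*)$$ if $\langle\nabla\mathcal L_n(\tilde\beta),\beta-\tilde\beta\rangle+\lim_{t\to0^+}\sum_j\rho_\lambda'(\tilde\beta_j+t(\beta_j-\tilde\beta_j))(\beta_j-\tilde\beta_j)\ge0$ for all $\beta$ with $\|\beta\|_1\le R$. An *oracle estimator* is a minimizer of $\mathcal L_n$ over the vectors supported on $S$. **Statement.** Fix $\psi$ as above and constants $\sigma_x,\lambda_0,B>0$. There is a constant $c_\psi>0$, depending only on $\psi$ and on $(\sigma_x,\lambda_0,B)$,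 such that for every $(\nu,s)$ as above and all $M,c_\infty>0$ there are positive constants $c_0,c_1,c_2,c_3,c_\ell,c_u$, depending only on $\psi,s,\nu,\sigma_x,\lambda_0,B,M,c_\infty$ (not on $n,p,k,P,\beta^*,\rho_\lambda,\lambda,R,\mu,\gamma$), with the following property. Suppose that * $\|x_i\|_\infty\le M$ almost surely, $x_i$ is sub-Gaussian with parameter $\sigma_x$, i.e. $\mathbb E\exp\{(v^Tx_i)^2/\sigma_x^2\}\le2$ for all $\|v\|_2\le1$, $\lambda_{\min}(\Sigma_x)\ge\lambda_0$, and $\|\beta^*\|_2\le B$; * $n\ge c_0k^3\log p$; * $\rho_\lambda$ is $(\mu,\gamma)$-amenable with $\mu<c_\psi\,\lambda_{\min}(\Sigma_x)$; * $\|\beta^*\|_1\le R/2$ and $c_\ell\sqrt{\frac{\log p}n}\le\lambda\le\frac{c_u}R$; * $Q^*_{SS}$ is invertible with $|||(Q^*_{SS})^{-1}|||_\infty\le c_\infty$; * $\min_{j\in S}|\beta^*_j|\ge\lambda(\gamma+2c_\infty)+c_3\sqrt{\frac{\log p}n}$. Then with probability at least $1-c_1\exp(-c_2\min\{k,\log p\})$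 the program $(*)$ has a unique stationary point $\hat\beta$, which is the (unique) oracle estimator, and $$\|\hat\beta-\beta^*\|_\infty\le c_3\sqrt{\frac{\log p}n}.$$ No incoherence condition is assumed. -/

import Mathlib

open MeasureTheory Filter Topology

noncomputable section

/-- `ψ` is the cumulant function, for the scale `s = c(σ)`, of the generalized linear model with
base measure `ν`: for every value `θ` of the linear predictor, `y ↦ exp ((y θ - ψ θ) / s)` is a
probability density with respect to `ν`. -/
def IsGLMFamily (ψ : ℝ → ℝ) (ν : Measure ℝ) (s : ℝ) : Prop :=
  ∀ θ : ℝ, ∫⁻ y, ENNReal.ofReal (Real.exp ((y * θ - ψ θ) / s)) ∂ν = 1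

/-- The joint law of one pair `(x, y)`: the covariate vector `x` has law `P` and, given `x`, the
response `y` has density `exp ((y xᵀβ - ψ (xᵀβ)) / s)` with respect to `ν`. -/
def glmLaw {p : ℕ} (ψ : ℝ → ℝ) (ν : Measure ℝ) (s : ℝ) (P : Measure (Fin p → ℝ))
    (β : Fin p → ℝ) : Measure ((Fin p → ℝ) × ℝ) :=
  (P.prod ν).withDensity fun z =>
    ENNReal.ofReal (Real.exp ((z.2 * (z.1 ⬝ᵥ β) - ψ (z.1 ⬝ᵥ β)) / s))

/-- The law of `n` i.i.d. pairs `(xᵢ, yᵢ)`. -/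
def glmSampleLaw {p : ℕ} (n : ℕ) (ψ : ℝ → ℝ) (ν : Measure ℝ) (s : ℝ) (P : Measure (Fin p → ℝ))
    (β : Fin p → ℝ) : Measure (Fin n → (Fin p → ℝ) × ℝ) :=
  Measure.pi fun _ => glmLaw ψ ν s P β

/-- The (rescaled) negative log-likelihood of the sample `z`. -/
def glmLoss {n p : ℕ} (ψ : ℝ → ℝ) (z : Fin n → (Fin p → ℝ) × ℝ) (β : Fin p → ℝ) : ℝ :=
  (1 / (n : ℝ)) * ∑ i, (ψ ((z i).1 ⬝ᵥ β) - (z i).2 * ((z i).1 ⬝ᵥ β))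

/-- The `ℓ₁`-norm.  (The `ℓ_∞`-norm is the built-in norm of `Fin p → ℝ`.) -/
def l1Norm {p : ℕ} (v : Fin p → ℝ) : ℝ := ∑ j, |v j|

/-- The `ℓ₂`-norm. -/
def l2Norm {p : ℕ} (v : Fin p → ℝ) : ℝ := Real.sqrt (∑ j, v j ^ 2)

/-- The support of a vector. -/
def suppSet {p : ℕ} (v : Fin p → ℝ) : Finset (Fin p) := Finset.univ.filter fun j => v j ≠ 0

/-- The covariate law `P` is sub-Gaussian with parameter `σ`: the sub-Gaussian (Orlicz) norm of
`vᵀx` is at most `σ`, for every `v` in the Euclidean unit ball. -/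
def IsSubGaussianVector {p : ℕ} (P : Measure (Fin p → ℝ)) (σ : ℝ) : Prop :=
  ∀ v : Fin p → ℝ, l2Norm v ≤ 1 →
    ∫⁻ x, ENNReal.ofReal (Real.exp ((x ⬝ᵥ v) ^ 2 / σ ^ 2)) ∂P ≤ 2

/-- `Σ_x = E[x xᵀ]`. -/
def covMatrix {p : ℕ} (P : Measure (Fin p → ℝ)) : Matrix (Fin p) (Fin p) ℝ :=
  Matrix.of fun i j => ∫ x, x i * x j ∂P

/-- The Fisher information matrix `E[ψ''(xᵀβ) x xᵀ]`. -/
def fisherInfo {p : ℕ} (ψ : ℝ → ℝ) (P : Measure (Fin p → ℝ)) (β : Fin p → ℝ) :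
    Matrix (Fin p) (Fin p) ℝ :=
  Matrix.of fun i j => ∫ x, iteratedDeriv 2 ψ (x ⬝ᵥ β) * (x i * x j) ∂P

/-- The principal submatrix `A_SS`. -/
def principalSub {p : ℕ} (A : Matrix (Fin p) (Fin p) ℝ) (S : Finset (Fin p)) :
    Matrix S S ℝ :=
  A.submatrix Subtype.val Subtype.val

/-- The smallest eigenvalue of a (symmetric) matrix. -/
def lambdaMin {p : ℕ} (A : Matrix (Fin p) (Fin p) ℝ) : ℝ := sInf (spectrum ℝ A)

/-- The `ℓ_∞`-operator norm of `A` (maximal absolute row sum) is at most `c`. -/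
def LinftyOpNormLE {ι : Type*} [Fintype ι] (A : Matrix ι ι ℝ) (c : ℝ) : Prop :=
  ∀ i, ∑ j, |A i j| ≤ c

/-- `(μ, γ)`-amenable regularizers with regularization parameter `lam`. -/
structure IsAmenable (ρ : ℝ → ℝ) (lam μ γ : ℝ) : Prop where
  mu_nonneg : 0 ≤ μ
  gamma_pos : 0 < γ
  symm : ∀ t, ρ (-t) = ρ t
  zero : ρ 0 = 0
  mono : MonotoneOn ρ (Set.Ici 0)
  ratio_anti : AntitoneOn (fun t => ρ t / t) (Set.Ioi 0)
  diff : ∀ t, t ≠ 0 → DifferentiableAt ℝ ρ t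
  weakly_convex : ConvexOn ℝ Set.univ fun t => ρ t + μ / 2 * t ^ 2
  selection : Tendsto (deriv ρ) (𝓝[>] 0) (𝓝 lam)
  unbiased : ∀ t, γ * lam ≤ t → deriv ρ t = 0

/-- `β` is a stationary point of the program `min {L(β) + ∑ⱼ ρ(βⱼ) : ‖β‖₁ ≤ R}`, that is,
`⟨∇L(β) + ∇ρ(β), β' - β⟩ ≥ 0` for all feasible `β'`, where
`⟨∇ρ(β), β' - β⟩` stands for `lim_{t → 0⁺} ⟨∇ρ(β + t (β' - β)), β' - β⟩`. -/
def IsStationaryPoint {p : ℕ} (L : (Fin p → ℝ) → ℝ) (ρ : ℝ → ℝ) (R : ℝ)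
    (β : Fin p → ℝ) : Prop :=
  l1Norm β ≤ R ∧ ∀ β' : Fin p → ℝ, l1Norm β' ≤ R →
    ∃ d : ℝ,
      Tendsto (fun t : ℝ => ∑ j, deriv ρ (β j + t * (β' j - β j)) * (β' j - β j))
        (𝓝[>] 0) (𝓝 d) ∧
      0 ≤ fderiv ℝ L β (β' - β) + d

/-- `β` is an oracle estimator: it minimizes `L` over the vectors supported on `S`. -/
def IsOracle {p : ℕ} (L : (Fin p → ℝ) → ℝ) (S : Finset (Fin p)) (β : Fin p → ℝ) : Prop :=
  (∀ j, j ∉ S → β j = 0) ∧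
    ∀ β' : Fin p → ℝ, (∀ j, j ∉ S → β' j = 0) → L β ≤ L β'

end

/-! Write ε = sqrt (log p / n), so n ε² = log p, and the sample size condition says that k^(3/2) ε
is small. For p ≥ 2 the conclusion holds on an event of probability at least 1 - 9/p
(`glmSampleLaw_not_isGoodSample_le`), where the argument is deterministic
(`IsGoodSample.exists_unique_stationary`).

Curvature. As ψ is a cumulant function, ψ'' ≥ 0 and the loss is convex. If ψ'' vanishes somewhere,
it vanishes identically and Q*_SS cannot be invertible. Otherwise ψ'' is bounded below on compact
sets, and the Bregman divergence of the loss dominates a pseudo-Huber risk truncated to bounded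
xᵀβ*. Maurey's method reduces a uniform lower bound for this risk on the cone ‖v‖₁ ≤ (r/ε) ‖v‖₂ to
finitely many vectors, handled by a lower-tail bound (`mul_huberRate_le_huberRisk`,
`glmSampleLaw_not_rsc_le`). The resulting growth is of order min(‖v‖₂², ‖v‖₂).

Oracle. Curvature and the O(ε) score put a minimizer over vectors supported on S within O(√k ε) of
β* in ℓ₂. Linearizing the gradient by Q* leaves an error O(k ε²), and inverting Q*_SS gives the ℓ_∞
rate. A coordinate j off S sees the score at j and in the direction U_j = (Q*_SS)⁻¹ Q*_Sj.
Incoherence would bound ‖U_j‖₁; here only ‖U_j‖₂ = O(1) is needed, because U_jᵀ score then still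
concentrates at rate ε, while the linearization error contributes √k · k ε² = O(ε)
(`exists_projection`, `oracle_bounds`). So the gradient off S is at most λ/2, the signal condition
puts the oracle in the flat part of the penalty on S, and the oracle is stationary.

Uniqueness. Let v be the difference between a stationary point and the oracle. In the cone,
curvature exceeds the concavity μ when ‖v‖₂ ≤ 1, and λR small excludes ‖v‖₂ > 1. Outside the cone,
convexity and the ℓ₁-penalty off S already contradict ‖v‖₁ ≤ 2R (`eq_oracle_of_isStationaryPoint`).
-/

/-! ### The pseudo-Huber function -/

/-- The pseudo-Huber function: quadratic near `0`, linear at infinity. -/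
noncomputable def pseudoHuber (u : ℝ) : ℝ := Real.sqrt (1 + u ^ 2) - 1

lemma pseudoHuber_eq_div (u : ℝ) : pseudoHuber u = u ^ 2 / (Real.sqrt (1 + u ^ 2) + 1) := by
  have h := Real.sqrt_nonneg (1 + u ^ 2)
  have h2 := Real.sq_sqrt (by positivity : 0 ≤ 1 + u ^ 2)
  rw [pseudoHuber, eq_div_iff (by positivity)]
  nlinarith

lemma pseudoHuber_nonneg (u : ℝ) : 0 ≤ pseudoHuber u := by
  rw [pseudoHuber_eq_div]; positivity

lemma continuous_pseudoHuber : Continuous pseudoHuber := by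
  unfold pseudoHuber; fun_prop

lemma pseudoHuber_le_half_sq (u : ℝ) : pseudoHuber u ≤ u ^ 2 / 2 := by
  have h := Real.sqrt_le_sqrt (by nlinarith [sq_nonneg u] : 1 ≤ 1 + u ^ 2)
  rw [Real.sqrt_one] at h
  rw [pseudoHuber_eq_div]
  exact div_le_div_of_nonneg_left (sq_nonneg u) (by norm_num) (by linarith)

lemma pseudoHuber_le_abs (u : ℝ) : pseudoHuber u ≤ |u| := by
  have : Real.sqrt (1 + u ^ 2) ≤ 1 + |u| := by
    rw [Real.sqrt_le_left (by positivity)]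
    nlinarith [sq_abs u, abs_nonneg u]
  rw [pseudoHuber]; linarith

lemma sq_div_le_pseudoHuber {u K : ℝ} (hu : |u| ≤ K) : u ^ 2 / (K + 2) ≤ pseudoHuber u := by
  have : Real.sqrt (1 + u ^ 2) ≤ 1 + |u| := by
    rw [Real.sqrt_le_left (by positivity)]
    nlinarith [sq_abs u, abs_nonneg u]
  rw [pseudoHuber_eq_div]
  exact div_le_div_of_nonneg_left (sq_nonneg u) (by positivity) (by linarith)

/-- The second-order upper bound coming from `pseudoHuber'' ≤ 1`. -/
lemma pseudoHuber_add_le (u z : ℝ) :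
    pseudoHuber (u + z) ≤ pseudoHuber u + u / Real.sqrt (1 + u ^ 2) * z + z ^ 2 / 2 := by
  set s := Real.sqrt (1 + u ^ 2) with hs
  have hs1 : 1 ≤ s := by
    have h := Real.sqrt_le_sqrt (by nlinarith [sq_nonneg u] : 1 ≤ 1 + u ^ 2)
    rwa [Real.sqrt_one] at h
  have hs2 : s ^ 2 = 1 + u ^ 2 := Real.sq_sqrt (by positivity)
  have hw := Real.sqrt_nonneg (1 + (u + z) ^ 2)
  have hw2 : Real.sqrt (1 + (u + z) ^ 2) ^ 2 = 1 + (u + z) ^ 2 := Real.sq_sqrt (by positivity)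
  set w := Real.sqrt (1 + (u + z) ^ 2)
  -- This is 2sw ≤ s² + w² divided by 2s.
  have key : w ≤ s + (2 * u * z + z ^ 2) / (2 * s) := by
    have e : s + (2 * u * z + z ^ 2) / (2 * s) = (s ^ 2 + w ^ 2) / (2 * s) := by
      rw [hs2, hw2]; field_simp; nlinarith
    rw [e, le_div_iff₀ (by positivity)]
    nlinarith [sq_nonneg (w - s)]
  have e2 : (2 * u * z + z ^ 2) / (2 * s) = u / s * z + z ^ 2 / (2 * s) := by field_simp
  have : z ^ 2 / (2 * s) ≤ z ^ 2 / 2 :=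
    div_le_div_of_nonneg_left (sq_nonneg z) (by norm_num) (by linarith)
  simp only [pseudoHuber]
  linarith

/-- The growth rate `r ↦ min (r², r)` of Huber type losses. -/
noncomputable def huberRate (r : ℝ) : ℝ := min (r ^ 2) r

lemma huberRate_nonneg {r : ℝ} (hr : 0 ≤ r) : 0 ≤ huberRate r := le_min (sq_nonneg r) hr

lemma huberRate_pos {r : ℝ} (hr : 0 < r) : 0 < huberRate r := lt_min (by positivity) hr

lemma huberRate_of_le_one {r : ℝ} (h0 : 0 ≤ r) (h1 : r ≤ 1) : huberRate r = r ^ 2 :=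
  min_eq_left (by nlinarith)

lemma huberRate_of_one_le {r : ℝ} (h1 : 1 ≤ r) : huberRate r = r := min_eq_right (by nlinarith)

lemma pseudoHuber_le_huberRate {r : ℝ} (hr : 0 ≤ r) : pseudoHuber r ≤ huberRate r :=
  le_min ((pseudoHuber_le_half_sq r).trans (by nlinarith [sq_nonneg r]))
    ((pseudoHuber_le_abs r).trans (abs_of_nonneg hr).le)

/-- A substitute for homogeneity, which transfers bounds from unit vectors to all vectors. In the
form u² / (√(1+u²) + 1), scaling by t ≤ 1 does not increase the denominator, and scaling by t ≥ 1
increases it by at most the factor t. -/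
lemma huberRate_mul_pseudoHuber_le {t : ℝ} (ht : 0 ≤ t) (u : ℝ) :
    huberRate t * pseudoHuber u ≤ pseudoHuber (t * u) := by
  set s := Real.sqrt (1 + u ^ 2) with hs
  have hs0 : 0 ≤ s := Real.sqrt_nonneg _
  have hs2 : s ^ 2 = 1 + u ^ 2 := Real.sq_sqrt (by positivity)
  rw [pseudoHuber_eq_div, pseudoHuber_eq_div (t * u), ← hs]
  rcases le_total t 1 with h | h
  · have h1 : Real.sqrt (1 + (t * u) ^ 2) ≤ s := by
      apply Real.sqrt_le_sqrt
      have : t ^ 2 ≤ 1 := by nlinarith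
      nlinarith [sq_nonneg u, mul_pow t u 2]
    rw [huberRate_of_le_one ht h, mul_div_assoc', ← mul_pow]
    exact div_le_div_of_nonneg_left (by positivity) (by positivity) (by linarith)
  · have h1 : Real.sqrt (1 + (t * u) ^ 2) ≤ t * s := by
      rw [Real.sqrt_le_left (by positivity), mul_pow, mul_pow, hs2]
      nlinarith [sq_nonneg u]
    rw [huberRate_of_one_le h, mul_div_assoc', div_le_div_iff₀ (by positivity) (by positivity)]
    have : t * u ^ 2 * (Real.sqrt (1 + (t * u) ^ 2) + 1) ≤ t * u ^ 2 * (t * (s + 1)) := by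
      apply mul_le_mul_of_nonneg_left _ (by positivity)
      nlinarith
    nlinarith

/-! ### Second-order Taylor expansion and Bregman divergences -/

lemma exists_taylor_two {f : ℝ → ℝ} (hf : ContDiff ℝ 2 f) (a u : ℝ) :
    ∃ ξ, |ξ - a| ≤ |u| ∧
      f (a + u) = f a + deriv f a * u + iteratedDeriv 2 f ξ * u ^ 2 / 2 := by
  rcases eq_or_ne u 0 with rfl | hu
  · exact ⟨a, by simp, by simp⟩
  have hne : a ≠ a + u := by simpa using hu
  obtain ⟨ξ, hξ, h⟩ := taylor_mean_remainder_lagrange_iteratedDeriv (n := 1) hne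
    (f := f) (by norm_num; exact hf.contDiffOn)
  refine ⟨ξ, ?_, ?_⟩
  · have := Set.abs_sub_left_of_mem_uIcc (Set.uIoo_subset_uIcc_self hξ)
    simpa using this
  · rw [taylorWithinEval_succ, taylor_within_zero_eval] at h
    have hd : iteratedDerivWithin (0 + 1) f (Set.uIcc a (a + u)) a = deriv f a := by
      rw [iteratedDerivWithin_one]
      exact ((hf.differentiable (by norm_num)) a).derivWithin
        ((uniqueDiffOn_uIcc hne) a Set.left_mem_uIcc)
    rw [hd] at h
    norm_num at h
    linarith

lemma taylor_one_le {f : ℝ → ℝ} (hf : ContDiff ℝ 2 f) {κ : ℝ}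
    (hκ : ∀ t, |iteratedDeriv 2 f t| ≤ κ) (a u : ℝ) :
    |f (a + u) - f a - deriv f a * u| ≤ κ * u ^ 2 / 2 := by
  obtain ⟨ξ, -, h⟩ := exists_taylor_two hf a u
  have e : f (a + u) - f a - deriv f a * u = iteratedDeriv 2 f ξ * (u ^ 2 / 2) := by
    rw [h]; ring
  rw [e, abs_mul, abs_of_nonneg (by positivity : 0 ≤ u ^ 2 / 2), mul_div_assoc]
  exact mul_le_mul_of_nonneg_right (hκ ξ) (by positivity)

lemma convexOn_of_iteratedDeriv_two_nonneg {f : ℝ → ℝ} (hf : ContDiff ℝ 2 f)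
    (h : ∀ t, 0 ≤ iteratedDeriv 2 f t) : ConvexOn ℝ Set.univ f := by
  have hd : ContDiff ℝ 1 (deriv f) := (contDiff_succ_iff_deriv.1 (by
    rw [one_add_one_eq_two]; exact hf)).2.2
  refine convexOn_univ_of_deriv2_nonneg (hf.differentiable (by norm_num))
    (hd.differentiable (by norm_num)) fun t => ?_
  have := h t
  rwa [iteratedDeriv_eq_iterate] at this

/-- A strictly convex function dominates the pseudo-Huber function, locally uniformly. -/
lemma mul_pseudoHuber_le_bregman {f : ℝ → ℝ} (hf : ContDiff ℝ 2 f)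
    (h0 : ∀ t, 0 ≤ iteratedDeriv 2 f t) {c T : ℝ} (hc : 0 ≤ c)
    (hcT : ∀ t, |t| ≤ T + 1 → c ≤ iteratedDeriv 2 f t) {a : ℝ} (ha : |a| ≤ T) (u : ℝ) :
    c / 2 * pseudoHuber u ≤ f (a + u) - f a - deriv f a * u := by
  have small : ∀ u : ℝ, |u| ≤ 1 → c / 2 * u ^ 2 ≤ f (a + u) - f a - deriv f a * u := by
    intro u hu
    obtain ⟨ξ, hξ, h⟩ := exists_taylor_two hf a u
    have : |ξ| ≤ T + 1 := by
      have := abs_add_le (ξ - a) a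
      rw [sub_add_cancel] at this
      linarith
    rw [h]
    nlinarith [hcT ξ this, sq_nonneg u]
  rcases le_total |u| 1 with hu | hu
  · refine le_trans ?_ (small u hu)
    apply mul_le_mul_of_nonneg_left _ (by positivity)
    exact (pseudoHuber_le_half_sq u).trans (by nlinarith [sq_nonneg u])
  · have hu0 : 0 < |u| := by linarith
    have h1 := small (u / |u|) (by rw [abs_div, abs_abs, div_self hu0.ne'])
    have hsq : (u / |u|) ^ 2 = 1 := by
      rw [div_pow, sq_abs, div_self]
      exact pow_ne_zero 2 (abs_pos.1 hu0)
    -- By convexity the divergence at u is at least |u| times the one at u / |u|, so the quadratic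
    -- bound at distance 1 continues linearly.
    have hconv := (convexOn_of_iteratedDeriv_two_nonneg hf h0).2 (Set.mem_univ a)
      (Set.mem_univ (a + u))
      (show 0 ≤ 1 - 1 / |u| by rw [sub_nonneg, div_le_one hu0]; exact hu)
      (show 0 ≤ 1 / |u| by positivity) (by ring)
    simp only [smul_eq_mul] at hconv
    have e : (1 - 1 / |u|) * a + 1 / |u| * (a + u) = a + u / |u| := by ring
    rw [e] at hconv
    rw [hsq, mul_one] at h1
    have h2 : c / 2 ≤ 1 / |u| * (f (a + u) - f a - deriv f a * u) := by
      have : deriv f a * (u / |u|) = 1 / |u| * (deriv f a * u) := by ring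
      linarith
    have h3 : c / 2 * |u| ≤ f (a + u) - f a - deriv f a * u := by
      have := mul_le_mul_of_nonneg_right h2 hu0.le
      rwa [mul_comm (1 / |u|), mul_assoc, one_div_mul_cancel hu0.ne', mul_one] at this
    refine le_trans ?_ h3
    exact mul_le_mul_of_nonneg_left (pseudoHuber_le_abs u) (by positivity)

/-! ### Amenable regularizers -/

namespace IsAmenable

variable {ρ : ℝ → ℝ} {lam μ γ : ℝ}

lemma deriv_neg (h : IsAmenable ρ lam μ γ) (t : ℝ) : deriv ρ (-t) = -deriv ρ t := by
  have e : (fun x => ρ (-x)) = ρ := funext h.symm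
  have := deriv_comp_neg ρ t
  rw [e] at this
  linarith

/-- At the kink `deriv` returns 0, as oddness forces. This value lies between the one-sided slopes
-λ and λ, so monotonicity of ρ' + μt and the bound |ρ'| ≤ λ hold at 0 too. -/
lemma deriv_zero (h : IsAmenable ρ lam μ γ) : deriv ρ 0 = 0 := by
  have := h.deriv_neg 0
  rw [neg_zero] at this
  linarith

lemma hasDerivAt_add (h : IsAmenable ρ lam μ γ) {t : ℝ} (ht : t ≠ 0) :
    HasDerivAt (fun t => ρ t + μ / 2 * t ^ 2) (deriv ρ t + μ * t) t := by
  have h1 := (h.diff t ht).hasDerivAt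
  have h2 := ((hasDerivAt_pow 2 t).const_mul (μ / 2))
  refine (h1.add h2).congr_deriv ?_
  norm_num
  ring

lemma monotone_of_ne_zero (h : IsAmenable ρ lam μ γ) {x y : ℝ} (hx : x ≠ 0) (hy : y ≠ 0)
    (hxy : x ≤ y) : deriv ρ x + μ * x ≤ deriv ρ y + μ * y := by
  rcases hxy.eq_or_lt with rfl | hlt
  · rfl
  exact (h.weakly_convex.le_slope_of_hasDerivAt (Set.mem_univ x) (Set.mem_univ y) hlt
    (h.hasDerivAt_add hx)).trans
    (h.weakly_convex.slope_le_of_hasDerivAt (Set.mem_univ x) (Set.mem_univ y) hlt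
    (h.hasDerivAt_add hy))

/-- Let the left point tend to 0⁺ in the monotonicity of ρ' + μt. This is the pull towards 0 that
the penalty exerts on coordinates off the support. -/
lemma le_deriv_add (h : IsAmenable ρ lam μ γ) {t : ℝ} (ht : 0 < t) :
    lam ≤ deriv ρ t + μ * t := by
  have h1 : Tendsto (fun x => deriv ρ x + μ * x) (𝓝[>] 0) (𝓝 (lam + μ * 0)) := by
    apply h.selection.add
    exact ((continuous_const.mul continuous_id).tendsto 0).mono_left nhdsWithin_le_nhds
  rw [mul_zero, add_zero] at h1
  refine le_of_tendsto h1 ?_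
  filter_upwards [Ioo_mem_nhdsGT ht] with x hx
  exact h.monotone_of_ne_zero hx.1.ne' ht.ne' hx.2.le

lemma deriv_nonneg (h : IsAmenable ρ lam μ γ) {t : ℝ} (ht : 0 < t) : 0 ≤ deriv ρ t := by
  have h1 : deriv ρ t = derivWithin ρ (Set.Ici 0) t :=
    ((h.diff t ht.ne').derivWithin ((uniqueDiffOn_Ici 0) t ht.le)).symm
  rw [h1]
  exact h.mono.derivWithin_nonneg

lemma lam_nonneg (h : IsAmenable ρ lam μ γ) : 0 ≤ lam :=
  ge_of_tendsto h.selection (by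
    filter_upwards [self_mem_nhdsWithin] with x hx
    exact h.deriv_nonneg hx)

lemma monotone_deriv_add (h : IsAmenable ρ lam μ γ) :
    Monotone fun t => deriv ρ t + μ * t := by
  have hpos : ∀ t, 0 < t → 0 ≤ deriv ρ t + μ * t := fun t ht =>
    h.lam_nonneg.trans (h.le_deriv_add ht)
  intro x y hxy
  show deriv ρ x + μ * x ≤ deriv ρ y + μ * y
  rcases eq_or_ne x 0 with rfl | hx
  · rcases hxy.eq_or_lt with rfl | hlt
    · rfl
    simpa [h.deriv_zero] using hpos y hlt
  rcases eq_or_ne y 0 with rfl | hy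
  · have := hpos (-x) (by simpa using lt_of_le_of_ne hxy hx)
    rw [h.deriv_neg] at this
    simp [h.deriv_zero]
    linarith
  exact h.monotone_of_ne_zero hx hy hxy

lemma continuous (h : IsAmenable ρ lam μ γ) : Continuous ρ := by
  have h1 : ContinuousOn (fun t => ρ t + μ / 2 * t ^ 2) Set.univ :=
    h.weakly_convex.continuousOn isOpen_univ
  have h2 := (continuousOn_univ.1 h1).sub (by fun_prop : Continuous fun t : ℝ => μ / 2 * t ^ 2)
  simpa only [add_sub_cancel_right, Pi.sub_def] using h2

/-- As ρ(t)/t is nonincreasing, it suffices to bound it near 0, where the mean value theorem makes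
it a value of ρ' close to λ. -/
lemma div_le (h : IsAmenable ρ lam μ γ) {t : ℝ} (ht : 0 < t) : ρ t / t ≤ lam := by
  refine le_of_forall_pos_le_add fun ε hε => ?_
  have h1 : ∀ᶠ x in 𝓝[>] (0 : ℝ), deriv ρ x < lam + ε :=
    h.selection.eventually (gt_mem_nhds (by linarith))
  obtain ⟨δ, hδ, hδ'⟩ := (mem_nhdsGT_iff_exists_Ioo_subset).1 h1
  set s := min δ t with hs
  have hs0 : 0 < s := lt_min hδ ht
  obtain ⟨c, hc, hc'⟩ := exists_deriv_eq_slope ρ hs0 h.continuous.continuousOn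
    (fun x hx => (h.diff x hx.1.ne').differentiableWithinAt)
  have h2 : deriv ρ c < lam + ε := hδ' ⟨hc.1, hc.2.trans_le (min_le_left _ _)⟩
  rw [h.zero, sub_zero, sub_zero] at hc'
  have h3 := h.ratio_anti (Set.mem_Ioi.2 hs0) (Set.mem_Ioi.2 ht) (min_le_right δ t)
  simp only at h3
  linarith

/-- The derivative of ρ(t)/t is nonpositive, which says ρ'(t) ≤ ρ(t)/t. -/
lemma deriv_le_of_pos (h : IsAmenable ρ lam μ γ) {t : ℝ} (ht : 0 < t) : deriv ρ t ≤ lam := by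
  have hd : HasDerivAt (fun t => ρ t / t) ((deriv ρ t * t - ρ t * 1) / t ^ 2) t :=
    (h.diff t ht.ne').hasDerivAt.div (hasDerivAt_id t) ht.ne'
  have h1 : derivWithin (fun t => ρ t / t) (Set.Ioi 0) t ≤ 0 := h.ratio_anti.derivWithin_nonpos
  rw [hd.differentiableAt.derivWithin ((uniqueDiffOn_Ioi 0) t ht), hd.deriv,
    div_le_iff₀ (by positivity), zero_mul] at h1
  have h2 := h.div_le ht
  rw [div_le_iff₀ ht] at h2
  nlinarith

lemma abs_deriv_le (h : IsAmenable ρ lam μ γ) (t : ℝ) : |deriv ρ t| ≤ lam := by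
  have hpos : ∀ t, 0 < t → |deriv ρ t| ≤ lam := fun t ht => by
    rw [abs_of_nonneg (h.deriv_nonneg ht)]; exact h.deriv_le_of_pos ht
  rcases lt_trichotomy t 0 with ht | rfl | ht
  · have := hpos (-t) (by linarith)
    rwa [h.deriv_neg, abs_neg] at this
  · simp [h.deriv_zero, h.lam_nonneg]
  · exact hpos t ht

lemma deriv_eq_zero_of_le_abs (h : IsAmenable ρ lam μ γ) {t : ℝ} (ht : γ * lam ≤ |t|) :
    deriv ρ t = 0 := by
  rcases abs_cases t with ⟨h1, -⟩ | ⟨h1, -⟩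
  · exact h.unbiased t (h1 ▸ ht)
  · have := h.unbiased (-t) (h1 ▸ ht)
    rw [h.deriv_neg] at this
    linarith

end IsAmenable

/-! ### The `ℓ₁`- and `ℓ₂`-norms -/

section Norms

variable {p : ℕ}

lemma l1Norm_nonneg (v : Fin p → ℝ) : 0 ≤ l1Norm v := Finset.sum_nonneg fun _ _ => abs_nonneg _

lemma l2Norm_nonneg (v : Fin p → ℝ) : 0 ≤ l2Norm v := Real.sqrt_nonneg _

lemma l2Norm_sq (v : Fin p → ℝ) : l2Norm v ^ 2 = ∑ j, v j ^ 2 :=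
  Real.sq_sqrt (Finset.sum_nonneg fun _ _ => sq_nonneg _)

lemma l1Norm_add_le (v w : Fin p → ℝ) : l1Norm (v + w) ≤ l1Norm v + l1Norm w := by
  rw [l1Norm, l1Norm, l1Norm, ← Finset.sum_add_distrib]
  exact Finset.sum_le_sum fun j _ => abs_add_le _ _

lemma l1Norm_neg (v : Fin p → ℝ) : l1Norm (-v) = l1Norm v := by simp [l1Norm]

lemma l1Norm_sub_le (v w : Fin p → ℝ) : l1Norm (v - w) ≤ l1Norm v + l1Norm w := by
  rw [sub_eq_add_neg, ← l1Norm_neg w]; exact l1Norm_add_le v _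

lemma l1Norm_smul (c : ℝ) (v : Fin p → ℝ) : l1Norm (c • v) = |c| * l1Norm v := by
  simp [l1Norm, abs_mul, Finset.mul_sum]

lemma l2Norm_smul (c : ℝ) (v : Fin p → ℝ) : l2Norm (c • v) = |c| * l2Norm v := by
  rw [l2Norm, l2Norm, ← Real.sqrt_sq_eq_abs, ← Real.sqrt_mul (sq_nonneg c)]
  simp [mul_pow, Finset.mul_sum]

lemma l2Norm_eq_zero {v : Fin p → ℝ} : l2Norm v = 0 ↔ v = 0 := by
  constructor
  · intro h
    have h1 := l2Norm_sq v
    rw [h, zero_pow two_ne_zero, eq_comm, Finset.sum_eq_zero_iff_of_nonneg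
      fun _ _ => sq_nonneg _] at h1
    ext j
    exact pow_eq_zero_iff two_ne_zero |>.1 (h1 j (Finset.mem_univ j))
  · rintro rfl; simp [l2Norm]

lemma l2Norm_single (j : Fin p) : l2Norm (Pi.single j (1 : ℝ)) = 1 := by
  rw [l2Norm, Real.sqrt_eq_one, Finset.sum_eq_single j] <;> simp +contextual

lemma dotProduct_le_l2Norm_mul (v w : Fin p → ℝ) : v ⬝ᵥ w ≤ l2Norm v * l2Norm w :=
  Real.sum_mul_le_sqrt_mul_sqrt _ _ _

lemma abs_dotProduct_le_norm_mul_l1Norm (x v : Fin p → ℝ) : |x ⬝ᵥ v| ≤ ‖x‖ * l1Norm v := by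
  rw [l1Norm, Finset.mul_sum]
  refine (Finset.abs_sum_le_sum_abs _ _).trans (Finset.sum_le_sum fun j _ => ?_)
  rw [abs_mul]
  exact mul_le_mul_of_nonneg_right (norm_le_pi_norm x j) (abs_nonneg _)

lemma sum_abs_le_sqrt_mul_l2Norm (S : Finset (Fin p)) {k : ℝ} (hS : (S.card : ℝ) ≤ k)
    (v : Fin p → ℝ) : ∑ j ∈ S, |v j| ≤ Real.sqrt k * l2Norm v := by
  have h0 : 0 ≤ k := le_trans (Nat.cast_nonneg _) hS
  rw [l2Norm, ← Real.sqrt_mul h0]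
  apply Real.le_sqrt_of_sq_le
  refine (sq_sum_le_card_mul_sum_sq).trans ?_
  simp only [sq_abs]
  exact mul_le_mul hS (Finset.sum_le_sum_of_subset_of_nonneg (Finset.subset_univ S)
    fun _ _ _ => sq_nonneg _) (Finset.sum_nonneg fun _ _ => sq_nonneg _) h0

lemma l1Norm_le_sqrt_mul_l2Norm {S : Finset (Fin p)} {k : ℝ} (hS : (S.card : ℝ) ≤ k)
    {v : Fin p → ℝ} (hv : ∀ j, j ∉ S → v j = 0) : l1Norm v ≤ Real.sqrt k * l2Norm v := by
  refine le_trans (le_of_eq ?_) (sum_abs_le_sqrt_mul_l2Norm S hS v)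
  rw [l1Norm]
  exact (Finset.sum_subset (Finset.subset_univ S) fun j _ hj => by simp [hv j hj]).symm

end Norms

/-! ### The generalized linear model -/

lemma ofReal_exp_mul (a b : ℝ) : ENNReal.ofReal (Real.exp a) * ENNReal.ofReal (Real.exp b) =
    ENNReal.ofReal (Real.exp (a + b)) := by
  rw [← ENNReal.ofReal_mul (Real.exp_nonneg _), ← Real.exp_add]

namespace IsGLMFamily

variable {ψ : ℝ → ℝ} {ν : Measure ℝ} {s : ℝ}

lemma measurable_density (ψ : ℝ → ℝ) (s θ : ℝ) :
    Measurable fun y : ℝ => ENNReal.ofReal (Real.exp ((y * θ - ψ θ) / s)) := by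
  fun_prop

/-- A strictly positive density turns ν into a finite measure, and dividing it out again preserves
σ-finiteness. Tonelli's theorem for `glmLaw` needs this. -/
lemma sigmaFinite (h : IsGLMFamily ψ ν s) : SigmaFinite ν := by
  set f : ℝ → ENNReal := fun y => ENNReal.ofReal (Real.exp ((y * 0 - ψ 0) / s)) with hf
  have hfin : IsFiniteMeasure (ν.withDensity f) := isFiniteMeasure_withDensity (by
    rw [h 0]; exact ENNReal.one_ne_top)
  have e : (ν.withDensity f).withDensity (fun x => (f x)⁻¹) = ν :=
    withDensity_inv_same (measurable_density ψ s 0)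
      (ae_of_all _ fun y => by simp [hf, Real.exp_pos]) (ae_of_all _ fun y => by simp [hf])
  rw [← e]
  exact SigmaFinite.withDensity_of_ne_top' fun y => by simp [hf, Real.exp_pos]

/-- Exponential moments of the response. -/
lemma lintegral_exp_mul (h : IsGLMFamily ψ ν s) (hs : 0 < s) (θ τ : ℝ) :
    ∫⁻ y, ENNReal.ofReal (Real.exp ((y * θ - ψ θ) / s)) * ENNReal.ofReal (Real.exp (τ * y)) ∂ν
      = ENNReal.ofReal (Real.exp ((ψ (θ + s * τ) - ψ θ) / s)) := by
  -- Exponential tilting by τ moves the natural parameter from θ to θ + sτ, and the tilted density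
  -- again integrates to 1.
  have e : ∀ y : ℝ, ENNReal.ofReal (Real.exp ((y * θ - ψ θ) / s)) *
      ENNReal.ofReal (Real.exp (τ * y)) =
      ENNReal.ofReal (Real.exp ((ψ (θ + s * τ) - ψ θ) / s)) *
        ENNReal.ofReal (Real.exp ((y * (θ + s * τ) - ψ (θ + s * τ)) / s)) := by
    intro y
    rw [ofReal_exp_mul, ofReal_exp_mul]
    congr 2
    field_simp
    ring
  simp_rw [e]
  rw [lintegral_const_mul _ (measurable_density ψ s _), h, mul_one]

/-- The cumulant function of the tilted family: `ψ'' ≥ 0`, and `ψ''` vanishes identically as soon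
as it vanishes somewhere, because then the base measure is a point mass. -/
lemma iteratedDeriv_two_nonneg_and (h : IsGLMFamily ψ ν s) (hs : 0 < s) (hψ : ContDiff ℝ 2 ψ) :
    (∀ t, 0 ≤ iteratedDeriv 2 ψ t) ∧
      ((∃ t, iteratedDeriv 2 ψ t = 0) → ∀ t, iteratedDeriv 2 ψ t = 0) := by
  set f : ℝ → ENNReal := fun y => ENNReal.ofReal (Real.exp ((y * 0 - ψ 0) / s)) with hf
  set μ := ν.withDensity f with hμ
  have hprob : IsProbabilityMeasure μ := ⟨by
    rw [hμ, withDensity_apply _ MeasurableSet.univ, setLIntegral_univ]; exact h 0⟩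
  have hlint : ∀ t : ℝ, ∫⁻ y, ENNReal.ofReal (Real.exp (t * y)) ∂μ =
      ENNReal.ofReal (Real.exp ((ψ (s * t) - ψ 0) / s)) := by
    intro t
    rw [hμ, lintegral_withDensity_eq_lintegral_mul _ (measurable_density ψ s 0) (by fun_prop)]
    have := h.lintegral_exp_mul hs 0 t
    rw [zero_add] at this
    exact this
  have hint : ∀ t : ℝ, Integrable (fun y : ℝ => Real.exp (t * y)) μ := fun t => by
    refine ⟨by fun_prop, ?_⟩
    rw [hasFiniteIntegral_iff_ofReal (ae_of_all _ fun _ => Real.exp_nonneg _), hlint]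
    exact ENNReal.ofReal_lt_top
  have hmgf : ∀ t : ℝ, ProbabilityTheory.mgf id μ t = Real.exp ((ψ (s * t) - ψ 0) / s) := by
    intro t
    rw [ProbabilityTheory.mgf, integral_eq_lintegral_of_nonneg_ae
      (ae_of_all _ fun _ => Real.exp_nonneg _) (by fun_prop)]
    simp only [id]
    rw [hlint, ENNReal.toReal_ofReal (Real.exp_nonneg _)]
  have hcgf : ProbabilityTheory.cgf id μ = fun t => s⁻¹ * (ψ (s * t) - ψ 0) := by
    ext t
    rw [ProbabilityTheory.cgf, hmgf, Real.log_exp]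
    ring
  have hder : ∀ t, iteratedDeriv 2 (ProbabilityTheory.cgf id μ) t
      = s * iteratedDeriv 2 ψ (s * t) := by
    intro t
    have hcomp : ContDiff ℝ 2 fun t => ψ (s * t) := hψ.comp (contDiff_const.mul contDiff_id)
    rw [hcgf, iteratedDeriv_const_mul_field,
      iteratedDeriv_fun_sub hcomp.contDiffAt contDiffAt_const,
      iteratedDeriv_comp_const_mul hψ]
    simp [iteratedDeriv_const]
    field_simp
  have hmem : ∀ t, t ∈ interior (ProbabilityTheory.integrableExpSet id μ) := by
    intro t
    have : ProbabilityTheory.integrableExpSet id μ = Set.univ :=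
      Set.eq_univ_of_forall fun t => hint t
    simp [this]
  -- The second derivative of the cumulant generating function is the variance of the tilted law;
  -- this gives ψ'' ≥ 0.
  have hvar : ∀ t, ProbabilityTheory.variance id (μ.tilted (t * id ·)) =
      s * iteratedDeriv 2 ψ (s * t) := fun t => by
    rw [ProbabilityTheory.variance_tilted_mul (hmem t), hder]
  have hst : ∀ t, s * (t / s) = t := fun t => by field_simp
  refine ⟨fun t => ?_, ?_⟩
  · have h1 := ProbabilityTheory.variance_nonneg id (μ.tilted ((t / s) * id ·))
    rw [hvar, hst] at h1
    exact nonneg_of_mul_nonneg_right h1 hs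
  · rintro ⟨t₀, ht₀⟩ t
    have h0 : ProbabilityTheory.variance id (μ.tilted ((t₀ / s) * id ·)) = 0 := by
      rw [hvar, hst, ht₀, mul_zero]
    have hpt : IsProbabilityMeasure (μ.tilted ((t₀ / s) * id ·)) :=
      isProbabilityMeasure_tilted (hint _)
    have h1 := ProbabilityTheory.ae_eq_integral_of_variance_eq_zero
      (ProbabilityTheory.memLp_tilted_mul (hmem (t₀ / s)) 2) h0
    -- The base law is absolutely continuous with respect to its tilt, so the response is also
    -- constant under the base law, and the cumulant generating function is linear.
    have h2 := (absolutelyContinuous_tilted (hint (t₀ / s))).ae_eq h1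
    set m := ∫ y, id y ∂(μ.tilted ((t₀ / s) * id ·))
    have hc : ProbabilityTheory.cgf id μ = fun t => m * t := by
      ext t
      have : ProbabilityTheory.mgf id μ t = Real.exp (m * t) := by
        rw [ProbabilityTheory.mgf, integral_congr_ae
          (h2.mono fun y hy => show Real.exp (t * id y) = Real.exp (m * t) by
            rw [hy, mul_comm])]
        simp
      rw [ProbabilityTheory.cgf, this, Real.log_exp]
    have h3 := hder (t / s)
    rw [hst, hc, iteratedDeriv_const_mul_field] at h3
    have h4 : iteratedDeriv 2 (fun x : ℝ => x) (t / s) = 0 := by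
      simp [iteratedDeriv_succ]
    rw [h4, mul_zero] at h3
    exact (mul_eq_zero.1 h3.symm).resolve_left hs.ne'

end IsGLMFamily

section GLMLaw

variable {p : ℕ} {ψ : ℝ → ℝ} {ν : Measure ℝ} {s : ℝ} {P : Measure (Fin p → ℝ)}

lemma measurable_glmDensity (hψ : Continuous ψ) (β : Fin p → ℝ) :
    Measurable fun z : (Fin p → ℝ) × ℝ =>
      ENNReal.ofReal (Real.exp ((z.2 * (z.1 ⬝ᵥ β) - ψ (z.1 ⬝ᵥ β)) / s)) := by
  have : Continuous fun z : (Fin p → ℝ) × ℝ => z.1 ⬝ᵥ β := by unfold dotProduct; fun_prop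
  fun_prop

lemma lintegral_glmLaw [SFinite P] (h : IsGLMFamily ψ ν s) (hψ : Continuous ψ) (β : Fin p → ℝ)
    {F : (Fin p → ℝ) × ℝ → ENNReal} (hF : Measurable F) :
    ∫⁻ z, F z ∂(glmLaw ψ ν s P β) = ∫⁻ x, ∫⁻ y,
      ENNReal.ofReal (Real.exp ((y * (x ⬝ᵥ β) - ψ (x ⬝ᵥ β)) / s)) * F (x, y) ∂ν ∂P := by
  have := h.sigmaFinite
  rw [glmLaw, lintegral_withDensity_eq_lintegral_mul _ (measurable_glmDensity hψ β) hF,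
    lintegral_prod _ ((measurable_glmDensity hψ β).mul hF).aemeasurable]
  rfl

variable [IsProbabilityMeasure P]

lemma lintegral_glmLaw_fst (h : IsGLMFamily ψ ν s) (hψ : Continuous ψ) (β : Fin p → ℝ)
    {g : (Fin p → ℝ) → ENNReal} (hg : Measurable g) :
    ∫⁻ z, g z.1 ∂(glmLaw ψ ν s P β) = ∫⁻ x, g x ∂P := by
  rw [lintegral_glmLaw h hψ β (F := fun z => g z.1) (hg.comp measurable_fst)]
  refine lintegral_congr fun x => ?_
  rw [lintegral_mul_const (g x) (IsGLMFamily.measurable_density ψ s _), h, one_mul]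

lemma isProbabilityMeasure_glmLaw (h : IsGLMFamily ψ ν s) (hψ : Continuous ψ)
    (β : Fin p → ℝ) : IsProbabilityMeasure (glmLaw ψ ν s P β) := ⟨by
  have := lintegral_glmLaw_fst (P := P) h hψ β (g := fun _ => 1) measurable_const
  simpa using this⟩

lemma map_fst_glmLaw (h : IsGLMFamily ψ ν s) (hψ : Continuous ψ) (β : Fin p → ℝ) :
    (glmLaw ψ ν s P β).map Prod.fst = P := by
  ext A hA
  rw [Measure.map_apply measurable_fst hA]
  have := lintegral_glmLaw_fst (P := P) h hψ β (g := A.indicator 1)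
    (measurable_one.indicator hA)
  rw [lintegral_indicator_one hA] at this
  rw [← this, ← lintegral_indicator_one (measurable_fst hA)]
  rfl

lemma continuous_dotProduct_left (u : Fin p → ℝ) : Continuous fun x : Fin p → ℝ => x ⬝ᵥ u := by
  unfold dotProduct; fun_prop

/-- The conditional moment generating function of the score is sub-Gaussian. -/
lemma lintegral_exp_score_le (h : IsGLMFamily ψ ν s) (hs : 0 < s) (hψ : ContDiff ℝ 2 ψ)
    {κ : ℝ} (hκ : ∀ t, |iteratedDeriv 2 ψ t| ≤ κ) (β u : Fin p → ℝ) (t : ℝ) :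
    ∫⁻ z, ENNReal.ofReal (Real.exp (t * ((z.1 ⬝ᵥ u) * (z.2 - deriv ψ (z.1 ⬝ᵥ β)))))
        ∂(glmLaw ψ ν s P β)
      ≤ ∫⁻ x, ENNReal.ofReal (Real.exp (κ * s * t ^ 2 / 2 * (x ⬝ᵥ u) ^ 2)) ∂P := by
  have hd : Continuous (deriv ψ) := hψ.continuous_deriv (by norm_num)
  have c1 := (continuous_dotProduct_left u).comp (continuous_fst (X := Fin p → ℝ) (Y := ℝ))
  have c2 := (continuous_dotProduct_left β).comp (continuous_fst (X := Fin p → ℝ) (Y := ℝ))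
  simp only [Function.comp_def] at c1 c2
  rw [lintegral_glmLaw h hψ.continuous β (by fun_prop)]
  refine lintegral_mono fun x => ?_
  set θ := x ⬝ᵥ β
  set τ := t * (x ⬝ᵥ u) with hτ
  have e : ∀ y : ℝ, ENNReal.ofReal (Real.exp ((y * θ - ψ θ) / s)) *
      ENNReal.ofReal (Real.exp (t * ((x ⬝ᵥ u) * (y - deriv ψ θ)))) =
      ENNReal.ofReal (Real.exp (-(τ * deriv ψ θ))) *
      (ENNReal.ofReal (Real.exp ((y * θ - ψ θ) / s)) * ENNReal.ofReal (Real.exp (τ * y))) := by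
    intro y
    rw [ofReal_exp_mul, ofReal_exp_mul, ofReal_exp_mul]
    congr 2
    rw [hτ]; ring
  refine (lintegral_congr e).trans_le ?_
  rw [lintegral_const_mul _ (by fun_prop),
    h.lintegral_exp_mul hs, ← ENNReal.ofReal_mul (Real.exp_nonneg _), ← Real.exp_add]
  apply ENNReal.ofReal_le_ofReal
  apply Real.exp_le_exp.2
  -- The centred conditional log-mgf is a first-order Taylor remainder of ψ, hence at most κ s τ² /
  -- 2.
  have h1 := (abs_le.1 (taylor_one_le hψ hκ θ (s * τ))).2
  have h2 : (ψ (θ + s * τ) - ψ θ) / s ≤ κ * s * τ ^ 2 / 2 + τ * deriv ψ θ := by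
    rw [div_le_iff₀ hs]
    nlinarith
  have h3 : κ * s * τ ^ 2 / 2 = κ * s * t ^ 2 / 2 * (x ⬝ᵥ u) ^ 2 := by rw [hτ]; ring
  linarith

end GLMLaw

/-! ### Moments of sub-Gaussian vectors -/

section SubGaussian

variable {p : ℕ} {P : Measure (Fin p → ℝ)} [IsProbabilityMeasure P] {σ : ℝ}

/-- For 0 ≤ b ≤ 1, convexity gives exp(bZ) ≤ 1 - b + b exp(Z); since E exp(Z) ≤ 2, the mean is at
most 1 + b ≤ exp(b). -/
lemma IsSubGaussianVector.lintegral_exp_le (h : IsSubGaussianVector P σ) (hσ : 0 < σ)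
    {u : Fin p → ℝ} {V a : ℝ} (hV : 0 < V) (hu : l2Norm u ≤ V) (ha0 : 0 ≤ a)
    (ha1 : a * (V ^ 2 * σ ^ 2) ≤ 1) :
    ∫⁻ x, ENNReal.ofReal (Real.exp (a * (x ⬝ᵥ u) ^ 2)) ∂P
      ≤ ENNReal.ofReal (Real.exp (a * (V ^ 2 * σ ^ 2))) := by
  set b := a * (V ^ 2 * σ ^ 2) with hb
  have hb0 : 0 ≤ b := by positivity
  have hw : l2Norm (V⁻¹ • u) ≤ 1 := by
    rw [l2Norm_smul, abs_of_pos (inv_pos.2 hV), inv_mul_le_iff₀ hV, mul_one]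
    exact hu
  have hw2 := h _ hw
  have hpt : ∀ x : Fin p → ℝ, ENNReal.ofReal (Real.exp (a * (x ⬝ᵥ u) ^ 2)) ≤
      ENNReal.ofReal (1 - b) + ENNReal.ofReal b *
        ENNReal.ofReal (Real.exp ((x ⬝ᵥ (V⁻¹ • u)) ^ 2 / σ ^ 2)) := by
    intro x
    set Z := (x ⬝ᵥ (V⁻¹ • u)) ^ 2 / σ ^ 2 with hZ
    have e : a * (x ⬝ᵥ u) ^ 2 = b * Z := by
      rw [hZ, hb, dotProduct_smul, smul_eq_mul]
      field_simp
    rw [e, ← ENNReal.ofReal_mul hb0, ← ENNReal.ofReal_add (by linarith) (by positivity)]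
    apply ENNReal.ofReal_le_ofReal
    have := convexOn_exp.2 (Set.mem_univ 0) (Set.mem_univ Z) (show 0 ≤ 1 - b by linarith) hb0
      (by ring)
    simpa using this
  refine (lintegral_mono hpt).trans ?_
  rw [lintegral_add_left measurable_const, lintegral_const, lintegral_const_mul' _ _ (by simp)]
  have h2 : (2 : ENNReal) = ENNReal.ofReal 2 := by simp
  calc _ ≤ ENNReal.ofReal (1 - b) + ENNReal.ofReal b * ENNReal.ofReal 2 := by
        rw [← h2]; simp only [measure_univ, mul_one]; gcongr
    _ = ENNReal.ofReal (1 + b) := by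
        rw [← ENNReal.ofReal_mul hb0, ← ENNReal.ofReal_add (by linarith) (by positivity)]
        congr 1; ring
    _ ≤ _ := ENNReal.ofReal_le_ofReal (by linarith [Real.add_one_le_exp b])

lemma integrable_of_continuous_of_norm_le {M : ℝ} (hM : ∀ᵐ x ∂P, ‖x‖ ≤ M)
    {f : (Fin p → ℝ) → ℝ} (hf : Continuous f) : Integrable f P := by
  obtain ⟨C, hC⟩ := (isCompact_closedBall (0 : Fin p → ℝ) M).exists_bound_of_continuousOn
    hf.continuousOn
  refine Integrable.of_bound hf.aestronglyMeasurable C ?_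
  filter_upwards [hM] with x hx
  exact hC x (by simpa using hx)

/-- Converts the Orlicz bound into moments: a term of the exponential series beyond the leading 1
has mean at most 1. The linear and quadratic terms give the second and fourth moments. -/
lemma IsSubGaussianVector.integral_add_le (h : IsSubGaussianVector P σ)
    {w : Fin p → ℝ} (hw : l2Norm w ≤ 1) {f : (Fin p → ℝ) → ℝ} (hf : Integrable f P)
    (hf0 : ∀ x, 0 ≤ f x)
    (hle : ∀ x, 1 + f x ≤ Real.exp ((x ⬝ᵥ w) ^ 2 / σ ^ 2)) : ∫ x, f x ∂P ≤ 1 := by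
  have h1 : ENNReal.ofReal (∫ x, (1 + f x) ∂P) ≤ 2 := by
    rw [ofReal_integral_eq_lintegral_ofReal (f := fun x => 1 + f x) ((integrable_const 1).add hf)
      (ae_of_all _ fun x => add_nonneg zero_le_one (hf0 x))]
    exact (lintegral_mono fun x => ENNReal.ofReal_le_ofReal (hle x)).trans (h w hw)
  rw [integral_add (integrable_const 1) hf] at h1
  have h2 : (2 : ENNReal) = ENNReal.ofReal 2 := by simp
  rw [h2, ENNReal.ofReal_le_ofReal_iff (by norm_num)] at h1
  simp at h1
  linarith

lemma IsSubGaussianVector.integral_sq_le (h : IsSubGaussianVector P σ) (hσ : 0 < σ) {M : ℝ}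
    (hM : ∀ᵐ x ∂P, ‖x‖ ≤ M) (u : Fin p → ℝ) :
    ∫ x, (x ⬝ᵥ u) ^ 2 ∂P ≤ σ ^ 2 * l2Norm u ^ 2 := by
  rcases (l2Norm_nonneg u).eq_or_lt with h0 | h0
  · have : u = 0 := l2Norm_eq_zero.1 h0.symm
    simp [this, l2Norm]
  have hw : l2Norm ((l2Norm u)⁻¹ • u) ≤ 1 := by
    rw [l2Norm_smul, abs_of_pos (inv_pos.2 h0), inv_mul_cancel₀ h0.ne']
  have hc := continuous_dotProduct_left u
  have h1 := h.integral_add_le hw (f := fun x => (x ⬝ᵥ u) ^ 2 / (σ ^ 2 * l2Norm u ^ 2))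
    (integrable_of_continuous_of_norm_le hM (by fun_prop)) (fun x => by positivity)
    (fun x => by
      have e : (x ⬝ᵥ ((l2Norm u)⁻¹ • u)) ^ 2 / σ ^ 2 =
          (x ⬝ᵥ u) ^ 2 / (σ ^ 2 * l2Norm u ^ 2) := by
        rw [dotProduct_smul, smul_eq_mul]; field_simp
      rw [e, add_comm]
      exact Real.add_one_le_exp _)
  rw [integral_div, div_le_one (by positivity)] at h1
  exact h1

lemma IsSubGaussianVector.integral_pow_four_le (h : IsSubGaussianVector P σ) (hσ : 0 < σ) {M : ℝ}
    (hM : ∀ᵐ x ∂P, ‖x‖ ≤ M) (u : Fin p → ℝ) :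
    ∫ x, (x ⬝ᵥ u) ^ 4 ∂P ≤ 2 * σ ^ 4 * l2Norm u ^ 4 := by
  rcases (l2Norm_nonneg u).eq_or_lt with h0 | h0
  · have : u = 0 := l2Norm_eq_zero.1 h0.symm
    simp [this, l2Norm]
  have hw : l2Norm ((l2Norm u)⁻¹ • u) ≤ 1 := by
    rw [l2Norm_smul, abs_of_pos (inv_pos.2 h0), inv_mul_cancel₀ h0.ne']
  have hc := continuous_dotProduct_left u
  have h1 := h.integral_add_le hw (f := fun x => (x ⬝ᵥ u) ^ 4 / (2 * σ ^ 4 * l2Norm u ^ 4))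
    (integrable_of_continuous_of_norm_le hM (by fun_prop)) (fun x => by positivity)
    (fun x => by
      set Z := (x ⬝ᵥ ((l2Norm u)⁻¹ • u)) ^ 2 / σ ^ 2 with hZ
      have e : (x ⬝ᵥ u) ^ 4 / (2 * σ ^ 4 * l2Norm u ^ 4) = Z ^ 2 / 2 := by
        rw [hZ, dotProduct_smul, smul_eq_mul]; field_simp
      have hZ0 : 0 ≤ Z := by positivity
      rw [e]
      linarith [Real.quadratic_le_exp_of_nonneg hZ0])
  rw [integral_div, div_le_one (by positivity)] at h1
  exact h1

end SubGaussian

/-! ### Concentration of empirical averages -/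

section Chernoff

variable {X : Type*} [MeasurableSpace X] {Q : Measure X}

lemma lintegral_exp_le_of_integral_le {f : X → ℝ} {g : X → ℝ} (hg : Integrable g Q)
    (hfg : ∀ᵐ x ∂Q, Real.exp (f x) ≤ g x) {a : ℝ} (hga : ∫ x, g x ∂Q ≤ 1 + a) :
    ∫⁻ x, ENNReal.ofReal (Real.exp (f x)) ∂Q ≤ ENNReal.ofReal (Real.exp a) := by
  have h0 : 0 ≤ᵐ[Q] g := hfg.mono fun x hx => (Real.exp_nonneg _).trans hx
  calc _ ≤ ∫⁻ x, ENNReal.ofReal (g x) ∂Q :=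
        lintegral_mono_ae (hfg.mono fun x hx => ENNReal.ofReal_le_ofReal hx)
    _ = ENNReal.ofReal (∫ x, g x ∂Q) := (ofReal_integral_eq_lintegral_ofReal hg h0).symm
    _ ≤ _ := ENNReal.ofReal_le_ofReal (hga.trans (by linarith [Real.add_one_le_exp a]))

variable [IsProbabilityMeasure Q]

/-- Markov's inequality for the exponential of the sum, whose mean factorizes by independence. The
tilting parameter is absorbed into f. -/
lemma pi_sum_ge_le (n : ℕ) {f : X → ℝ} (hf : Measurable f) {a : ℝ} (b : ℝ)
    (h : ∫⁻ x, ENNReal.ofReal (Real.exp (f x)) ∂Q ≤ ENNReal.ofReal (Real.exp a)) :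
    Measure.pi (fun _ : Fin n => Q) {z | n * b ≤ ∑ i, f (z i)}
      ≤ ENNReal.ofReal (Real.exp (n * (a - b))) := by
  have hint : Integrable (fun x => Real.exp (f x)) Q := by
    refine ⟨by fun_prop, ?_⟩
    rw [hasFiniteIntegral_iff_ofReal (ae_of_all _ fun _ => Real.exp_nonneg _)]
    exact h.trans_lt ENNReal.ofReal_lt_top
  have hle : ∫ x, Real.exp (f x) ∂Q ≤ Real.exp a := by
    rw [← ENNReal.ofReal_le_ofReal_iff (Real.exp_nonneg _), ofReal_integral_eq_lintegral_ofReal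
      hint (ae_of_all _ fun _ => Real.exp_nonneg _)]
    exact h
  have hprod : Integrable (fun z : Fin n → X => ∏ i, Real.exp (f (z i)))
      (Measure.pi fun _ => Q) := Integrable.fintype_prod fun _ => hint
  have hI : ∫ z : Fin n → X, ∏ i, Real.exp (f (z i)) ∂(Measure.pi fun _ => Q)
      ≤ Real.exp (n * a) := by
    rw [integral_fintype_prod_eq_pow (fun x => Real.exp (f x)), Fintype.card_fin, Real.exp_nat_mul]
    exact pow_le_pow_left₀ (integral_nonneg fun _ => Real.exp_nonneg _) hle n
  have hM := mul_meas_ge_le_integral_of_nonneg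
    (ae_of_all _ fun z : Fin n → X => Finset.prod_nonneg fun i _ => Real.exp_nonneg (f (z i)))
    hprod (Real.exp (n * b))
  have hset : {z : Fin n → X | Real.exp (n * b) ≤ ∏ i, Real.exp (f (z i))} =
      {z | n * b ≤ ∑ i, f (z i)} := by
    ext z
    simp only [Set.mem_ofPred_eq, ← Real.exp_sum, Real.exp_le_exp]
  rw [hset] at hM
  rw [← ofReal_measureReal]
  apply ENNReal.ofReal_le_ofReal
  rw [mul_sub, Real.exp_sub, le_div_iff₀ (Real.exp_pos _), mul_comm]
  exact hM.trans hI

/-- A two-sided Chernoff bound for averages of sub-Gaussian random variables. -/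
lemma pi_abs_average_gt_le {n : ℕ} (hn : 0 < n) {w : X → ℝ} (hw : Measurable w) {ε K C : ℝ}
    (hε : 0 < ε)
    (h : ∀ t, |t| = ε → ∫⁻ x, ENNReal.ofReal (Real.exp (t * w x)) ∂Q
      ≤ ENNReal.ofReal (Real.exp (K * ε ^ 2))) :
    Measure.pi (fun _ : Fin n => Q) {z | C * ε < |1 / (n : ℝ) * ∑ i, w (z i)|}
      ≤ ENNReal.ofReal (2 * Real.exp ((K - C) * (n * ε ^ 2))) := by
  have hn' : (0 : ℝ) < n := Nat.cast_pos.2 hn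
  -- The tilting parameter is ε itself; with n ε² = log p the tail becomes a power of p.
  have h1 := pi_sum_ge_le n (hw.const_mul ε) (C * ε ^ 2) (h ε (abs_of_pos hε))
  have h2 := pi_sum_ge_le n (hw.const_mul (-ε)) (C * ε ^ 2) (h (-ε) (by simp [abs_of_pos hε]))
  have hsub : {z : Fin n → X | C * ε < |1 / (n : ℝ) * ∑ i, w (z i)|} ⊆
      {z | n * (C * ε ^ 2) ≤ ∑ i, ε * w (z i)} ∪ {z | n * (C * ε ^ 2) ≤ ∑ i, -ε * w (z i)} := by
    intro z hz
    simp only [Set.mem_ofPred_eq, Set.mem_union, ← Finset.mul_sum] at hz ⊢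
    rcases lt_abs.1 hz with hz | hz
    · left
      rw [one_div, lt_inv_mul_iff₀ hn'] at hz
      nlinarith
    · right
      rw [one_div, ← mul_neg, lt_inv_mul_iff₀ hn'] at hz
      nlinarith
  refine (measure_mono hsub).trans ((measure_union_le _ _).trans ((add_le_add h1 h2).trans ?_))
  rw [← ENNReal.ofReal_add (Real.exp_nonneg _) (Real.exp_nonneg _), ← two_mul]
  apply le_of_eq
  congr 3
  ring

/-- Use exp y ≤ 1 + y + y² for |y| ≤ 1; the linear term has mean zero after centring. -/
lemma lintegral_exp_bounded_le {f : X → ℝ} (hf : Measurable f) {b t : ℝ}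
    (hb : ∀ᵐ x ∂Q, |f x| ≤ b) (ht : |t| * (2 * b) ≤ 1) :
    ∫⁻ x, ENNReal.ofReal (Real.exp (t * (f x - ∫ x, f x ∂Q))) ∂Q
      ≤ ENNReal.ofReal (Real.exp ((2 * b) ^ 2 * |t| ^ 2)) := by
  have hfi : Integrable f Q := Integrable.of_bound hf.aestronglyMeasurable b
    (by simpa [Real.norm_eq_abs] using hb)
  set m := ∫ x, f x ∂Q with hm
  have hmb : |m| ≤ b := by
    have := norm_integral_le_of_norm_le_const (μ := Q) (f := f) (C := b)
      (by simpa [Real.norm_eq_abs] using hb)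
    simpa using this
  have hi : Integrable (fun x => t * (f x - m)) Q := (hfi.sub (integrable_const m)).const_mul t
  refine lintegral_exp_le_of_integral_le
    (g := fun x => 1 + (2 * b) ^ 2 * |t| ^ 2 + t * (f x - m))
    ((integrable_const _).add hi) ?_ ?_
  · filter_upwards [hb] with x hx
    have h1 : |f x - m| ≤ 2 * b := (abs_sub _ _).trans (by linarith)
    have h2 : |t * (f x - m)| ≤ |t| * (2 * b) := by
      rw [abs_mul]; exact mul_le_mul_of_nonneg_left h1 (abs_nonneg t)
    have h3 := (abs_le.1 (Real.abs_exp_sub_one_sub_id_le (h2.trans ht))).2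
    have h4 : (t * (f x - m)) ^ 2 ≤ (|t| * (2 * b)) ^ 2 := by
      rw [← sq_abs (t * (f x - m))]; exact pow_le_pow_left₀ (abs_nonneg _) h2 2
    rw [mul_pow] at h4
    linarith
  · rw [integral_add (integrable_const _) hi, integral_const_mul,
      integral_sub hfi (integrable_const m)]
    simp [← hm]

/-- Multiply by exp y ≥ 1 + y + y²/2 and note (1 - y + y²/2)(1 + y + y²/2) = 1 + y⁴/4. -/
lemma exp_neg_le_quadratic {y : ℝ} (hy : 0 ≤ y) : Real.exp (-y) ≤ 1 - y + y ^ 2 / 2 := by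
  have h1 := Real.quadratic_le_exp_of_nonneg hy
  rw [Real.exp_neg, inv_le_iff_one_le_mul₀ (Real.exp_pos y)]
  have h2 : 0 ≤ 1 - y + y ^ 2 / 2 := by nlinarith [sq_nonneg (y - 1)]
  have h3 := mul_le_mul_of_nonneg_left h1 h2
  nlinarith [sq_nonneg (y ^ 2)]

/-- The lower tail of an average of nonnegative random variables. -/
lemma pi_average_le_le (n : ℕ) {f : X → ℝ} (hf : Measurable f) (hf0 : ∀ x, 0 ≤ f x)
    (hfi : Integrable f Q) (hfi2 : Integrable (fun x => f x ^ 2) Q) {e m : ℝ} (he : 0 < e)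
    (hm : 0 < m) (h1 : e ≤ ∫ x, f x ∂Q) (h2 : ∫ x, f x ^ 2 ∂Q ≤ m) :
    Measure.pi (fun _ : Fin n => Q) {z | ∑ i, f (z i) ≤ n * (e / 2)}
      ≤ ENNReal.ofReal (Real.exp (-(e ^ 2 / (8 * m)) * n)) := by
  -- The minimizer of the Chernoff exponent -te/2 + t²m/2.
  set t := e / (2 * m) with ht
  have ht0 : 0 < t := by positivity
  have hi : Integrable (fun x => 1 + (-t) * f x) Q := (integrable_const _).add (hfi.const_mul _)
  have hexp : ∫⁻ x, ENNReal.ofReal (Real.exp (-t * f x)) ∂Q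
      ≤ ENNReal.ofReal (Real.exp (-t * e + t ^ 2 / 2 * m)) := by
    refine lintegral_exp_le_of_integral_le
      (g := fun x => 1 + (-t) * f x + t ^ 2 / 2 * f x ^ 2)
      (hi.add (hfi2.const_mul _)) ?_ ?_
    · refine ae_of_all _ fun x => ?_
      have := exp_neg_le_quadratic (mul_nonneg ht0.le (hf0 x))
      rw [neg_mul]
      nlinarith
    · rw [integral_add hi (hfi2.const_mul _),
        integral_add (integrable_const _) (hfi.const_mul _), integral_const_mul,
        integral_const_mul]
      simp only [integral_const, probReal_univ, smul_eq_mul, mul_one]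
      nlinarith [mul_le_mul_of_nonneg_left h1 ht0.le,
        mul_le_mul_of_nonneg_left h2 (by positivity : 0 ≤ t ^ 2 / 2)]
  have h3 := pi_sum_ge_le n (hf.const_mul (-t)) (-t * (e / 2)) hexp
  refine (measure_mono fun z hz => ?_).trans (h3.trans (le_of_eq ?_))
  · simp only [Set.mem_ofPred_eq, ← Finset.mul_sum] at hz ⊢
    nlinarith
  · congr 2
    rw [ht]; field_simp; ring

end Chernoff

/-! ### Sparse approximation of the `ℓ₁`-ball -/

section Maurey

variable {p : ℕ}

/-- The vertices `± r eⱼ` of the `ℓ₁`-ball of radius `r`. -/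
def l1Vertex (r : ℝ) (a : Fin p × Bool) : Fin p → ℝ :=
  Pi.single a.1 (if a.2 then r else -r)

lemma l1Norm_l1Vertex {r : ℝ} (hr : 0 ≤ r) (a : Fin p × Bool) : l1Norm (l1Vertex r a) = r := by
  rw [l1Norm, Finset.sum_eq_single a.1]
  · rcases a with ⟨j, b⟩
    cases b <;> simp [l1Vertex, abs_of_nonneg hr]
  · intro j _ hj; simp [l1Vertex, hj]
  · simp

/-- A linear functional on the `ℓ₁`-ball is minimized at a vertex. -/
lemma exists_l1Vertex_le [NeZero p] {r : ℝ} {v : Fin p → ℝ} (hv : l1Norm v ≤ r)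
    (ℓ : (Fin p → ℝ) →ₗ[ℝ] ℝ) : ∃ a, ℓ (l1Vertex r a) ≤ ℓ v := by
  have hr : 0 ≤ r := (l1Norm_nonneg v).trans hv
  obtain ⟨j, -, hj⟩ := Finset.exists_max_image Finset.univ
    (fun j : Fin p => |ℓ (Pi.single j 1)|) ⟨0, Finset.mem_univ _⟩
  have hsum : ℓ v = ∑ i, v i * ℓ (Pi.single i 1) := by
    conv_lhs => rw [pi_eq_sum_univ' v, map_sum]
    simp [smul_eq_mul]
  have hlow : -(r * |ℓ (Pi.single j 1)|) ≤ ℓ v := by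
    rw [hsum]
    refine le_trans ?_ (neg_abs_le _)
    refine neg_le_neg ((Finset.abs_sum_le_sum_abs _ _).trans ?_)
    calc _ ≤ ∑ i, |v i| * |ℓ (Pi.single j 1)| := Finset.sum_le_sum fun i hi => by
          rw [abs_mul]; exact mul_le_mul_of_nonneg_left (hj i hi) (abs_nonneg _)
      _ ≤ _ := by
          rw [← Finset.sum_mul]
          exact mul_le_mul_of_nonneg_right hv (abs_nonneg _)
  have hval : ∀ c : ℝ, ℓ (Pi.single j c) = c * ℓ (Pi.single j 1) := fun c => by
    rw [← smul_eq_mul, ← map_smul, ← Pi.single_smul]; simp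
  rcases abs_cases (ℓ (Pi.single j 1)) with ⟨h1, -⟩ | ⟨h1, -⟩
  · refine ⟨(j, false), le_trans (le_of_eq ?_) hlow⟩
    simp only [l1Vertex, Bool.false_eq_true, if_false]
    rw [hval, h1]; ring
  · refine ⟨(j, true), le_trans (le_of_eq ?_) hlow⟩
    simp only [l1Vertex, if_true]
    rw [hval, h1]; ring

/-- The averages of `m` vertices of the `ℓ₁`-ball. -/
noncomputable def vertexAverage (r : ℝ) {m : ℕ} (J : Fin m → Fin p × Bool) : Fin p → ℝ :=
  (m : ℝ)⁻¹ • ∑ i, l1Vertex r (J i)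

/-- Maurey's empirical method: a function that is smooth with respect to the `ℓ₁`-norm is almost
as small at some average of `m` vertices as at a given point of the `ℓ₁`-ball. -/
lemma exists_vertexAverage_le [NeZero p] {G : (Fin p → ℝ) → ℝ} {D : ℝ} (hD : 0 ≤ D)
    (hG : ∀ u, ∃ ℓ : (Fin p → ℝ) →ₗ[ℝ] ℝ, ∀ z, G (u + z) ≤ G u + ℓ z + D * l1Norm z ^ 2)
    {r : ℝ} {v : Fin p → ℝ} (hv : l1Norm v ≤ r) {m : ℕ} (hm : 0 < m) :
    ∃ J : Fin m → Fin p × Bool, G (vertexAverage r J) ≤ G v + 4 * D * r ^ 2 / m := by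
  have hr : 0 ≤ r := (l1Norm_nonneg v).trans hv
  have hm' : (0 : ℝ) < m := Nat.cast_pos.2 hm
  -- A greedy form of Maurey's argument: one m-th of v at a time is replaced by a vertex chosen so
  -- that the linear term is nonpositive. Each step has ℓ₁-length at most 2r/m, so only the
  -- quadratic cost D(2r/m)² accumulates.
  have key : ∀ l : ℕ, l ≤ m → ∃ J : Fin l → Fin p × Bool,
      G ((m : ℝ)⁻¹ • ∑ i, l1Vertex r (J i) + (((m : ℝ) - l) / m) • v)
        ≤ G v + l * (D * (2 * r / m) ^ 2) := by
    intro l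
    induction l with
    | zero =>
      intro _
      refine ⟨Fin.elim0, le_of_eq ?_⟩
      simp [div_self hm'.ne']
    | succ l ih =>
      intro hl
      obtain ⟨J, hJ⟩ := ih (Nat.le_of_succ_le hl)
      set u := (m : ℝ)⁻¹ • ∑ i, l1Vertex r (J i) + (((m : ℝ) - l) / m) • v with hu
      obtain ⟨ℓ, hℓ⟩ := hG u
      obtain ⟨a, ha⟩ := exists_l1Vertex_le hv ℓ
      refine ⟨Fin.snoc J a, ?_⟩
      have e : (m : ℝ)⁻¹ • ∑ i, l1Vertex r ((Fin.snoc J a : Fin (l + 1) → Fin p × Bool) i) +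
          (((m : ℝ) - (l + 1 : ℕ)) / m) • v = u + (m : ℝ)⁻¹ • (l1Vertex r a - v) := by
        rw [Fin.sum_univ_castSucc]
        simp only [Fin.snoc_castSucc, Fin.snoc_last, hu]
        push_cast
        ext j
        simp only [Pi.add_apply, Pi.smul_apply, Pi.sub_apply, smul_eq_mul]
        field_simp
        ring
      rw [e]
      refine (hℓ _).trans ?_
      have h1 : ℓ ((m : ℝ)⁻¹ • (l1Vertex r a - v)) ≤ 0 := by
        rw [map_smul, map_sub, smul_eq_mul]
        exact mul_nonpos_of_nonneg_of_nonpos (by positivity) (by linarith)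
      have h2 : l1Norm ((m : ℝ)⁻¹ • (l1Vertex r a - v)) ≤ 2 * r / m := by
        rw [l1Norm_smul, abs_of_pos (inv_pos.2 hm'), inv_mul_le_iff₀ hm',
          mul_div_cancel₀ _ hm'.ne']
        refine (l1Norm_sub_le _ _).trans ?_
        rw [l1Norm_l1Vertex hr]; linarith
      have h3 := mul_le_mul_of_nonneg_left (pow_le_pow_left₀ (l1Norm_nonneg _) h2 2) hD
      push_cast
      linarith
  obtain ⟨J, hJ⟩ := key m le_rfl
  refine ⟨J, ?_⟩
  rw [sub_self, zero_div, zero_smul, add_zero] at hJ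
  refine hJ.trans (le_of_eq ?_)
  field_simp
  ring

/-- The empirical pseudo-Huber risk of the design `x` with weights `ω`. -/
noncomputable def huberRisk {n : ℕ} (ω : Fin n → ℝ) (x : Fin n → Fin p → ℝ)
    (v : Fin p → ℝ) : ℝ := 1 / (n : ℝ) * ∑ i, ω i * pseudoHuber (x i ⬝ᵥ v)

/-- Smoothness in ℓ₁ with a dimension-free constant, from pseudoHuber'' ≤ 1 and |xᵀz| ≤ M‖z‖₁: the
input for Maurey's method. -/
lemma huberRisk_add_le {n : ℕ} {ω : Fin n → ℝ} {x : Fin n → Fin p → ℝ} {M : ℝ}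
    (hω0 : ∀ i, 0 ≤ ω i) (hω1 : ∀ i, ω i ≤ 1) (hx : ∀ i, ‖x i‖ ≤ M) (u : Fin p → ℝ) :
    ∃ ℓ : (Fin p → ℝ) →ₗ[ℝ] ℝ, ∀ z,
      huberRisk ω x (u + z) ≤ huberRisk ω x u + ℓ z + M ^ 2 / 2 * l1Norm z ^ 2 := by
  refine ⟨(1 / (n : ℝ)) • ∑ i, (ω i * (x i ⬝ᵥ u / Real.sqrt (1 + (x i ⬝ᵥ u) ^ 2))) •
    dotProductBilin ℝ ℝ (x i), fun z => ?_⟩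
  have hterm : ∀ i, ω i * pseudoHuber (x i ⬝ᵥ (u + z)) ≤ ω i * pseudoHuber (x i ⬝ᵥ u) +
      (ω i * (x i ⬝ᵥ u / Real.sqrt (1 + (x i ⬝ᵥ u) ^ 2))) * (x i ⬝ᵥ z) +
      M ^ 2 / 2 * l1Norm z ^ 2 := by
    intro i
    have h1 := mul_le_mul_of_nonneg_left (pseudoHuber_add_le (x i ⬝ᵥ u) (x i ⬝ᵥ z)) (hω0 i)
    have h2 : (x i ⬝ᵥ z) ^ 2 ≤ M ^ 2 * l1Norm z ^ 2 := by
      rw [← sq_abs, ← mul_pow]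
      refine pow_le_pow_left₀ (abs_nonneg _) ((abs_dotProduct_le_norm_mul_l1Norm _ _).trans ?_) 2
      exact mul_le_mul_of_nonneg_right (hx i) (l1Norm_nonneg z)
    have h3 : ω i * ((x i ⬝ᵥ z) ^ 2 / 2) ≤ 1 * ((x i ⬝ᵥ z) ^ 2 / 2) :=
      mul_le_mul_of_nonneg_right (hω1 i) (by positivity)
    rw [dotProduct_add]
    nlinarith
  have hn : 1 / (n : ℝ) * (n * (M ^ 2 / 2 * l1Norm z ^ 2)) ≤ M ^ 2 / 2 * l1Norm z ^ 2 := by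
    rcases Nat.eq_zero_or_pos n with rfl | h
    · simp; positivity
    · have : (n : ℝ) ≠ 0 := by positivity
      rw [← mul_assoc, one_div_mul_cancel this, one_mul]
  have hs := mul_le_mul_of_nonneg_left (Finset.sum_le_sum fun i (_ : i ∈ Finset.univ) => hterm i)
    (by positivity : 0 ≤ 1 / (n : ℝ))
  simp only [Finset.sum_add_distrib, Finset.sum_const, Finset.card_univ, Fintype.card_fin,
    nsmul_eq_mul, mul_add] at hs
  simp only [huberRisk, LinearMap.smul_apply, LinearMap.sum_apply, smul_eq_mul]
  refine hs.trans ?_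
  simp only [dotProductBilin_apply_apply]
  linarith

/-- √(1 + ‖u‖²) is the Euclidean norm of (1, u), hence convex, and Cauchy–Schwarz for (1, u) and (1,
u + z) gives its tangent. Subtracting it therefore costs nothing in the smoothness constant. -/
lemma neg_pseudoHuber_l2Norm_add_le (u : Fin p → ℝ) :
    ∃ ℓ : (Fin p → ℝ) →ₗ[ℝ] ℝ, ∀ z,
      -pseudoHuber (l2Norm (u + z)) ≤ -pseudoHuber (l2Norm u) + ℓ z := by
  refine ⟨(-(1 / Real.sqrt (1 + l2Norm u ^ 2))) • dotProductBilin ℝ ℝ u, fun z => ?_⟩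
  set a := Real.sqrt (1 + l2Norm u ^ 2) with ha
  set b := Real.sqrt (1 + l2Norm (u + z) ^ 2) with hb
  have ha0 : 0 < a := Real.sqrt_pos.2 (by positivity)
  have hb0 : 0 ≤ b := Real.sqrt_nonneg _
  have ha2 : a ^ 2 = 1 + l2Norm u ^ 2 := Real.sq_sqrt (by positivity)
  have hb2 : b ^ 2 = 1 + l2Norm (u + z) ^ 2 := Real.sq_sqrt (by positivity)
  have hcs := dotProduct_le_l2Norm_mul u (u + z)
  have huu : u ⬝ᵥ u = l2Norm u ^ 2 := by
    rw [l2Norm_sq]; simp [dotProduct, sq]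
  rw [dotProduct_add, huu] at hcs
  have hab : 1 + l2Norm u * l2Norm (u + z) ≤ a * b := by
    have h0 := mul_nonneg (l2Norm_nonneg u) (l2Norm_nonneg (u + z))
    apply le_of_sq_le_sq _ (by positivity)
    rw [mul_pow, ha2, hb2]
    nlinarith [sq_nonneg (l2Norm u - l2Norm (u + z))]
  have h1 : a ^ 2 + u ⬝ᵥ z ≤ a * b := by rw [ha2]; linarith
  have h2 : a + u ⬝ᵥ z / a ≤ b := by
    rw [← sub_nonneg]
    have : b - (a + u ⬝ᵥ z / a) = (a * b - (a ^ 2 + u ⬝ᵥ z)) / a := by field_simp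
    rw [this]; exact div_nonneg (by linarith) ha0.le
  simp only [pseudoHuber, LinearMap.smul_apply, dotProductBilin_apply_apply, smul_eq_mul, ← ha,
    ← hb]
  have : -(1 / a) * u ⬝ᵥ z = -(u ⬝ᵥ z / a) := by ring
  linarith

/-- Restricted strong convexity: a lower bound for the pseudo-Huber risk at all averages of `m`
vertices of an `ℓ₁`-ball extends to all vectors with a small ratio of `ℓ₁`- to `ℓ₂`-norm. -/
lemma mul_huberRate_le_huberRisk [NeZero p] {n : ℕ} {ω : Fin n → ℝ} {x : Fin n → Fin p → ℝ}
    {M : ℝ} (hω0 : ∀ i, 0 ≤ ω i) (hω1 : ∀ i, ω i ≤ 1) (hx : ∀ i, ‖x i‖ ≤ M)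
    {e r : ℝ} (he : 0 ≤ e) {m : ℕ} (hm : 0 < m)
    (hJ : ∀ J : Fin m → Fin p × Bool,
      e * pseudoHuber (l2Norm (vertexAverage r J)) ≤ huberRisk ω x (vertexAverage r J))
    (hmr : 2 * M ^ 2 * r ^ 2 / m ≤ e / 5) {v : Fin p → ℝ} (hv : l1Norm v ≤ r * l2Norm v) :
    e / 5 * huberRate (l2Norm v) ≤ huberRisk ω x v := by
  have unit : ∀ w : Fin p → ℝ, l2Norm w = 1 → l1Norm w ≤ r → e / 5 ≤ huberRisk ω x w := by
    intro w hw hwr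
    -- Maurey is applied to the difference of the two sides, since the ℓ₂-norm of the approximating
    -- average is not controlled. At w this leaves e (√2 - 1) - e/5 ≥ e/5.
    obtain ⟨J, hJ'⟩ := exists_vertexAverage_le
      (G := fun v => huberRisk ω x v - e * pseudoHuber (l2Norm v)) (D := M ^ 2 / 2)
      (by positivity) (fun u => by
        obtain ⟨ℓ₁, h₁⟩ := huberRisk_add_le hω0 hω1 hx u
        obtain ⟨ℓ₂, h₂⟩ := neg_pseudoHuber_l2Norm_add_le u
        refine ⟨ℓ₁ + e • ℓ₂, fun z => ?_⟩
        have := mul_le_mul_of_nonneg_left (h₂ z) he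
        have := h₁ z
        simp only [LinearMap.add_apply, LinearMap.smul_apply, smul_eq_mul]
        linarith) hwr hm
    have h1 := hJ J
    have h2 : 4 * (M ^ 2 / 2) * r ^ 2 / m = 2 * M ^ 2 * r ^ 2 / m := by ring
    have h3 : (2 : ℝ) / 5 ≤ pseudoHuber 1 := by
      rw [pseudoHuber, le_sub_iff_add_le]
      apply Real.le_sqrt_of_sq_le
      norm_num
    rw [hw] at hJ'
    nlinarith
  rcases (l2Norm_nonneg v).eq_or_lt with h0 | h0
  · have : v = 0 := l2Norm_eq_zero.1 h0.symm
    simp [this, huberRisk, pseudoHuber, l2Norm, huberRate]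
  obtain ⟨w, hw⟩ : ∃ w, w = (l2Norm v)⁻¹ • v := ⟨_, rfl⟩
  have hvw : v = l2Norm v • w := by rw [hw, smul_smul, mul_inv_cancel₀ h0.ne', one_smul]
  have hw1 : l2Norm w = 1 := by
    rw [hw, l2Norm_smul, abs_of_pos (inv_pos.2 h0), inv_mul_cancel₀ h0.ne']
  have hw2 : l1Norm w ≤ r := by
    rw [hw, l1Norm_smul, abs_of_pos (inv_pos.2 h0), inv_mul_le_iff₀ h0, mul_comm]
    exact hv
  have hscale : huberRate (l2Norm v) * huberRisk ω x w ≤ huberRisk ω x v := by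
    conv_rhs => rw [hvw]
    rw [huberRisk, huberRisk, mul_left_comm, Finset.mul_sum]
    apply mul_le_mul_of_nonneg_left _ (by positivity)
    refine Finset.sum_le_sum fun i _ => ?_
    rw [mul_left_comm, dotProduct_smul, smul_eq_mul]
    exact mul_le_mul_of_nonneg_left (huberRate_mul_pseudoHuber_le h0.le _) (hω0 i)
  have := mul_le_mul_of_nonneg_left (unit w hw1 hw2) (huberRate_nonneg h0.le)
  linarith

end Maurey

/-! ### Quadratic forms -/

section QuadraticForms

variable {p : ℕ} {P : Measure (Fin p → ℝ)}

/-- Displays the covariance as a weighted second moment with weight 1, so that it shares the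
quadratic form identities with the Fisher information. -/
lemma covMatrix_apply (i j : Fin p) : covMatrix P i j = ∫ x, (1 : ℝ) * (x i * x j) ∂P := by
  simp [covMatrix]

lemma lambdaMin_mul_sq_le {A : Matrix (Fin p) (Fin p) ℝ} (hA : A.IsHermitian) (v : Fin p → ℝ) :
    lambdaMin A * l2Norm v ^ 2 ≤ v ⬝ᵥ A.mulVec v := by
  set c := lambdaMin A with hc
  have hfin : (spectrum ℝ A).Finite := by
    rw [hA.spectrum_real_eq_range_eigenvalues]; exact Set.finite_range _
  have hB : (A - algebraMap ℝ _ c).IsHermitian := hA.sub (by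
    rw [Algebra.algebraMap_eq_smul_one]
    simp [Matrix.IsHermitian])
  have hpos : (A - algebraMap ℝ _ c).PosSemidef := by
    rw [hB.posSemidef_iff_eigenvalues_nonneg]
    intro i
    have hi : hB.eigenvalues i ∈ spectrum ℝ (A - algebraMap ℝ _ c) := by
      rw [hB.spectrum_real_eq_range_eigenvalues]; exact ⟨i, rfl⟩
    rw [← spectrum.sub_singleton_eq, Set.mem_sub] at hi
    obtain ⟨a, ha, b, hb, hab⟩ := hi
    rw [Set.mem_singleton_iff] at hb
    have : c ≤ a := csInf_le hfin.bddBelow ha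
    simp only [Pi.zero_apply]
    linarith
  have h := hpos.dotProduct_mulVec_nonneg v
  rw [Matrix.sub_mulVec, dotProduct_sub, Algebra.algebraMap_eq_smul_one, Matrix.smul_mulVec,
    Matrix.one_mulVec, dotProduct_smul, smul_eq_mul, star_trivial] at h
  have : v ⬝ᵥ v = l2Norm v ^ 2 := by rw [l2Norm_sq]; simp [dotProduct, sq]
  rw [this] at h
  linarith

lemma isHermitian_covMatrix : (covMatrix P).IsHermitian := by
  ext i j
  simp [covMatrix, mul_comm]

variable [IsProbabilityMeasure P] {M : ℝ}

lemma sum_mul_integral_eq (hM : ∀ᵐ x ∂P, ‖x‖ ≤ M) {W : (Fin p → ℝ) → ℝ} (hW : Continuous W)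
    (j : Fin p) (v : Fin p → ℝ) :
    ∑ l, (∫ x, W x * (x j * x l) ∂P) * v l = ∫ x, W x * (x j * (x ⬝ᵥ v)) ∂P := by
  simp_rw [← integral_mul_const]
  rw [← integral_finsetSum _ fun l _ =>
    integrable_of_continuous_of_norm_le hM (by fun_prop)]
  refine integral_congr_ae (ae_of_all _ fun x => ?_)
  simp only [dotProduct, Finset.mul_sum]
  exact Finset.sum_congr rfl fun l _ => by ring

lemma sum_mul_sum_mul_integral_eq (hM : ∀ᵐ x ∂P, ‖x‖ ≤ M) {W : (Fin p → ℝ) → ℝ}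
    (hW : Continuous W) (u v : Fin p → ℝ) :
    ∑ j, u j * ∑ l, (∫ x, W x * (x j * x l) ∂P) * v l
      = ∫ x, W x * ((x ⬝ᵥ u) * (x ⬝ᵥ v)) ∂P := by
  simp_rw [sum_mul_integral_eq hM hW, ← integral_const_mul]
  have hv := continuous_dotProduct_left v
  rw [← integral_finsetSum _ fun l _ =>
    integrable_of_continuous_of_norm_le hM (by fun_prop)]
  refine integral_congr_ae (ae_of_all _ fun x => ?_)
  simp only
  generalize x ⬝ᵥ v = c
  simp only [dotProduct, Finset.sum_mul, Finset.mul_sum]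
  exact Finset.sum_congr rfl fun l _ => by ring

lemma lambdaMin_covMatrix_mul_sq_le (hM : ∀ᵐ x ∂P, ‖x‖ ≤ M) (v : Fin p → ℝ) :
    lambdaMin (covMatrix P) * l2Norm v ^ 2 ≤ ∫ x, (x ⬝ᵥ v) ^ 2 ∂P := by
  refine (lambdaMin_mul_sq_le isHermitian_covMatrix v).trans (le_of_eq ?_)
  have := sum_mul_sum_mul_integral_eq hM (continuous_const (y := (1 : ℝ))) v v
  simp_rw [← covMatrix_apply, one_mul, ← sq] at this
  rw [← this]
  rfl

/-- Turns the hypothesis μ < c_ψ λ_min(Σ_x) into a bound on μ by a fixed curvature constant. -/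
lemma lambdaMin_covMatrix_le (hM : ∀ᵐ x ∂P, ‖x‖ ≤ M) {σ : ℝ} (hσ : 0 < σ)
    (h : IsSubGaussianVector P σ) (j : Fin p) : lambdaMin (covMatrix P) ≤ σ ^ 2 := by
  have h1 := lambdaMin_covMatrix_mul_sq_le hM (Pi.single j (1 : ℝ))
  have h2 := h.integral_sq_le hσ hM (Pi.single j (1 : ℝ))
  rw [l2Norm_single] at h1 h2
  linarith

end QuadraticForms

/-! ### Truncated moments -/

section TruncatedMoments

variable {p : ℕ} {P : Measure (Fin p → ℝ)} [IsProbabilityMeasure P] {M σ lam₀ B : ℝ}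

/-- The indicator of `|xᵀβ| ≤ T`. -/
noncomputable def truncWeight (β : Fin p → ℝ) (T : ℝ) (x : Fin p → ℝ) : ℝ :=
  if |x ⬝ᵥ β| ≤ T then 1 else 0

lemma truncWeight_nonneg (β : Fin p → ℝ) (T : ℝ) (x : Fin p → ℝ) : 0 ≤ truncWeight β T x := by
  unfold truncWeight; split_ifs <;> simp

lemma truncWeight_le_one (β : Fin p → ℝ) (T : ℝ) (x : Fin p → ℝ) : truncWeight β T x ≤ 1 := by
  unfold truncWeight; split_ifs <;> simp

lemma measurable_truncWeight (β : Fin p → ℝ) (T : ℝ) : Measurable (truncWeight β T) :=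
  Measurable.ite (measurableSet_le (continuous_dotProduct_left β).abs.measurable measurable_const)
    measurable_const measurable_const

lemma measurable_truncWeight_mul (β : Fin p → ℝ) (T : ℝ) (v : Fin p → ℝ) :
    Measurable fun x => truncWeight β T x * pseudoHuber (x ⬝ᵥ v) :=
  (measurable_truncWeight β T).mul
    (continuous_pseudoHuber.comp (continuous_dotProduct_left v)).measurable

lemma integrable_truncWeight_mul (hM : ∀ᵐ x ∂P, ‖x‖ ≤ M) (β : Fin p → ℝ) (T : ℝ)
    (v : Fin p → ℝ) : Integrable (fun x => truncWeight β T x * pseudoHuber (x ⬝ᵥ v)) P := by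
  have hc := continuous_pseudoHuber.comp (continuous_dotProduct_left v)
  refine (integrable_of_continuous_of_norm_le hM hc).mono'
    (measurable_truncWeight_mul β T v).aestronglyMeasurable (ae_of_all _ fun x => ?_)
  rw [Real.norm_eq_abs, abs_of_nonneg (mul_nonneg (truncWeight_nonneg _ _ _)
    (pseudoHuber_nonneg _))]
  exact mul_le_of_le_one_left (pseudoHuber_nonneg _) (truncWeight_le_one _ _ _)

lemma integrable_truncWeight_mul_sq (hM : ∀ᵐ x ∂P, ‖x‖ ≤ M) (β : Fin p → ℝ) (T : ℝ)
    (v : Fin p → ℝ) :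
    Integrable (fun x => (truncWeight β T x * pseudoHuber (x ⬝ᵥ v)) ^ 2) P := by
  have hc := continuous_pseudoHuber.comp (continuous_dotProduct_left v)
  refine (integrable_of_continuous_of_norm_le hM (hc.pow 2)).mono'
    ((measurable_truncWeight_mul β T v).pow_const 2).aestronglyMeasurable
    (ae_of_all _ fun x => ?_)
  rw [Real.norm_eq_abs, abs_of_nonneg (sq_nonneg _), mul_pow]
  exact mul_le_of_le_one_left (sq_nonneg _)
    (pow_le_one₀ (truncWeight_nonneg _ _ _) (truncWeight_le_one _ _ _))

/-- A minorant involving only second and fourth moments. Where a truncation is active it is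
nonpositive: |u| > K gives u² ≤ u⁴/K², and |a| > T gives 2T²u² ≤ 2u²a² ≤ u⁴ + a⁴. -/
lemma truncWeight_mul_pseudoHuber_ge (β v x : Fin p → ℝ) {K T : ℝ} (hK : 0 < K) (hT : 0 < T) :
    ((x ⬝ᵥ v) ^ 2 - (x ⬝ᵥ v) ^ 4 / K ^ 2 - ((x ⬝ᵥ v) ^ 4 + (x ⬝ᵥ β) ^ 4) / (2 * T ^ 2)) / (K + 2)
      ≤ truncWeight β T x * pseudoHuber (x ⬝ᵥ v) := by
  set u := x ⬝ᵥ v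
  set a := x ⬝ᵥ β
  have h0 := mul_nonneg (truncWeight_nonneg β T x) (pseudoHuber_nonneg u)
  have p1 : 0 ≤ u ^ 4 / K ^ 2 := by positivity
  have p2 : 0 ≤ (u ^ 4 + a ^ 4) / (2 * T ^ 2) := by positivity
  by_cases ha : |a| ≤ T
  · by_cases hu : |u| ≤ K
    · have : truncWeight β T x = 1 := if_pos ha
      rw [this, one_mul]
      refine le_trans ?_ (sq_div_le_pseudoHuber hu)
      exact div_le_div_of_nonneg_right (by linarith) (by positivity)
    · refine le_trans (div_nonpos_of_nonpos_of_nonneg ?_ (by positivity)) h0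
      have h1 : K ^ 2 ≤ u ^ 2 := by
        rw [← sq_abs u]; exact pow_le_pow_left₀ hK.le (not_le.1 hu).le 2
      have h2 : u ^ 2 ≤ u ^ 4 / K ^ 2 := by
        rw [le_div_iff₀ (by positivity)]
        nlinarith [sq_nonneg u]
      linarith
  · refine le_trans (div_nonpos_of_nonpos_of_nonneg ?_ (by positivity)) h0
    have h1 : T ^ 2 ≤ a ^ 2 := by
      rw [← sq_abs a]; exact pow_le_pow_left₀ hT.le (not_le.1 ha).le 2
    have h2 : u ^ 2 ≤ (u ^ 4 + a ^ 4) / (2 * T ^ 2) := by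
      rw [le_div_iff₀ (by positivity)]
      nlinarith [sq_nonneg u, sq_nonneg (u ^ 2 - a ^ 2)]
    linarith

/-- There are a truncation level and a constant, depending only on the sub-Gaussian parameter, the
smallest eigenvalue and the radius, that bound the truncated pseudo-Huber risk from below. -/
lemma exists_le_integral_truncWeight (hσ : 0 < σ) (hlam₀ : 0 < lam₀) (B : ℝ) :
    ∃ T e : ℝ, 0 < T ∧ 0 < e ∧ ∀ {p : ℕ} {P : Measure (Fin p → ℝ)} [IsProbabilityMeasure P]
      {M : ℝ}, (∀ᵐ x ∂P, ‖x‖ ≤ M) → IsSubGaussianVector P σ → lam₀ ≤ lambdaMin (covMatrix P) →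
      ∀ β : Fin p → ℝ, l2Norm β ≤ B → ∀ v : Fin p → ℝ, l2Norm v = 1 →
      e ≤ ∫ x, truncWeight β T x * pseudoHuber (x ⬝ᵥ v) ∂P := by
  -- K and T make each of the two fourth-moment corrections at most λ₀/4, leaving λ₀/2. Neither
  -- depends on the sup bound M, as c_ψ requires.
  set K := Real.sqrt (8 * σ ^ 4 / lam₀) with hK
  set T := Real.sqrt (4 * σ ^ 4 * (1 + B ^ 4) / lam₀) with hT
  have hK0 : 0 < K := Real.sqrt_pos.2 (by positivity)
  have hT0 : 0 < T := Real.sqrt_pos.2 (by positivity)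
  have hK2 : K ^ 2 = 8 * σ ^ 4 / lam₀ := Real.sq_sqrt (by positivity)
  have hT2 : T ^ 2 = 4 * σ ^ 4 * (1 + B ^ 4) / lam₀ := Real.sq_sqrt (by positivity)
  refine ⟨T, lam₀ / 2 / (K + 2), hT0, by positivity, ?_⟩
  intro p P _ M hM hsub hlam β hβ v hv
  have hcv := continuous_dotProduct_left v
  have hcβ := continuous_dotProduct_left β
  have i1 : Integrable (fun x : Fin p → ℝ => (x ⬝ᵥ v) ^ 2) P :=
    integrable_of_continuous_of_norm_le hM (by fun_prop)
  have i2 : Integrable (fun x : Fin p → ℝ => (x ⬝ᵥ v) ^ 4) P :=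
    integrable_of_continuous_of_norm_le hM (by fun_prop)
  have i3 : Integrable (fun x : Fin p → ℝ => (x ⬝ᵥ β) ^ 4) P :=
    integrable_of_continuous_of_norm_le hM (by fun_prop)
  have i4 : Integrable (fun x : Fin p → ℝ => (x ⬝ᵥ v) ^ 4 / K ^ 2) P := i2.div_const _
  have i6 : Integrable (fun x : Fin p → ℝ => (x ⬝ᵥ v) ^ 2 - (x ⬝ᵥ v) ^ 4 / K ^ 2) P := i1.sub i4
  have i5 : Integrable (fun x : Fin p → ℝ => ((x ⬝ᵥ v) ^ 4 + (x ⬝ᵥ β) ^ 4) / (2 * T ^ 2)) P :=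
    (i2.add i3).div_const _
  refine le_trans ?_ (integral_mono ((i6.sub i5).div_const (K + 2))
    (integrable_truncWeight_mul hM β T v)
    fun x => truncWeight_mul_pseudoHuber_ge β v x hK0 hT0)
  have e1 : ∫ x, ((x ⬝ᵥ v) ^ 2 - (x ⬝ᵥ v) ^ 4 / K ^ 2 -
      ((x ⬝ᵥ v) ^ 4 + (x ⬝ᵥ β) ^ 4) / (2 * T ^ 2)) / (K + 2) ∂P =
      (∫ x, (x ⬝ᵥ v) ^ 2 ∂P - (∫ x, (x ⬝ᵥ v) ^ 4 ∂P) / K ^ 2 -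
      (∫ x, (x ⬝ᵥ v) ^ 4 ∂P + ∫ x, (x ⬝ᵥ β) ^ 4 ∂P) / (2 * T ^ 2)) / (K + 2) := by
    rw [integral_div, integral_sub i6 i5, integral_sub i1 i4, integral_div, integral_div,
      integral_add i2 i3]
  simp only [Pi.sub_apply]
  rw [e1]
  apply div_le_div_of_nonneg_right _ (by positivity)
  have m1 := lambdaMin_covMatrix_mul_sq_le hM v
  have m2 := hsub.integral_pow_four_le hσ hM v
  have m3 := hsub.integral_pow_four_le hσ hM β
  rw [hv] at m1 m2
  have hβ4 : l2Norm β ^ 4 ≤ B ^ 4 := pow_le_pow_left₀ (l2Norm_nonneg β) hβ 4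
  have b1 : (∫ x, (x ⬝ᵥ v) ^ 4 ∂P) / K ^ 2 ≤ lam₀ / 4 := by
    rw [div_le_iff₀ (by positivity), hK2]
    refine m2.trans (le_of_eq ?_)
    field_simp
    norm_num
  have b2 : (∫ x, (x ⬝ᵥ v) ^ 4 ∂P + ∫ x, (x ⬝ᵥ β) ^ 4 ∂P) / (2 * T ^ 2) ≤ lam₀ / 4 := by
    rw [div_le_iff₀ (by positivity), hT2]
    have : lam₀ / 4 * (2 * (4 * σ ^ 4 * (1 + B ^ 4) / lam₀)) = 2 * σ ^ 4 * (1 + B ^ 4) := by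
      field_simp
    rw [this]
    have := mul_le_mul_of_nonneg_left hβ4 (by positivity : 0 ≤ 2 * σ ^ 4)
    linarith
  linarith

lemma le_integral_truncWeight_of_unit (hM : ∀ᵐ x ∂P, ‖x‖ ≤ M) {β : Fin p → ℝ} {T e : ℝ}
    (he : ∀ v : Fin p → ℝ, l2Norm v = 1 →
      e ≤ ∫ x, truncWeight β T x * pseudoHuber (x ⬝ᵥ v) ∂P)
    {v : Fin p → ℝ} (hv : 0 < l2Norm v) :
    e * huberRate (l2Norm v) ≤ ∫ x, truncWeight β T x * pseudoHuber (x ⬝ᵥ v) ∂P := by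
  obtain ⟨w, hw⟩ : ∃ w, w = (l2Norm v)⁻¹ • v := ⟨_, rfl⟩
  have hvw : v = l2Norm v • w := by rw [hw, smul_smul, mul_inv_cancel₀ hv.ne', one_smul]
  have hw1 : l2Norm w = 1 := by
    rw [hw, l2Norm_smul, abs_of_pos (inv_pos.2 hv), inv_mul_cancel₀ hv.ne']
  have h1 := mul_le_mul_of_nonneg_left (he w hw1) (huberRate_nonneg hv.le)
  rw [← integral_const_mul, mul_comm] at h1
  refine h1.trans (integral_mono ((integrable_truncWeight_mul hM β T w).const_mul _)
    (integrable_truncWeight_mul hM β T v) fun x => ?_)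
  have e1 : x ⬝ᵥ v = l2Norm v * (x ⬝ᵥ w) := by
    conv_lhs => rw [hvw]
    rw [dotProduct_smul, smul_eq_mul]
  simp only
  rw [e1, mul_left_comm]
  exact mul_le_mul_of_nonneg_left (huberRate_mul_pseudoHuber_le hv.le _)
    (truncWeight_nonneg β T x)

/-- Fourth moments serve short vectors and second moments long ones. With the first-moment bound of
the same order, this makes the lower tail independent of ‖v‖₂. -/
lemma integral_truncWeight_sq_le (hM : ∀ᵐ x ∂P, ‖x‖ ≤ M) (hσ : 0 < σ)
    (h : IsSubGaussianVector P σ) (β v : Fin p → ℝ) (T : ℝ) :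
    ∫ x, (truncWeight β T x * pseudoHuber (x ⬝ᵥ v)) ^ 2 ∂P
      ≤ (2 * σ ^ 4 + σ ^ 2) * huberRate (l2Norm v) ^ 2 := by
  have hc := continuous_dotProduct_left v
  have hpt : ∀ x : Fin p → ℝ, (truncWeight β T x * pseudoHuber (x ⬝ᵥ v)) ^ 2 ≤
      pseudoHuber (x ⬝ᵥ v) ^ 2 := fun x =>
    pow_le_pow_left₀ (mul_nonneg (truncWeight_nonneg _ _ _) (pseudoHuber_nonneg _))
      (mul_le_of_le_one_left (pseudoHuber_nonneg _) (truncWeight_le_one _ _ _)) 2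
  have h0 := l2Norm_nonneg v
  rcases le_total (l2Norm v) 1 with h1 | h1
  · rw [huberRate_of_le_one h0 h1]
    refine (integral_mono (integrable_truncWeight_mul_sq hM β T v)
      (integrable_of_continuous_of_norm_le hM (f := fun x => (x ⬝ᵥ v) ^ 4) (by fun_prop))
      fun x => (hpt x).trans ?_).trans ((h.integral_pow_four_le hσ hM v).trans ?_)
    · have := pow_le_pow_left₀ (pseudoHuber_nonneg (x ⬝ᵥ v)) (pseudoHuber_le_half_sq _) 2
      nlinarith [sq_nonneg ((x ⬝ᵥ v) ^ 2)]
    · have : 0 ≤ σ ^ 2 * l2Norm v ^ 4 := by positivity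
      nlinarith
  · rw [huberRate_of_one_le h1]
    refine (integral_mono (integrable_truncWeight_mul_sq hM β T v)
      (integrable_of_continuous_of_norm_le hM (f := fun x => (x ⬝ᵥ v) ^ 2) (by fun_prop))
      fun x => (hpt x).trans ?_).trans ((h.integral_sq_le hσ hM v).trans ?_)
    · have := pow_le_pow_left₀ (pseudoHuber_nonneg (x ⬝ᵥ v)) (pseudoHuber_le_abs _) 2
      rwa [sq_abs] at this
    · have : 0 ≤ σ ^ 4 * l2Norm v ^ 2 := by positivity
      nlinarith

end TruncatedMoments

/-! ### High-probability events of the generalized linear model -/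

section Events

variable {p : ℕ} {ψ : ℝ → ℝ} {ν : Measure ℝ} {s : ℝ} {P : Measure (Fin p → ℝ)}
  [IsProbabilityMeasure P] {κ M σ : ℝ}

lemma ae_glmLaw_of_ae (h : IsGLMFamily ψ ν s) (hψ : Continuous ψ) (β : Fin p → ℝ)
    {q : (Fin p → ℝ) → Prop} (hq : ∀ᵐ x ∂P, q x) : ∀ᵐ z ∂(glmLaw ψ ν s P β), q z.1 := by
  rw [← map_fst_glmLaw (P := P) h hψ β] at hq
  exact ae_of_ae_map measurable_fst.aemeasurable hq

lemma integral_glmLaw_fst (h : IsGLMFamily ψ ν s) (hψ : Continuous ψ) (β : Fin p → ℝ)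
    {f : (Fin p → ℝ) → ℝ} (hf : Measurable f) :
    ∫ z, f z.1 ∂(glmLaw ψ ν s P β) = ∫ x, f x ∂P := by
  have := integral_map (μ := glmLaw ψ ν s P β) measurable_fst.aemeasurable (f := f)
    hf.aestronglyMeasurable
  rw [map_fst_glmLaw h hψ β] at this
  exact this.symm

lemma integrable_glmLaw_fst (h : IsGLMFamily ψ ν s) (hψ : Continuous ψ) (β : Fin p → ℝ)
    {f : (Fin p → ℝ) → ℝ} (hf : Integrable f P) :
    Integrable (fun z => f z.1) (glmLaw ψ ν s P β) := by
  rw [← map_fst_glmLaw (P := P) h hψ β] at hf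
  exact hf.comp_measurable measurable_fst

lemma ae_glmSampleLaw_norm_le (h : IsGLMFamily ψ ν s) (hψ : Continuous ψ) (β : Fin p → ℝ)
    (hM : ∀ᵐ x ∂P, ‖x‖ ≤ M) (n : ℕ) :
    ∀ᵐ z ∂(glmSampleLaw n ψ ν s P β), ∀ i, ‖(z i).1‖ ≤ M := by
  have := isProbabilityMeasure_glmLaw (P := P) h hψ β
  rw [ae_all_iff]
  intro i
  exact (measurePreserving_eval (fun _ : Fin n => glmLaw ψ ν s P β) i).quasiMeasurePreserving.ae
    (ae_glmLaw_of_ae h hψ β hM)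

/-- Concentration of the score in a fixed direction. -/
lemma glmSampleLaw_score_gt_le (h : IsGLMFamily ψ ν s) (hs : 0 < s) (hψ : ContDiff ℝ 2 ψ)
    (hκ : ∀ t, |iteratedDeriv 2 ψ t| ≤ κ) (hσ : 0 < σ) (hsub : IsSubGaussianVector P σ)
    (β : Fin p → ℝ) {u : Fin p → ℝ} {V : ℝ} (hV : 0 < V) (hu : l2Norm u ≤ V) {n : ℕ} (hn : 0 < n)
    {ε : ℝ} (hε : 0 < ε) (hε1 : κ * s * V ^ 2 * σ ^ 2 / 2 * ε ^ 2 ≤ 1) (C : ℝ) :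
    glmSampleLaw n ψ ν s P β {z | C * ε <
        |1 / (n : ℝ) * ∑ i, ((z i).1 ⬝ᵥ u) * ((z i).2 - deriv ψ ((z i).1 ⬝ᵥ β))|}
      ≤ ENNReal.ofReal (2 * Real.exp ((κ * s * V ^ 2 * σ ^ 2 / 2 - C) * (n * ε ^ 2))) := by
  have := isProbabilityMeasure_glmLaw (P := P) h hψ.continuous β
  have hd : Continuous (deriv ψ) := hψ.continuous_deriv (by norm_num)
  have c1 := (continuous_dotProduct_left u).comp (continuous_fst (X := Fin p → ℝ) (Y := ℝ))
  have c2 := (continuous_dotProduct_left β).comp (continuous_fst (X := Fin p → ℝ) (Y := ℝ))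
  simp only [Function.comp_def] at c1 c2
  have hκ0 : 0 ≤ κ := (abs_nonneg _).trans (hκ 0)
  refine pi_abs_average_gt_le (Q := glmLaw ψ ν s P β) hn
    (w := fun z => (z.1 ⬝ᵥ u) * (z.2 - deriv ψ (z.1 ⬝ᵥ β))) (by fun_prop) hε fun t ht => ?_
  refine (lintegral_exp_score_le h hs hψ hκ β u t).trans ?_
  have ht2 : t ^ 2 = ε ^ 2 := by rw [← sq_abs, ht]
  rw [ht2]
  have e : κ * s * V ^ 2 * σ ^ 2 / 2 * ε ^ 2 = κ * s * ε ^ 2 / 2 * (V ^ 2 * σ ^ 2) := by ring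
  rw [e] at hε1 ⊢
  exact hsub.lintegral_exp_le hσ hV hu (by positivity) hε1

/-- Concentration of the average of a bounded function of the covariates. -/
lemma glmSampleLaw_bounded_gt_le (h : IsGLMFamily ψ ν s) (hψ : Continuous ψ) (β : Fin p → ℝ)
    {f : (Fin p → ℝ) → ℝ} (hf : Measurable f) {b : ℝ} (hb : ∀ᵐ x ∂P, |f x| ≤ b) {n : ℕ}
    (hn : 0 < n) {ε : ℝ} (hε : 0 < ε) (hε1 : ε * (2 * b) ≤ 1) (C : ℝ) :
    glmSampleLaw n ψ ν s P β {z | C * ε < |1 / (n : ℝ) * ∑ i, f (z i).1 - ∫ x, f x ∂P|}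
      ≤ ENNReal.ofReal (2 * Real.exp (((2 * b) ^ 2 - C) * (n * ε ^ 2))) := by
  have := isProbabilityMeasure_glmLaw (P := P) h hψ β
  have hn' : (n : ℝ) ≠ 0 := by positivity
  have hset : {z : Fin n → (Fin p → ℝ) × ℝ | C * ε <
      |1 / (n : ℝ) * ∑ i, f (z i).1 - ∫ x, f x ∂P|} =
      {z | C * ε < |1 / (n : ℝ) * ∑ i, (f (z i).1 - ∫ x, f x ∂P)|} := by
    ext z
    simp only [Set.mem_ofPred_eq, Finset.sum_sub_distrib, Finset.sum_const, Finset.card_univ,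
      Fintype.card_fin, nsmul_eq_mul, mul_sub]
    rw [← mul_assoc (1 / (n : ℝ)) n, one_div_mul_cancel hn', one_mul]
  rw [hset]
  refine pi_abs_average_gt_le (Q := glmLaw ψ ν s P β) hn (w := fun z => f z.1 - ∫ x, f x ∂P)
    ((hf.comp measurable_fst).sub_const _) hε fun t ht => ?_
  rw [← integral_glmLaw_fst (P := P) h hψ β hf]
  have := lintegral_exp_bounded_le (Q := glmLaw ψ ν s P β) (f := fun z => f z.1)
    (hf.comp measurable_fst) (t := t) (ae_glmLaw_of_ae h hψ β hb) (by rw [ht]; exact hε1)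
  rwa [ht] at this

/-- The lower tail of the truncated pseudo-Huber risk in a fixed direction. -/
lemma glmSampleLaw_huberRisk_lt_le (h : IsGLMFamily ψ ν s) (hψ : Continuous ψ) (β : Fin p → ℝ)
    (hM : ∀ᵐ x ∂P, ‖x‖ ≤ M) (hσ : 0 < σ) (hsub : IsSubGaussianVector P σ) {T e : ℝ} (he0 : 0 < e)
    (he : ∀ v : Fin p → ℝ, l2Norm v = 1 →
      e ≤ ∫ x, truncWeight β T x * pseudoHuber (x ⬝ᵥ v) ∂P) {n : ℕ} (hn : 0 < n)
    (v : Fin p → ℝ) :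
    glmSampleLaw n ψ ν s P β {z | huberRisk (fun i => truncWeight β T (z i).1)
        (fun i => (z i).1) v < e / 2 * pseudoHuber (l2Norm v)}
      ≤ ENNReal.ofReal (Real.exp (-(e ^ 2 / (8 * (2 * σ ^ 4 + σ ^ 2))) * n)) := by
  have := isProbabilityMeasure_glmLaw (P := P) h hψ β
  have hn' : (0 : ℝ) < n := Nat.cast_pos.2 hn
  rcases (l2Norm_nonneg v).eq_or_lt with h0 | h0
  · have : v = 0 := l2Norm_eq_zero.1 h0.symm
    have hset : {z : Fin n → (Fin p → ℝ) × ℝ | huberRisk (fun i => truncWeight β T (z i).1)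
        (fun i => (z i).1) v < e / 2 * pseudoHuber (l2Norm v)} = ∅ := by
      simp [this, huberRisk, pseudoHuber, l2Norm]
    rw [hset]; simp
  set g := huberRate (l2Norm v) with hg
  have hg0 : 0 < g := huberRate_pos h0
  -- Dividing by the Huber rate makes the first two moment bounds independent of v.
  set f : (Fin p → ℝ) → ℝ := fun x => g⁻¹ * (truncWeight β T x * pseudoHuber (x ⬝ᵥ v)) with hf
  have hfm : Measurable f := (measurable_truncWeight_mul β T v).const_mul _
  have hf0 : ∀ x, 0 ≤ f x := fun x =>
    mul_nonneg (inv_nonneg.2 hg0.le) (mul_nonneg (truncWeight_nonneg _ _ _) (pseudoHuber_nonneg _))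
  have hfi : Integrable f P := (integrable_truncWeight_mul hM β T v).const_mul _
  have hfi2 : Integrable (fun x => f x ^ 2) P := by
    simp only [hf, mul_pow g⁻¹]
    exact (integrable_truncWeight_mul_sq hM β T v).const_mul _
  have h1 : e ≤ ∫ z, f z.1 ∂(glmLaw ψ ν s P β) := by
    rw [integral_glmLaw_fst h hψ β hfm, hf, integral_const_mul, ← div_eq_inv_mul,
      le_div_iff₀ hg0]
    exact le_integral_truncWeight_of_unit hM he h0
  have h2 : ∫ z, f z.1 ^ 2 ∂(glmLaw ψ ν s P β) ≤ 2 * σ ^ 4 + σ ^ 2 := by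
    rw [integral_glmLaw_fst h hψ β (f := fun x => f x ^ 2) (hfm.pow_const 2)]
    simp only [hf, mul_pow g⁻¹]
    rw [integral_const_mul, inv_pow, ← div_eq_inv_mul, div_le_iff₀ (by positivity)]
    exact integral_truncWeight_sq_le hM hσ hsub β v T
  have i1 : Integrable (fun z : (Fin p → ℝ) × ℝ => f z.1) (glmLaw ψ ν s P β) :=
    integrable_glmLaw_fst (f := f) h hψ β hfi
  have i2 : Integrable (fun z : (Fin p → ℝ) × ℝ => f z.1 ^ 2) (glmLaw ψ ν s P β) :=
    integrable_glmLaw_fst (f := fun x => f x ^ 2) h hψ β hfi2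
  have hm : Measurable fun z : (Fin p → ℝ) × ℝ => f z.1 := hfm.comp measurable_fst
  have hpos : 0 < 2 * σ ^ 4 + σ ^ 2 := by positivity
  have key := pi_average_le_le n hm (fun z => hf0 z.1) i1 i2 he0 hpos h1 h2
  rw [glmSampleLaw]
  refine le_trans (measure_mono ?_) key
  intro z hz
  simp only [Set.mem_ofPred_eq, hf, ← Finset.mul_sum, huberRisk] at hz ⊢
  have h3 := hz.le.trans (mul_le_mul_of_nonneg_left (pseudoHuber_le_huberRate h0.le)
    (by positivity : 0 ≤ e / 2))
  rw [one_div, inv_mul_le_iff₀ hn'] at h3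
  rw [inv_mul_le_iff₀ hg0]
  linarith

/-- The sample satisfies restricted strong convexity with high probability. -/
lemma glmSampleLaw_not_rsc_le (h : IsGLMFamily ψ ν s) (hψ : Continuous ψ) (β : Fin p → ℝ)
    (hM : ∀ᵐ x ∂P, ‖x‖ ≤ M) (hσ : 0 < σ) (hsub : IsSubGaussianVector P σ) {T e : ℝ} (he0 : 0 < e)
    (he : ∀ v : Fin p → ℝ, l2Norm v = 1 →
      e ≤ ∫ x, truncWeight β T x * pseudoHuber (x ⬝ᵥ v) ∂P) {n : ℕ} (hn : 0 < n)
    (hp : 2 ≤ p) {ε c r : ℝ} (hε : 0 < ε) (hεn : n * ε ^ 2 = Real.log p)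
    (hc : c = e ^ 2 / (8 * (2 * σ ^ 4 + σ ^ 2))) (hεc : 4 * ε ^ 2 ≤ c)
    (hr : 160 * M ^ 2 * r ^ 2 ≤ e * c) :
    glmSampleLaw n ψ ν s P β {z | (∀ i, ‖(z i).1‖ ≤ M) ∧ ¬ ∀ v : Fin p → ℝ,
        l1Norm v ≤ r / ε * l2Norm v → e / 10 * huberRate (l2Norm v) ≤
          huberRisk (fun i => truncWeight β T (z i).1) (fun i => (z i).1) v}
      ≤ ENNReal.ofReal (Real.exp (-Real.log p)) := by
  have hp' : (2 : ℝ) ≤ p := by exact_mod_cast hp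
  have : NeZero p := ⟨by omega⟩
  have hc0 : 0 < c := by rw [hc]; positivity
  have hn' : (0 : ℝ) < n := Nat.cast_pos.2 hn
  -- The union bound over (2p)^m ≤ p^(2m) averages then costs at most half of the exponent cn. As m
  -- ≥ 1, the floor loses at most a factor 2, and Maurey's error stays below the required fraction
  -- of e.
  set m := ⌊c / (4 * ε ^ 2)⌋₊ with hm
  have hx1 : 1 ≤ c / (4 * ε ^ 2) := by rwa [le_div_iff₀ (by positivity), one_mul]
  have hm1 : 1 ≤ m := (Nat.one_le_floor_iff _).2 hx1
  have hmle : (m : ℝ) ≤ c / (4 * ε ^ 2) := Nat.floor_le (by positivity)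
  have hmge : c / (8 * ε ^ 2) ≤ m := by
    have h1 : c / (4 * ε ^ 2) < m + 1 := Nat.lt_floor_add_one _
    have h2 : (1 : ℝ) ≤ m := by exact_mod_cast hm1
    have h3 : c / (8 * ε ^ 2) = c / (4 * ε ^ 2) / 2 := by field_simp; norm_num
    linarith
  have hm0 : (0 : ℝ) < m := by exact_mod_cast hm1
  have hmr : 2 * M ^ 2 * (r / ε) ^ 2 / m ≤ e / 2 / 5 := by
    rw [div_le_iff₀ hm0]
    have h1 : e / 2 / 5 * (c / (8 * ε ^ 2)) ≤ e / 2 / 5 * m :=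
      mul_le_mul_of_nonneg_left hmge (by positivity)
    refine le_trans ?_ h1
    rw [div_pow, mul_div_assoc', mul_div_assoc', div_le_div_iff₀ (by positivity) (by positivity)]
    have := mul_le_mul_of_nonneg_right hr (sq_nonneg ε)
    nlinarith
  set A : (Fin m → Fin p × Bool) → Set (Fin n → (Fin p → ℝ) × ℝ) := fun J =>
    {z | huberRisk (fun i => truncWeight β T (z i).1) (fun i => (z i).1)
      (vertexAverage (r / ε) J) < e / 2 * pseudoHuber (l2Norm (vertexAverage (r / ε) J))}
  have hsub' : {z : Fin n → (Fin p → ℝ) × ℝ | (∀ i, ‖(z i).1‖ ≤ M) ∧ ¬ ∀ v : Fin p → ℝ,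
        l1Norm v ≤ r / ε * l2Norm v → e / 10 * huberRate (l2Norm v) ≤
          huberRisk (fun i => truncWeight β T (z i).1) (fun i => (z i).1) v} ⊆ ⋃ J, A J := by
    rintro z ⟨hz1, hz2⟩
    by_contra hz3
    simp only [Set.mem_iUnion, not_exists] at hz3
    refine hz2 fun v hv => ?_
    have := mul_huberRate_le_huberRisk (ω := fun i => truncWeight β T (z i).1)
      (x := fun i => (z i).1) (fun i => truncWeight_nonneg _ _ _)
      (fun i => truncWeight_le_one _ _ _) hz1 (e := e / 2) (r := r / ε) (by positivity) hm1
      (fun J => not_lt.1 (hz3 J)) hmr hv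
    convert this using 2
    ring
  refine (measure_mono hsub').trans ((measure_iUnion_fintype_le _ _).trans ?_)
  refine (Finset.sum_le_sum fun J _ => glmSampleLaw_huberRisk_lt_le h hψ β hM hσ hsub he0 he hn
    (vertexAverage (r / ε) J)).trans ?_
  rw [← hc, Finset.sum_const, nsmul_eq_mul, ← ENNReal.ofReal_natCast,
    ← ENNReal.ofReal_mul (Nat.cast_nonneg _)]
  apply ENNReal.ofReal_le_ofReal
  have hcard : ((Finset.univ : Finset (Fin m → Fin p × Bool)).card : ℝ) ≤
      Real.exp (2 * m * Real.log p) := by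
    have h1 : Real.exp (2 * m * Real.log p) = ((p : ℝ) ^ 2) ^ m := by
      rw [← Real.exp_log (by positivity : (0 : ℝ) < ((p : ℝ) ^ 2) ^ m), Real.log_pow, Real.log_pow]
      congr 1; push_cast; ring
    rw [h1]
    simp only [Finset.card_univ, Fintype.card_fun, Fintype.card_prod, Fintype.card_fin,
      Fintype.card_bool]
    push_cast
    apply pow_le_pow_left₀ (by positivity)
    nlinarith
  refine (mul_le_mul_of_nonneg_right hcard (Real.exp_nonneg _)).trans ?_
  rw [← Real.exp_add]
  apply Real.exp_le_exp.2
  have h4 : 4 * ε ^ 2 * m ≤ c := by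
    rw [le_div_iff₀ (by positivity)] at hmle
    linarith
  have h5 := mul_le_mul_of_nonneg_left h4 hn'.le
  have h6 := mul_le_mul_of_nonneg_left hεc hn'.le
  rw [← hεn]
  nlinarith

end Events

/-! ### Oracle estimators and stationary points of smooth convex losses -/

section Abstract

variable {p : ℕ} {L : (Fin p → ℝ) → ℝ} {S : Finset (Fin p)}

lemma fderiv_eq_sum (L : (Fin p → ℝ) → ℝ) (β v : Fin p → ℝ) :
    fderiv ℝ L β v = ∑ j, v j * fderiv ℝ L β (Pi.single j 1) := by
  conv_lhs => rw [pi_eq_sum_univ' v, map_sum]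
  simp [smul_eq_mul]

lemma abs_fderiv_le (L : (Fin p → ℝ) → ℝ) (β : Fin p → ℝ) {G : ℝ}
    (hG : ∀ j, j ∈ S → |fderiv ℝ L β (Pi.single j 1)| ≤ G) {v : Fin p → ℝ}
    (hv : ∀ j, j ∉ S → v j = 0) : |fderiv ℝ L β v| ≤ G * l1Norm v := by
  rw [fderiv_eq_sum, l1Norm, Finset.mul_sum]
  refine (Finset.abs_sum_le_sum_abs _ _).trans (Finset.sum_le_sum fun j _ => ?_)
  rw [abs_mul, mul_comm]
  by_cases hj : j ∈ S
  · exact mul_le_mul_of_nonneg_right (hG j hj) (abs_nonneg _)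
  · simp [hv j hj]

/-- Existence of an oracle estimator close to `βs`. -/
lemma exists_oracle (hL : Differentiable ℝ L) {k G α : ℝ} (hS : (S.card : ℝ) ≤ k)
    {βs : Fin p → ℝ} (hβs : ∀ j, j ∉ S → βs j = 0)
    (hG : ∀ j, j ∈ S → |fderiv ℝ L βs (Pi.single j 1)| ≤ G) (hG0 : 0 ≤ G)
    (hα : 0 < α) (hGα : G * Real.sqrt k < α)
    (hrsc : ∀ v : Fin p → ℝ, (∀ j, j ∉ S → v j = 0) →
      α * huberRate (l2Norm v) ≤ L (βs + v) - L βs - fderiv ℝ L βs v) :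
    ∃ βh, IsOracle L S βh ∧ l2Norm (βh - βs) ≤ G * Real.sqrt k / α ∧
      ∀ j ∈ S, fderiv ℝ L βh (Pi.single j 1) = 0 := by
  set ρ := G * Real.sqrt k / α with hρ
  have hρ0 : 0 ≤ ρ := by positivity
  have hρ1 : ρ < 1 := by rw [hρ, div_lt_one hα]; exact hGα
  -- Beyond radius ρ the curvature beats the linear term: quadratically up to distance 1, and
  -- linearly afterwards because G√k < α. A minimizer over the small ball is therefore global on the
  -- subspace.
  have hfar : ∀ β : Fin p → ℝ, (∀ j, j ∉ S → β j = 0) → ρ < l2Norm (β - βs) → L βs < L β := by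
    intro β hβ hlt
    have hv : ∀ j, j ∉ S → (β - βs) j = 0 := fun j hj => by simp [hβ j hj, hβs j hj]
    have h1 := hrsc (β - βs) hv
    rw [add_sub_cancel] at h1
    have h2 := (abs_le.1 (abs_fderiv_le L βs hG hv)).1
    have h3 := mul_le_mul_of_nonneg_left (l1Norm_le_sqrt_mul_l2Norm hS hv) hG0
    set d := l2Norm (β - βs)
    have hd0 : 0 < d := hρ0.trans_lt hlt
    have h4 : G * (Real.sqrt k * d) < α * huberRate d := by
      rcases le_total d 1 with h | h
      · rw [huberRate_of_le_one hd0.le h]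
        rw [hρ, div_lt_iff₀ hα] at hlt
        nlinarith
      · rw [huberRate_of_one_le h]
        nlinarith
    linarith
  set A : Set (Fin p → ℝ) := {β | (∀ j, j ∉ S → β j = 0) ∧ l2Norm (β - βs) ≤ ρ} with hA
  have hcont2 : Continuous fun β : Fin p → ℝ => l2Norm (β - βs) := by
    unfold l2Norm; fun_prop
  have hclosed : IsClosed A := by
    have h1 : IsClosed {β : Fin p → ℝ | ∀ j, j ∉ S → β j = 0} := by
      simp only [Set.ofPred_forall]
      exact isClosed_iInter fun j => isClosed_iInter fun _ =>
        isClosed_eq (continuous_apply j) continuous_const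
    exact h1.inter (isClosed_le hcont2 continuous_const)
  have hbdd : A ⊆ Metric.closedBall βs ρ := by
    intro β hβ
    rw [mem_closedBall_iff_norm, pi_norm_le_iff_of_nonneg hρ0]
    intro j
    refine le_trans ?_ hβ.2
    rw [Real.norm_eq_abs, l2Norm]
    apply Real.abs_le_sqrt
    exact Finset.single_le_sum (f := fun j => (β - βs) j ^ 2) (fun _ _ => sq_nonneg _)
      (Finset.mem_univ j)
  have hcomp : IsCompact A := (isCompact_closedBall βs ρ).of_isClosed_subset hclosed hbdd
  have hmem : βs ∈ A := ⟨hβs, by simpa [l2Norm] using hρ0⟩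
  obtain ⟨βh, hβh, hmin⟩ := hcomp.exists_isMinOn ⟨βs, hmem⟩ hL.continuous.continuousOn
  have horacle : IsOracle L S βh := by
    refine ⟨hβh.1, fun β hβ => ?_⟩
    rcases le_or_gt (l2Norm (β - βs)) ρ with h | h
    · exact hmin (show β ∈ A from ⟨hβ, h⟩)
    · exact (hmin hmem).trans (hfar β hβ h).le
  refine ⟨βh, horacle, hβh.2, fun j hj => ?_⟩
  have hd : HasDerivAt (fun t : ℝ => L (βh + t • Pi.single j (1 : ℝ)))
      (fderiv ℝ L βh (Pi.single j 1)) 0 := by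
    have h1 : HasDerivAt (fun t : ℝ => βh + t • Pi.single j (1 : ℝ)) (Pi.single j (1 : ℝ)) 0 := by
      have := ((hasDerivAt_id (0 : ℝ)).smul_const (Pi.single j (1 : ℝ) : Fin p → ℝ)).const_add βh
      simpa using this
    have h2 : HasFDerivAt L (fderiv ℝ L βh) (βh + (0 : ℝ) • Pi.single j (1 : ℝ)) := by
      rw [zero_smul, add_zero]; exact (hL βh).hasFDerivAt
    exact h2.comp_hasDerivAt (0 : ℝ) h1
  refine IsLocalMin.hasDerivAt_eq_zero (Filter.Eventually.of_forall fun t => ?_) hd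
  rw [zero_smul, add_zero]
  refine horacle.2 _ fun i hi => ?_
  have : i ≠ j := fun h => hi (h ▸ hj)
  simp [hβh.1 i hi, this]

lemma isOracle_iff {βh : Fin p → ℝ} (hor : IsOracle L S βh)
    (hgrad : ∀ j ∈ S, fderiv ℝ L βh (Pi.single j 1) = 0) {α : ℝ} (hα : 0 < α)
    (hrsc : ∀ v : Fin p → ℝ, (∀ j, j ∉ S → v j = 0) →
      α * huberRate (l2Norm v) ≤ L (βh + v) - L βh - fderiv ℝ L βh v) (β : Fin p → ℝ) :
    IsOracle L S β ↔ β = βh := by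
  refine ⟨fun h => ?_, fun h => h ▸ hor⟩
  have hv : ∀ j, j ∉ S → (β - βh) j = 0 := fun j hj => by simp [h.1 j hj, hor.1 j hj]
  have h1 := hrsc (β - βh) hv
  have h2 := abs_fderiv_le L βh (G := 0) (S := S) (fun j hj => by simp [hgrad j hj]) hv
  rw [zero_mul, abs_nonpos_iff] at h2
  rw [add_sub_cancel, h2] at h1
  have h3 := h.2 βh hor.1
  by_contra hne
  have h4 : 0 < l2Norm (β - βh) := lt_of_le_of_ne (l2Norm_nonneg _) fun h0 =>
    hne (sub_eq_zero.1 (l2Norm_eq_zero.1 h0.symm))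
  have := mul_pos hα (huberRate_pos h4)
  linarith

variable {ρ : ℝ → ℝ} {lam μ γ R : ℝ}

/-- The oracle estimator is a stationary point, by strict dual feasibility. -/
lemma isStationaryPoint_oracle (hρ : IsAmenable ρ lam μ γ) {βh : Fin p → ℝ}
    (hR : l1Norm βh ≤ R) (hsupp : ∀ j, j ∉ S → βh j = 0)
    (hbig : ∀ j ∈ S, γ * lam < |βh j|)
    (hgrad : ∀ j ∈ S, fderiv ℝ L βh (Pi.single j 1) = 0)
    (hdual : ∀ j, j ∉ S → |fderiv ℝ L βh (Pi.single j 1)| ≤ lam / 2) :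
    IsStationaryPoint L ρ R βh := by
  -- On S the strict inequality keeps nearby points in the flat region of ρ; off S the one-sided
  -- slope λ outweighs a gradient of size at most λ/2.
  refine ⟨hR, fun β' _ => ⟨∑ j, if j ∈ S then 0 else lam * |(β' - βh) j|, ?_, ?_⟩⟩
  · refine tendsto_finsetSum _ fun j _ => ?_
    have hcont : Tendsto (fun t : ℝ => βh j + t * (β' j - βh j)) (𝓝[>] 0) (𝓝 (βh j)) := by
      have : Continuous fun t : ℝ => βh j + t * (β' j - βh j) := by fun_prop
      have h0 := this.tendsto 0
      rw [zero_mul, add_zero] at h0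
      exact h0.mono_left nhdsWithin_le_nhds
    split_ifs with hj
    · refine tendsto_const_nhds.congr' ?_
      filter_upwards [hcont.abs.eventually (lt_mem_nhds (hbig j hj))] with t ht
      rw [hρ.deriv_eq_zero_of_le_abs ht.le, zero_mul]
    · simp only [hsupp j hj, zero_add, sub_zero, Pi.sub_apply] at hcont ⊢
      rcases lt_trichotomy (β' j) 0 with h | h | h
      · have h1 : Tendsto (fun t : ℝ => -(t * β' j)) (𝓝[>] 0) (𝓝[>] 0) := by
          refine tendsto_nhdsWithin_iff.2 ⟨by simpa using hcont.neg, ?_⟩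
          filter_upwards [self_mem_nhdsWithin] with t ht
          have : 0 < t := ht
          simp only [Set.mem_Ioi]
          nlinarith
        have h2 := ((hρ.selection.comp h1).neg).mul_const (β' j)
        rw [abs_of_neg h]
        convert h2 using 2 with t
        · simp [hρ.deriv_neg]
        · ring
      · simp [h]
      · have h1 : Tendsto (fun t : ℝ => t * β' j) (𝓝[>] 0) (𝓝[>] 0) := by
          refine tendsto_nhdsWithin_iff.2 ⟨hcont, ?_⟩
          filter_upwards [self_mem_nhdsWithin] with t ht
          exact mul_pos (show (0 : ℝ) < t from ht) h
        rw [abs_of_pos h]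
        exact (hρ.selection.comp h1).mul_const (β' j)
  · rw [fderiv_eq_sum, ← Finset.sum_add_distrib]
    refine Finset.sum_nonneg fun j _ => ?_
    split_ifs with hj
    · simp [hgrad j hj]
    · have h1 : |(β' - βh) j * fderiv ℝ L βh (Pi.single j 1)| ≤
          |(β' - βh) j| * (lam / 2) := by
        rw [abs_mul]; exact mul_le_mul_of_nonneg_left (hdual j hj) (abs_nonneg _)
      have h2 := (abs_le.1 h1).1
      have h3 := mul_nonneg hρ.lam_nonneg (abs_nonneg ((β' - βh) j))
      linarith

/-- The regularizer's directional derivative towards a point whose nonzero entries lie in the flat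
part of the regularizer. -/
lemma IsAmenable.deriv_mul_sub_le (hρ : IsAmenable ρ lam μ γ) {b β t : ℝ} (ht0 : 0 < t)
    (ht1 : t < 1) (hb : γ * lam ≤ |b|) :
    deriv ρ (β + t * (b - β)) * (b - β) ≤ μ * (b - β) ^ 2 := by
  set x := β + t * (b - β) with hx
  have hb0 : deriv ρ b = 0 := hρ.deriv_eq_zero_of_le_abs hb
  have hμ := hρ.mu_nonneg
  have hbx : b - x = (1 - t) * (b - β) := by rw [hx]; ring
  rcases le_total β b with h | h
  · have h1 := hρ.monotone_deriv_add (show x ≤ b by nlinarith)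
    simp only [hb0, zero_add] at h1
    have h2 : deriv ρ x ≤ μ * (b - β) := by
      have : μ * (b - x) ≤ μ * (b - β) := mul_le_mul_of_nonneg_left (by nlinarith) hμ
      linarith
    nlinarith
  · have h1 := hρ.monotone_deriv_add (show b ≤ x by nlinarith)
    simp only [hb0, zero_add] at h1
    have h2 : μ * (b - β) ≤ deriv ρ x := by
      have : μ * (b - β) ≤ μ * (b - x) := mul_le_mul_of_nonneg_left (by nlinarith) hμ
      linarith
    nlinarith

/-- Off the support the target is 0, and ρ'(x) ≥ λ - μx at the positive point x = (1 - t)|β| yields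
the additional gain λ|β|; oddness covers negative β. -/
lemma IsAmenable.deriv_mul_neg_le (hρ : IsAmenable ρ lam μ γ) {β t : ℝ} (ht0 : 0 < t)
    (ht1 : t < 1) :
    deriv ρ (β + t * (0 - β)) * (0 - β) ≤ μ * (0 - β) ^ 2 - lam * |0 - β| := by
  have hμ := hρ.mu_nonneg
  have hpos : ∀ β : ℝ, 0 < β → deriv ρ ((1 - t) * β) * (-β) ≤ μ * β ^ 2 - lam * β := by
    intro β hβ
    have h1 := hρ.le_deriv_add (mul_pos (sub_pos.2 ht1) hβ)
    have h2 : μ * ((1 - t) * β) ≤ μ * β := mul_le_mul_of_nonneg_left (by nlinarith) hμ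
    nlinarith
  have hx : β + t * (0 - β) = (1 - t) * β := by ring
  rw [hx, zero_sub, abs_neg]
  rcases lt_trichotomy β 0 with h | rfl | h
  · have := hpos (-β) (by linarith)
    rw [mul_neg (1 - t), hρ.deriv_neg] at this
    rw [abs_of_neg h]
    linarith
  · simp
  · have := hpos β h
    rw [abs_of_pos h]
    linarith

/-- Uniqueness of the stationary point under restricted strong convexity at the oracle. -/
lemma eq_oracle_of_isStationaryPoint (hρ : IsAmenable ρ lam μ γ) {βh : Fin p → ℝ}
    (hR : l1Norm βh ≤ R) (hsupp : ∀ j, j ∉ S → βh j = 0)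
    (hbig : ∀ j ∈ S, γ * lam ≤ |βh j|)
    (hgrad : ∀ j ∈ S, fderiv ℝ L βh (Pi.single j 1) = 0)
    (hdual : ∀ j, j ∉ S → |fderiv ℝ L βh (Pi.single j 1)| ≤ lam / 2)
    (hconv : ∀ β v : Fin p → ℝ, 0 ≤ L (β + v) - L β - fderiv ℝ L β v)
    {k α r : ℝ} (hα : 0 < α) (hS : (S.card : ℝ) ≤ k) (hr : 0 < r) (hkr : Real.sqrt k ≤ r / 2)
    (hrsc : ∀ v : Fin p → ℝ, l1Norm v ≤ r * l2Norm v →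
      α * huberRate (l2Norm v) ≤ L (βh + v) - L βh - fderiv ℝ L βh v)
    (hlam : 0 < lam) (hμ : μ < α) (hlamR : 3 * (lam * R) ≤ α) (hrR : 8 * α * R ≤ lam * r ^ 2)
    {β : Fin p → ℝ} (hβ : IsStationaryPoint L ρ R β) : β = βh := by
  by_contra hne
  have hμ0 := hρ.mu_nonneg
  obtain ⟨v, hv⟩ : ∃ v, v = β - βh := ⟨_, rfl⟩
  have hβv : β = βh + v := by rw [hv]; abel
  have hneg : βh - β = -v := by rw [hv]; abel
  have hv0 : 0 < l2Norm v := lt_of_le_of_ne (l2Norm_nonneg _) fun h0 =>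
    hne (by rw [hβv, l2Norm_eq_zero.1 h0.symm, add_zero])
  have hvR : l1Norm v ≤ 2 * R := by
    rw [hv]; exact (l1Norm_sub_le _ _).trans (by linarith [hβ.1])
  obtain ⟨d, hd, hd0⟩ := hβ.2 βh hR
  rw [hneg, map_neg] at hd0
  set off := ∑ j, if j ∈ S then 0 else |v j| with hoff
  -- the two bounds for the directional derivative of the regularizer
  have hd1 : d ≤ μ * l2Norm v ^ 2 - lam * off := by
    refine le_of_tendsto hd ?_
    filter_upwards [Ioo_mem_nhdsGT (show (0 : ℝ) < 1 by norm_num)] with t ht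
    have e : μ * l2Norm v ^ 2 - lam * off =
        ∑ j, (μ * v j ^ 2 - lam * if j ∈ S then 0 else |v j|) := by
      rw [Finset.sum_sub_distrib, ← Finset.mul_sum, ← Finset.mul_sum, l2Norm_sq]
    rw [e]
    refine Finset.sum_le_sum fun j _ => ?_
    have hvj : βh j - β j = -v j := by rw [hv]; simp
    split_ifs with hj
    · have := hρ.deriv_mul_sub_le (β := β j) ht.1 ht.2 (hbig j hj)
      rw [hvj, neg_sq] at this
      rw [hvj]; linarith
    · have := hρ.deriv_mul_neg_le (β := β j) ht.1 ht.2
      rw [← hsupp j hj, hvj, neg_sq, abs_neg] at this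
      rwa [hvj]
  have hd2 : d ≤ lam * l1Norm v := by
    refine le_of_tendsto hd (Filter.Eventually.of_forall fun t => ?_)
    rw [l1Norm, Finset.mul_sum]
    refine Finset.sum_le_sum fun j _ => (le_abs_self _).trans ?_
    rw [abs_mul]
    have hvj : βh j - β j = -v j := by rw [hv]; simp
    rw [hvj, abs_neg]
    exact mul_le_mul_of_nonneg_right (hρ.abs_deriv_le _) (abs_nonneg _)
  have hgradv : -(lam / 2 * off) ≤ fderiv ℝ L βh v := by
    rw [fderiv_eq_sum, hoff, Finset.mul_sum, ← Finset.sum_neg_distrib]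
    refine Finset.sum_le_sum fun j _ => ?_
    split_ifs with hj
    · simp [hgrad j hj]
    · refine le_trans (neg_le_neg ?_) (neg_abs_le _)
      rw [abs_mul, mul_comm (lam / 2)]
      exact mul_le_mul_of_nonneg_left (hdual j hj) (abs_nonneg _)
  have hoff0 : 0 ≤ off := Finset.sum_nonneg fun j _ => by split_ifs <;> simp
  have hoff1 : l1Norm v ≤ off + Real.sqrt k * l2Norm v := by
    have h1 := sum_abs_le_sqrt_mul_l2Norm S hS v
    have h2 : l1Norm v = off + ∑ j ∈ S, |v j| := by
      rw [l1Norm, hoff, ← Finset.sum_filter_add_sum_filter_not Finset.univ (· ∈ S),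
        Finset.sum_ite, Finset.sum_const_zero, zero_add, add_comm]
      congr 1
      exact Finset.sum_congr (by simp) fun _ _ => rfl
    linarith
  have hoff2 : off ≤ l1Norm v := Finset.sum_le_sum fun j _ => by
    split_ifs
    · exact abs_nonneg _
    · exact le_rfl
  -- The divergence from β back to βh is nonnegative, so convexity suffices at β and curvature is
  -- needed only at the oracle.
  have hmono : L (βh + v) - L βh - fderiv ℝ L βh v ≤ fderiv ℝ L β v - fderiv ℝ L βh v := by
    have := hconv β (-v)
    rw [map_neg, ← hneg, add_sub_cancel] at this
    rw [← hβv]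
    linarith
  have hconvh := hconv βh v
  rcases le_or_gt (l1Norm v) (r * l2Norm v) with hcase | hcase
  -- Inside the cone: for ‖v‖₂ ≤ 1 one gets α‖v‖₂² ≤ μ‖v‖₂²; for ‖v‖₂ > 1, α‖v‖₂ ≤ (3/2)λ‖v‖₁ ≤ 3λR
  -- ≤ α. Both are impossible.
  · have h1 := hrsc v hcase
    rcases le_or_gt (l2Norm v) 1 with h | h
    · rw [huberRate_of_le_one hv0.le h] at h1
      have : μ * l2Norm v ^ 2 < α * l2Norm v ^ 2 := mul_lt_mul_of_pos_right hμ (by positivity)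
      nlinarith
    · rw [huberRate_of_one_le h.le] at h1
      have h2 : lam / 2 * off ≤ lam / 2 * l1Norm v :=
        mul_le_mul_of_nonneg_left hoff2 (by positivity)
      have h3 : lam * l1Norm v ≤ lam * (2 * R) := mul_le_mul_of_nonneg_left hvR hlam.le
      nlinarith
  -- Outside the cone at least half of ‖v‖₁ lies off S, so (λ/4)‖v‖₁ ≤ μ‖v‖₂² ≤ μ‖v‖₁²/r², which
  -- forces ‖v‖₁ > 2R.
  · have h1 : lam / 2 * off ≤ μ * l2Norm v ^ 2 := by linarith
    have h2 : Real.sqrt k * l2Norm v ≤ l1Norm v / 2 := by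
      have := mul_le_mul_of_nonneg_right hkr hv0.le
      linarith
    have h3 : lam / 4 * l1Norm v ≤ μ * l2Norm v ^ 2 := by
      have : lam / 2 * (l1Norm v / 2) ≤ lam / 2 * off :=
        mul_le_mul_of_nonneg_left (by linarith) (by positivity)
      linarith
    have hl1 : 0 < l1Norm v := (mul_pos hr hv0).trans hcase
    have h4 : r ^ 2 * l2Norm v ^ 2 ≤ l1Norm v ^ 2 := by
      rw [← mul_pow]; exact pow_le_pow_left₀ (by positivity) hcase.le 2
    have h5 : r ^ 2 * (lam / 4 * l1Norm v) ≤ μ * l1Norm v ^ 2 := by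
      have a1 := mul_le_mul_of_nonneg_left h3 (sq_nonneg r)
      have a2 := mul_le_mul_of_nonneg_left h4 hμ0
      linarith
    have h6 : r ^ 2 * (lam / 4) ≤ μ * l1Norm v := by
      have : (r ^ 2 * (lam / 4)) * l1Norm v ≤ (μ * l1Norm v) * l1Norm v := by linarith
      exact le_of_mul_le_mul_right this hl1
    have h7 : μ * l1Norm v < α * (2 * R) := by
      have : μ * l1Norm v < α * l1Norm v := mul_lt_mul_of_pos_right hμ hl1
      have := mul_le_mul_of_nonneg_left hvR hα.le
      linarith
    linarith

/-- The `ℓ_∞`-error and the dual variables of the oracle estimator, in terms of the score `g` and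
of the error of the linearization of the gradient by the matrix `Q`. -/
lemma oracle_bounds {Q : Matrix (Fin p) (Fin p) ℝ} {g d Δ rem : Fin p → ℝ} {cInf G E u : ℝ}
    (hsymm : ∀ i j, Q i j = Q j i) (hΔ : ∀ j, j ∉ S → Δ j = 0)
    (hrem : ∀ j, d j = g j + ∑ l, Q j l * Δ l + rem j) (hremE : ∀ j, |rem j| ≤ E)
    (hg : ∀ j, |g j| ≤ G) (hd : ∀ j ∈ S, d j = 0)
    (hdet : IsUnit (principalSub Q S).det) (hinv : LinftyOpNormLE (principalSub Q S)⁻¹ cInf)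
    (U : Fin p → Fin p → ℝ) (hU0 : ∀ j i, i ∉ S → U j i = 0)
    (hU : ∀ j, ∀ l ∈ S, ∑ i, Q l i * U j i = Q l j)
    (hUg : ∀ j, |∑ i, U j i * g i| ≤ G) (hUu : ∀ j, l1Norm (U j) ≤ u) :
    (∀ j ∈ S, |Δ j| ≤ cInf * (G + E)) ∧ ∀ j, |d j| ≤ 2 * G + E + u * E := by
  constructor
  · intro j hj
    set q := principalSub Q S
    have hq : q.mulVec (fun l : S => Δ l) = fun l : S => -(g l + rem l) := by
      ext l
      have h1 := hrem l
      rw [hd l l.2] at h1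
      have h2 : ∑ i, Q l i * Δ i = ∑ i : S, Q l i * Δ i := by
        rw [Finset.sum_coe_sort S fun i => Q l i * Δ i]
        exact (Finset.sum_subset (Finset.subset_univ S) fun i _ hi => by simp [hΔ i hi]).symm
      have h3 : q.mulVec (fun l : S => Δ l) l = ∑ i : S, Q l i * Δ i := rfl
      rw [h3, ← h2]
      linarith
    have hsol : (fun l : S => Δ l) = q⁻¹.mulVec fun l : S => -(g l + rem l) := by
      rw [← hq, Matrix.mulVec_mulVec, Matrix.nonsing_inv_mul _ hdet, Matrix.one_mulVec]
    have hj' : Δ j = ∑ l : S, q⁻¹ ⟨j, hj⟩ l * -(g l + rem l) := congrFun hsol ⟨j, hj⟩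
    have hGE : 0 ≤ G + E := add_nonneg ((abs_nonneg _).trans (hg j)) ((abs_nonneg _).trans (hremE j))
    rw [hj']
    refine (Finset.abs_sum_le_sum_abs _ _).trans ?_
    refine le_trans ?_ (mul_le_mul_of_nonneg_right (hinv ⟨j, hj⟩) hGE)
    rw [Finset.sum_mul]
    refine Finset.sum_le_sum fun l _ => ?_
    rw [abs_mul, abs_neg]
    exact mul_le_mul_of_nonneg_left
      ((abs_add_le _ _).trans (add_le_add (hg l) (hremE l))) (abs_nonneg _)
  · intro j
    -- Row j of Q on S is a combination U_j of the rows in S, where the vanishing gradient expresses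
    -- QΔ through score and remainder. The score enters only through U_jᵀg, so no ℓ₁-bound on U_j is
    -- multiplied by G.
    have h1 : ∑ l, Q j l * Δ l = -∑ i, U j i * g i - ∑ i, U j i * rem i := by
      have e1 : ∑ l, Q j l * Δ l = ∑ l, ∑ i, Q l i * U j i * Δ l := by
        refine Finset.sum_congr rfl fun l _ => ?_
        by_cases hl : l ∈ S
        · rw [← Finset.sum_mul, hU j l hl, hsymm j l]
        · simp [hΔ l hl]
      have e2 : ∑ l, ∑ i, Q l i * U j i * Δ l = ∑ i, U j i * ∑ l, Q i l * Δ l := by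
        rw [Finset.sum_comm]
        refine Finset.sum_congr rfl fun i _ => ?_
        rw [Finset.mul_sum]
        exact Finset.sum_congr rfl fun l _ => by rw [hsymm l i]; ring
      rw [e1, e2, ← Finset.sum_neg_distrib, ← Finset.sum_sub_distrib]
      refine Finset.sum_congr rfl fun i _ => ?_
      by_cases hi : i ∈ S
      · have := hrem i
        rw [hd i hi] at this
        have h2 : ∑ l, Q i l * Δ l = -g i - rem i := by linarith
        rw [h2]; ring
      · simp [hU0 j i hi]
    have h2 : |∑ i, U j i * rem i| ≤ u * E := by
      have hE : 0 ≤ E := (abs_nonneg _).trans (hremE j)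
      refine (Finset.abs_sum_le_sum_abs _ _).trans
        (le_trans ?_ (mul_le_mul_of_nonneg_right (hUu j) hE))
      rw [l1Norm, Finset.sum_mul]
      refine Finset.sum_le_sum fun i _ => ?_
      rw [abs_mul]
      exact mul_le_mul_of_nonneg_left (hremE i) (abs_nonneg _)
    rw [hrem j, h1]
    have a1 := abs_le.1 (hg j)
    have a2 := abs_le.1 (hUg j)
    have a3 := abs_le.1 (hremE j)
    have a4 := abs_le.1 h2
    rw [abs_le]
    constructor <;> linarith

end Abstract

/-! ### The negative log-likelihood of a good sample -/

section Loss

variable {n p : ℕ} {ψ : ℝ → ℝ} {z : Fin n → (Fin p → ℝ) × ℝ}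

lemma hasFDerivAt_glmLoss (hψ : Differentiable ℝ ψ) (z : Fin n → (Fin p → ℝ) × ℝ)
    (β : Fin p → ℝ) :
    HasFDerivAt (glmLoss ψ z) ((1 / (n : ℝ)) • ∑ i, (deriv ψ ((z i).1 ⬝ᵥ β) - (z i).2) •
      LinearMap.toContinuousLinearMap (dotProductBilin ℝ ℝ (z i).1)) β := by
  have h1 : ∀ i, HasFDerivAt (fun β : Fin p → ℝ => (z i).1 ⬝ᵥ β)
      (LinearMap.toContinuousLinearMap (dotProductBilin ℝ ℝ (z i).1)) β := fun i =>
    (LinearMap.toContinuousLinearMap (dotProductBilin ℝ ℝ (z i).1)).hasFDerivAt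
  have h2 : ∀ i ∈ Finset.univ, HasFDerivAt
      (fun β : Fin p → ℝ => ψ ((z i).1 ⬝ᵥ β) - (z i).2 * ((z i).1 ⬝ᵥ β))
      ((deriv ψ ((z i).1 ⬝ᵥ β) - (z i).2) •
        LinearMap.toContinuousLinearMap (dotProductBilin ℝ ℝ (z i).1)) β := fun i _ => by
    have h3 := ((hψ ((z i).1 ⬝ᵥ β)).hasDerivAt.comp_hasFDerivAt β (h1 i)).sub
      ((h1 i).const_mul (z i).2)
    rw [← sub_smul] at h3
    exact h3
  exact (HasFDerivAt.fun_sum h2).const_mul (1 / (n : ℝ))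

lemma fderiv_glmLoss (hψ : Differentiable ℝ ψ) (z : Fin n → (Fin p → ℝ) × ℝ)
    (β v : Fin p → ℝ) : fderiv ℝ (glmLoss ψ z) β v =
      1 / (n : ℝ) * ∑ i, (deriv ψ ((z i).1 ⬝ᵥ β) - (z i).2) * ((z i).1 ⬝ᵥ v) := by
  rw [(hasFDerivAt_glmLoss hψ z β).fderiv]
  simp [dotProductBilin_apply_apply]

lemma glmLoss_bregman (hψ : Differentiable ℝ ψ) (z : Fin n → (Fin p → ℝ) × ℝ)
    (β v : Fin p → ℝ) :
    glmLoss ψ z (β + v) - glmLoss ψ z β - fderiv ℝ (glmLoss ψ z) β v =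
      1 / (n : ℝ) * ∑ i, (ψ ((z i).1 ⬝ᵥ β + (z i).1 ⬝ᵥ v) - ψ ((z i).1 ⬝ᵥ β) -
        deriv ψ ((z i).1 ⬝ᵥ β) * ((z i).1 ⬝ᵥ v)) := by
  rw [fderiv_glmLoss hψ, glmLoss, glmLoss, ← mul_sub, ← mul_sub, ← Finset.sum_sub_distrib,
    ← Finset.sum_sub_distrib]
  congr 1
  refine Finset.sum_congr rfl fun i _ => ?_
  rw [dotProduct_add]
  ring

lemma glmLoss_bregman_nonneg (hψ : ContDiff ℝ 2 ψ) (h0 : ∀ t, 0 ≤ iteratedDeriv 2 ψ t)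
    (z : Fin n → (Fin p → ℝ) × ℝ) (β v : Fin p → ℝ) :
    0 ≤ glmLoss ψ z (β + v) - glmLoss ψ z β - fderiv ℝ (glmLoss ψ z) β v := by
  rw [glmLoss_bregman (hψ.differentiable (by norm_num))]
  refine mul_nonneg (by positivity) (Finset.sum_nonneg fun i _ => ?_)
  obtain ⟨ξ, -, h⟩ := exists_taylor_two hψ ((z i).1 ⬝ᵥ β) ((z i).1 ⬝ᵥ v)
  rw [h]
  have := mul_nonneg (h0 ξ) (sq_nonneg ((z i).1 ⬝ᵥ v))
  linarith

/-- Terms inside the truncation have |xᵀβ| ≤ T + 1, and one more unit is needed for the Taylor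
point, hence T + 2. The other terms are nonnegative by convexity. Allowing β ≠ β* gives curvature at
the oracle itself. -/
lemma mul_huberRisk_le_glmLoss_bregman (hψ : ContDiff ℝ 2 ψ)
    (h0 : ∀ t, 0 ≤ iteratedDeriv 2 ψ t) {c T : ℝ} (hc : 0 ≤ c)
    (hcT : ∀ t, |t| ≤ T + 2 → c ≤ iteratedDeriv 2 ψ t) {βs β : Fin p → ℝ}
    (hβ : ∀ i, |(z i).1 ⬝ᵥ (β - βs)| ≤ 1) (v : Fin p → ℝ) :
    c / 2 * huberRisk (fun i => truncWeight βs T (z i).1) (fun i => (z i).1) v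
      ≤ glmLoss ψ z (β + v) - glmLoss ψ z β - fderiv ℝ (glmLoss ψ z) β v := by
  rw [glmLoss_bregman (hψ.differentiable (by norm_num)), huberRisk, mul_left_comm, Finset.mul_sum]
  refine mul_le_mul_of_nonneg_left (Finset.sum_le_sum fun i _ => ?_) (by positivity)
  unfold truncWeight
  split_ifs with h
  · rw [one_mul]
    refine mul_pseudoHuber_le_bregman hψ h0 hc (T := T + 1) (fun t ht => hcT t (by linarith)) ?_ _
    have e : (z i).1 ⬝ᵥ β = (z i).1 ⬝ᵥ βs + (z i).1 ⬝ᵥ (β - βs) := by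
      rw [← dotProduct_add, add_sub_cancel]
    rw [e]
    exact (abs_add_le _ _).trans (add_le_add h (hβ i))
  · rw [zero_mul, mul_zero]
    obtain ⟨ξ, -, h⟩ := exists_taylor_two hψ ((z i).1 ⬝ᵥ β) ((z i).1 ⬝ᵥ v)
    rw [h]
    have := mul_nonneg (h0 ξ) (sq_nonneg ((z i).1 ⬝ᵥ v))
    linarith

/-- The empirical second moments in terms of the empirical covariance matrix. -/
lemma average_sq_le {Sg : Matrix (Fin p) (Fin p) ℝ} {E σ2 : ℝ}
    (hcov : ∀ j l, |1 / (n : ℝ) * ∑ i, (z i).1 j * (z i).1 l - Sg j l| ≤ E) {v : Fin p → ℝ}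
    (hSg : ∑ j, v j * ∑ l, Sg j l * v l ≤ σ2) :
    1 / (n : ℝ) * ∑ i, ((z i).1 ⬝ᵥ v) ^ 2 ≤ σ2 + E * l1Norm v ^ 2 := by
  have e1 : 1 / (n : ℝ) * ∑ i, ((z i).1 ⬝ᵥ v) ^ 2 =
      ∑ j, ∑ l, (v j * v l) * (1 / (n : ℝ) * ∑ i, (z i).1 j * (z i).1 l) := by
    have : ∀ i, ((z i).1 ⬝ᵥ v) ^ 2 = ∑ j, ∑ l, (v j * v l) * ((z i).1 j * (z i).1 l) := by
      intro i
      rw [sq, dotProduct, Finset.sum_mul_sum]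
      exact Finset.sum_congr rfl fun j _ => Finset.sum_congr rfl fun l _ => by ring
    simp_rw [this]
    rw [Finset.sum_comm, Finset.mul_sum]
    refine Finset.sum_congr rfl fun j _ => ?_
    rw [Finset.sum_comm, Finset.mul_sum]
    refine Finset.sum_congr rfl fun l _ => ?_
    rw [← Finset.mul_sum]; ring
  have e2 : ∑ j, ∑ l, (v j * v l) * (1 / (n : ℝ) * ∑ i, (z i).1 j * (z i).1 l) =
      ∑ j, v j * ∑ l, Sg j l * v l +
      ∑ j, ∑ l, (v j * v l) * (1 / (n : ℝ) * ∑ i, (z i).1 j * (z i).1 l - Sg j l) := by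
    rw [← Finset.sum_add_distrib]
    refine Finset.sum_congr rfl fun j _ => ?_
    rw [Finset.mul_sum, ← Finset.sum_add_distrib]
    exact Finset.sum_congr rfl fun l _ => by ring
  have e3 : E * l1Norm v ^ 2 = ∑ j, ∑ l, |v j| * |v l| * E := by
    rw [sq, l1Norm, Finset.sum_mul_sum, Finset.mul_sum]
    refine Finset.sum_congr rfl fun j _ => ?_
    rw [Finset.mul_sum]
    exact Finset.sum_congr rfl fun l _ => by ring
  rw [e1, e2, e3]
  refine add_le_add hSg (Finset.sum_le_sum fun j _ => Finset.sum_le_sum fun l _ => ?_)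
  refine (le_abs_self _).trans ?_
  rw [abs_mul, abs_mul]
  exact mul_le_mul_of_nonneg_left (hcov j l) (by positivity)

/-- The linearization error of the gradient of the loss. -/
lemma abs_fderiv_glmLoss_sub_le (hψ : ContDiff ℝ 3 ψ) {κ M E : ℝ}
    (hκ : ∀ t, |iteratedDeriv 3 ψ t| ≤ κ) (hM : ∀ i, ‖(z i).1‖ ≤ M) (hM0 : 0 ≤ M)
    {Q : Matrix (Fin p) (Fin p) ℝ} {βs : Fin p → ℝ}
    (hhess : ∀ j l, |1 / (n : ℝ) * ∑ i, iteratedDeriv 2 ψ ((z i).1 ⬝ᵥ βs) *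
      ((z i).1 j * (z i).1 l) - Q j l| ≤ E) (v : Fin p → ℝ) (j : Fin p) :
    |fderiv ℝ (glmLoss ψ z) (βs + v) (Pi.single j 1) -
        fderiv ℝ (glmLoss ψ z) βs (Pi.single j 1) - ∑ l, Q j l * v l|
      ≤ M * κ / 2 * (1 / (n : ℝ) * ∑ i, ((z i).1 ⬝ᵥ v) ^ 2) + E * l1Norm v := by
  have hψ2 : ContDiff ℝ 2 ψ := hψ.of_le (by norm_num)
  have hψ1 : Differentiable ℝ ψ := hψ.differentiable (by norm_num)
  have hdψ : ContDiff ℝ 2 (deriv ψ) := (contDiff_succ_iff_deriv.1 (by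
    rw [show (2 : WithTop ℕ∞) + 1 = 3 by norm_num]; exact hψ)).2.2
  have hd2 : ∀ t, iteratedDeriv 2 (deriv ψ) t = iteratedDeriv 3 ψ t := fun t => by
    rw [iteratedDeriv_succ' (n := 2)]
  have hd1 : ∀ t, deriv (deriv ψ) t = iteratedDeriv 2 ψ t := fun t => by
    rw [iteratedDeriv_succ, iteratedDeriv_one]
  -- Two sources of error: the Taylor remainder of ψ', controlled by ψ''', and the deviation of the
  -- empirical Hessian from Q.
  have e1 : fderiv ℝ (glmLoss ψ z) (βs + v) (Pi.single j 1) -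
      fderiv ℝ (glmLoss ψ z) βs (Pi.single j 1) - ∑ l, Q j l * v l =
      1 / (n : ℝ) * ∑ i, (z i).1 j * (deriv ψ ((z i).1 ⬝ᵥ βs + (z i).1 ⬝ᵥ v) -
        deriv ψ ((z i).1 ⬝ᵥ βs) - deriv (deriv ψ) ((z i).1 ⬝ᵥ βs) * ((z i).1 ⬝ᵥ v)) +
      ∑ l, (1 / (n : ℝ) * ∑ i, iteratedDeriv 2 ψ ((z i).1 ⬝ᵥ βs) *
        ((z i).1 j * (z i).1 l) - Q j l) * v l := by
    have e2 : ∑ l, (1 / (n : ℝ) * ∑ i, iteratedDeriv 2 ψ ((z i).1 ⬝ᵥ βs) *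
        ((z i).1 j * (z i).1 l) - Q j l) * v l =
        1 / (n : ℝ) * ∑ i, (z i).1 j * (deriv (deriv ψ) ((z i).1 ⬝ᵥ βs) * ((z i).1 ⬝ᵥ v)) -
        ∑ l, Q j l * v l := by
      simp_rw [sub_mul]
      rw [Finset.sum_sub_distrib]
      congr 1
      simp_rw [mul_assoc (1 / (n : ℝ)), Finset.sum_mul]
      rw [← Finset.mul_sum, Finset.sum_comm]
      congr 1
      refine Finset.sum_congr rfl fun i _ => ?_
      rw [hd1]
      generalize iteratedDeriv 2 ψ ((z i).1 ⬝ᵥ βs) = w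
      rw [dotProduct, Finset.mul_sum, Finset.mul_sum]
      exact Finset.sum_congr rfl fun l _ => by ring
    rw [e2, fderiv_glmLoss hψ1, fderiv_glmLoss hψ1, ← mul_sub, ← Finset.sum_sub_distrib,
      add_sub, ← mul_add, ← Finset.sum_add_distrib]
    congr 2
    refine Finset.sum_congr rfl fun i _ => ?_
    rw [dotProduct_add, dotProduct_single_one]
    ring
  rw [e1]
  refine (abs_add_le _ _).trans (add_le_add ?_ ?_)
  · rw [abs_mul, abs_of_nonneg (by positivity : 0 ≤ 1 / (n : ℝ)), mul_left_comm]
    refine mul_le_mul_of_nonneg_left ?_ (by positivity)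
    rw [Finset.mul_sum]
    refine (Finset.abs_sum_le_sum_abs _ _).trans (Finset.sum_le_sum fun i _ => ?_)
    rw [abs_mul]
    have h1 := taylor_one_le hdψ (κ := κ) (fun t => by rw [hd2]; exact hκ t)
      ((z i).1 ⬝ᵥ βs) ((z i).1 ⬝ᵥ v)
    have h2 : |(z i).1 j| ≤ M := (norm_le_pi_norm (z i).1 j).trans (hM i)
    refine (mul_le_mul h2 h1 (abs_nonneg _) hM0).trans (le_of_eq (by ring))
  · rw [l1Norm, Finset.mul_sum]
    refine (Finset.abs_sum_le_sum_abs _ _).trans (Finset.sum_le_sum fun l _ => ?_)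
    rw [abs_mul]
    exact mul_le_mul_of_nonneg_right (hhess j l) (abs_nonneg _)

/-- The deterministic properties of the sample on which the analysis rests. -/
structure IsGoodSample (ψ : ℝ → ℝ) (z : Fin n → (Fin p → ℝ) × ℝ) (βs : Fin p → ℝ)
    (Q Sg : Matrix (Fin p) (Fin p) ℝ) (U : Fin p → Fin p → ℝ) (M G T r α : ℝ) : Prop where
  norm_le : ∀ i, ‖(z i).1‖ ≤ M
  score : ∀ j, |1 / (n : ℝ) * ∑ i, ((z i).1 ⬝ᵥ Pi.single j 1) *
    ((z i).2 - deriv ψ ((z i).1 ⬝ᵥ βs))| ≤ G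
  score_dir : ∀ j, |1 / (n : ℝ) * ∑ i, ((z i).1 ⬝ᵥ U j) *
    ((z i).2 - deriv ψ ((z i).1 ⬝ᵥ βs))| ≤ G
  hess : ∀ j l, |1 / (n : ℝ) * ∑ i, iteratedDeriv 2 ψ ((z i).1 ⬝ᵥ βs) *
    ((z i).1 j * (z i).1 l) - Q j l| ≤ G
  cov : ∀ j l, |1 / (n : ℝ) * ∑ i, (z i).1 j * (z i).1 l - Sg j l| ≤ G
  rsc : ∀ v : Fin p → ℝ, l1Norm v ≤ r * l2Norm v → α * huberRate (l2Norm v) ≤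
    huberRisk (fun i => truncWeight βs T (z i).1) (fun i => (z i).1) v

end Loss

/-! ### Deterministic analysis on a good sample -/

section Deterministic

variable {n p : ℕ} {ψ : ℝ → ℝ} {z : Fin n → (Fin p → ℝ) × ℝ}

set_option maxHeartbeats 1000000 in
/-- On a good sample, the program has a unique stationary point, which is the oracle estimator. -/
lemma IsGoodSample.exists_unique_stationary (hψ : ContDiff ℝ 3 ψ) {κ c T : ℝ} (hκ0 : 0 ≤ κ)
    (hκ : ∀ t, |iteratedDeriv 3 ψ t| ≤ κ) (h0 : ∀ t, 0 ≤ iteratedDeriv 2 ψ t) (hc : 0 ≤ c)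
    (hcT : ∀ t, |t| ≤ T + 2 → c ≤ iteratedDeriv 2 ψ t) {βs : Fin p → ℝ}
    {Q Sg : Matrix (Fin p) (Fin p) ℝ} {U : Fin p → Fin p → ℝ} {M C ε r α α₁ V σ2 cInf k : ℝ}
    (hz : IsGoodSample ψ z βs Q Sg U M (C * ε) T (r / ε) α) (hM : 0 ≤ M) (hC : 0 < C)
    (hε : 0 < ε) (hr : 0 < r) (hα₁ : α₁ = c / 2 * α) (hα₁0 : 0 < α₁) (hV : 0 ≤ V) (hσ2 : 0 ≤ σ2)
    (hSg : ∀ v : Fin p → ℝ, ∑ j, v j * ∑ l, Sg j l * v l ≤ σ2 * l2Norm v ^ 2)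
    (hsymm : ∀ i j, Q i j = Q j i)
    (hdet : IsUnit (principalSub Q (suppSet βs)).det) (hcInf : 0 < cInf)
    (hinv : LinftyOpNormLE (principalSub Q (suppSet βs))⁻¹ cInf)
    (hU0 : ∀ j i, i ∉ suppSet βs → U j i = 0)
    (hU : ∀ j, ∀ l ∈ suppSet βs, ∑ i, Q l i * U j i = Q l j) (hUV : ∀ j, l2Norm (U j) ≤ V)
    (hk : 1 ≤ k) (hS : ((suppSet βs).card : ℝ) ≤ k) {η : ℝ} (hη : k * Real.sqrt k * ε ≤ η)
    (hη1 : η ≤ 1) (hηα : C * η < α₁) (hηM : M * C * η ≤ α₁) (hηr : 2 * η ≤ r)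
    {Cr c₃ : ℝ} (hCr : Cr = M * κ / 2 * (σ2 + C) * (C / α₁) ^ 2 + C ^ 2 / α₁)
    (hc₃ : c₃ = cInf * (C + Cr))
    {ρ : ℝ → ℝ} {lam R μ γ : ℝ} (hρ : IsAmenable ρ lam μ γ) (hμ : μ < α₁)
    (hR : l1Norm βs ≤ R / 2) (hlam : 0 < lam) (hlam1 : 2 * (2 * C + Cr + V * Cr) * ε ≤ lam)
    (hlamR : 3 * (lam * R) ≤ α₁) (hrR : 8 * α₁ * R ≤ lam * (r / ε) ^ 2)
    (hmin : ∀ j ∈ suppSet βs, lam * (γ + 2 * cInf) + c₃ * ε ≤ |βs j|) :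
    ∃ βh : Fin p → ℝ, (∀ β, IsStationaryPoint (glmLoss ψ z) ρ R β ↔ β = βh) ∧
      (∀ β, IsOracle (glmLoss ψ z) (suppSet βs) β ↔ β = βh) ∧ ‖βh - βs‖ ≤ c₃ * ε := by
  set S := suppSet βs with hSdef
  set L := glmLoss ψ z with hLdef
  have hψ2 : ContDiff ℝ 2 ψ := hψ.of_le (by norm_num)
  have hψ1 : Differentiable ℝ ψ := hψ.differentiable (by norm_num)
  have hL : Differentiable ℝ L := fun β => (hasFDerivAt_glmLoss hψ1 z β).differentiableAt
  set sk := Real.sqrt k with hsk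
  have hsk1 : 1 ≤ sk := Real.one_le_sqrt.2 hk
  have hsk2 : sk ^ 2 = k := Real.sq_sqrt (by linarith)
  have hskk : sk ≤ k := by nlinarith
  have a1 : k * ε ≤ η := le_trans (by nlinarith [mul_pos (show 0 < k by linarith) hε]) hη
  have a2 : sk * ε ≤ η := le_trans (by nlinarith) a1
  have hη0 : 0 < η := lt_of_lt_of_le (by positivity) a2
  have hCr0 : 0 ≤ Cr := by rw [hCr]; positivity
  have hG0 : 0 ≤ C * ε := by positivity
  have hβs : ∀ j, j ∉ S → βs j = 0 := fun j hj => by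
    by_contra h; exact hj (by simp [hSdef, suppSet, h])
  -- the score
  have hscore : ∀ w : Fin p → ℝ, fderiv ℝ L βs w = -(1 / (n : ℝ) * ∑ i, ((z i).1 ⬝ᵥ w) *
      ((z i).2 - deriv ψ ((z i).1 ⬝ᵥ βs))) := fun w => by
    rw [hLdef, fderiv_glmLoss hψ1, ← mul_neg, ← Finset.sum_neg_distrib]
    congr 1
    exact Finset.sum_congr rfl fun i _ => by ring
  have hg : ∀ j, |fderiv ℝ L βs (Pi.single j 1)| ≤ C * ε := fun j => by
    rw [hscore, abs_neg]; exact hz.score j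
  -- restricted strong convexity
  have hrsc : ∀ β, (∀ i, |(z i).1 ⬝ᵥ (β - βs)| ≤ 1) → ∀ v, l1Norm v ≤ r / ε * l2Norm v →
      α₁ * huberRate (l2Norm v) ≤ L (β + v) - L β - fderiv ℝ L β v := by
    intro β hβ v hv
    refine le_trans ?_ (mul_huberRisk_le_glmLoss_bregman hψ2 h0 hc hcT hβ v)
    rw [hα₁, mul_assoc]
    exact mul_le_mul_of_nonneg_left (hz.rsc v hv) (by positivity)
  have hskr : sk ≤ r / ε / 2 := by
    rw [div_div, le_div_iff₀ (by positivity)]; linarith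
  have hsparse : ∀ v : Fin p → ℝ, (∀ j, j ∉ S → v j = 0) → l1Norm v ≤ r / ε * l2Norm v := by
    intro v hv
    refine (l1Norm_le_sqrt_mul_l2Norm hS hv).trans ?_
    have : 0 ≤ r / ε := by positivity
    exact mul_le_mul_of_nonneg_right (by linarith) (l2Norm_nonneg v)
  obtain ⟨βh, hor, hdist, hgrad⟩ := exists_oracle hL hS hβs (fun j _ => hg j) hG0 hα₁0
    (by nlinarith) fun v hv => hrsc βs (by simp) v (hsparse v hv)
  obtain ⟨Δ, hΔ⟩ : ∃ Δ, Δ = βh - βs := ⟨_, rfl⟩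
  have hβhΔ : βh = βs + Δ := by rw [hΔ]; abel
  rw [← hΔ] at hdist
  have hΔ0 : ∀ j, j ∉ S → Δ j = 0 := fun j hj => by simp [hΔ, hor.1 j hj, hβs j hj]
  have hl2 : l2Norm Δ ≤ C / α₁ * (sk * ε) := hdist.trans (le_of_eq (by ring))
  have hl1 : l1Norm Δ ≤ C / α₁ * (k * ε) := by
    refine (l1Norm_le_sqrt_mul_l2Norm hS hΔ0).trans ?_
    refine (mul_le_mul_of_nonneg_left hl2 (by positivity)).trans (le_of_eq ?_)
    have e : sk * (C / α₁ * (sk * ε)) = C / α₁ * (sk ^ 2 * ε) := by ring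
    rw [e, hsk2]
  -- The linear predictors at the oracle move by at most 1, so restricted strong convexity is
  -- available there as well.
  have hnear : ∀ i, |(z i).1 ⬝ᵥ (βh - βs)| ≤ 1 := fun i => by
    rw [← hΔ]
    refine (abs_dotProduct_le_norm_mul_l1Norm _ _).trans ?_
    refine (mul_le_mul (hz.norm_le i) hl1 (l1Norm_nonneg _) hM).trans ?_
    have e : M * (C / α₁ * (k * ε)) = M * C * (k * ε) / α₁ := by ring
    rw [e, div_le_one hα₁0]
    exact (mul_le_mul_of_nonneg_left a1 (by positivity)).trans hηM
  -- the error of the linearization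
  obtain ⟨rem, hrem⟩ : ∃ rem : Fin p → ℝ, ∀ j, rem j = fderiv ℝ L βh (Pi.single j 1) -
    fderiv ℝ L βs (Pi.single j 1) - ∑ l, Q j l * Δ l := ⟨_, fun _ => rfl⟩
  have hremE : ∀ j, |rem j| ≤ Cr * (k * ε ^ 2) := by
    intro j
    have h1 := abs_fderiv_glmLoss_sub_le hψ hκ hz.norm_le hM hz.hess Δ j
    rw [← hβhΔ, ← hLdef, ← hrem] at h1
    have h2 := average_sq_le hz.cov (hSg Δ)
    have hl2' : l2Norm Δ ^ 2 ≤ (C / α₁) ^ 2 * (k * ε ^ 2) := by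
      have := pow_le_pow_left₀ (l2Norm_nonneg Δ) hl2 2
      rwa [mul_pow, mul_pow, hsk2] at this
    -- This term is of order k²ε³ = kε² · kε, and kε ≤ 1.
    have hl1' : C * ε * l1Norm Δ ^ 2 ≤ C * ((C / α₁) ^ 2 * (k * ε ^ 2)) := by
      have h3 := pow_le_pow_left₀ (l1Norm_nonneg Δ) hl1 2
      have h4 : ε * l1Norm Δ ^ 2 ≤ (C / α₁) ^ 2 * (k * ε ^ 2) := by
        refine (mul_le_mul_of_nonneg_left h3 hε.le).trans ?_
        have e : ε * (C / α₁ * (k * ε)) ^ 2 = (C / α₁) ^ 2 * (k * ε ^ 2) * (k * ε) := by ring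
        rw [e]
        exact mul_le_of_le_one_right (by positivity) (a1.trans hη1)
      rw [mul_assoc]
      exact mul_le_mul_of_nonneg_left h4 hC.le
    have h5 : 1 / (n : ℝ) * ∑ i, ((z i).1 ⬝ᵥ Δ) ^ 2 ≤
        (σ2 + C) * ((C / α₁) ^ 2 * (k * ε ^ 2)) := by
      have := mul_le_mul_of_nonneg_left hl2' hσ2
      linarith
    have h6 := mul_le_mul_of_nonneg_left h5 (by positivity : 0 ≤ M * κ / 2)
    have h7 : C * ε * l1Norm Δ ≤ C ^ 2 / α₁ * (k * ε ^ 2) :=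
      (mul_le_mul_of_nonneg_left hl1 hG0).trans (le_of_eq (by ring))
    rw [hCr]
    linarith
  have hUu : ∀ j, l1Norm (U j) ≤ sk * V := fun j =>
    (l1Norm_le_sqrt_mul_l2Norm hS (hU0 j)).trans
      (mul_le_mul_of_nonneg_left (hUV j) (by positivity))
  obtain ⟨hinf, hdual⟩ := oracle_bounds (S := S) hsymm hΔ0
    (fun j => show fderiv ℝ L βh (Pi.single j 1) = fderiv ℝ L βs (Pi.single j 1) +
      ∑ l, Q j l * Δ l + rem j by rw [hrem]; ring) hremE hg hgrad hdet hinv U hU0 hU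
    (fun j => by
      rw [← fderiv_eq_sum, hscore, abs_neg]; exact hz.score_dir j) hUu
  have b1 : Cr * (k * ε ^ 2) ≤ Cr * ε := by
    refine mul_le_mul_of_nonneg_left ?_ hCr0
    have e : k * ε ^ 2 = k * ε * ε := by ring
    rw [e]
    exact mul_le_of_le_one_left hε.le (a1.trans hη1)
  -- The one place where the full strength k^(3/2) ε ≤ 1, that is n ≳ k³ log p, is needed.
  have b2 : sk * V * (Cr * (k * ε ^ 2)) ≤ V * Cr * ε := by
    have e : sk * V * (Cr * (k * ε ^ 2)) = V * Cr * ε * (k * sk * ε) := by ring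
    rw [e]
    exact mul_le_of_le_one_right (by positivity) (hη.trans hη1)
  have hinf' : ∀ j, |Δ j| ≤ c₃ * ε := by
    intro j
    by_cases hj : j ∈ S
    · refine (hinf j hj).trans ?_
      rw [hc₃, mul_assoc]
      exact mul_le_mul_of_nonneg_left (by linarith) hcInf.le
    · rw [hΔ0 j hj, abs_zero, hc₃]; positivity
  have hdual' : ∀ j, j ∉ S → |fderiv ℝ L βh (Pi.single j 1)| ≤ lam / 2 := fun j _ =>
    (hdual j).trans (by linarith)
  have hbig : ∀ j ∈ S, γ * lam < |βh j| := by
    intro j hj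
    have h1 := hmin j hj
    have h2 := hinf' j
    have h3 : |βs j| ≤ |βh j| + |Δ j| := by
      have e : βs j = βh j - Δ j := by simp [hΔ]
      rw [e]; exact abs_sub _ _
    have : 0 < lam * cInf := mul_pos hlam hcInf
    nlinarith
  have hRh : l1Norm βh ≤ R := by
    -- The signal condition dominates the error coordinatewise, so feasibility of the oracle follows
    -- from ‖β*‖₁ ≤ R/2.
    have h1 : l1Norm Δ ≤ l1Norm βs := by
      refine Finset.sum_le_sum fun j _ => ?_
      by_cases hj : j ∈ S
      · refine (hinf' j).trans (le_trans ?_ (hmin j hj))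
        have := hρ.gamma_pos
        have : 0 ≤ lam * (γ + 2 * cInf) := by positivity
        linarith
      · simp [hΔ0 j hj]
    have h2 := l1Norm_add_le βs Δ
    rw [← hβhΔ] at h2
    linarith
  have hrsch := hrsc βh hnear
  refine ⟨βh, fun β => ⟨fun h => ?_, fun h => h ▸ ?_⟩, ?_, ?_⟩
  · exact eq_oracle_of_isStationaryPoint hρ hRh hor.1 (fun j hj => (hbig j hj).le) hgrad hdual'
      (glmLoss_bregman_nonneg hψ2 h0 z) hα₁0 hS (by positivity) hskr hrsch hlam hμ hlamR hrR h
  · exact isStationaryPoint_oracle hρ hRh hor.1 hbig hgrad hdual'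
  · exact isOracle_iff hor hgrad hα₁0 fun v hv => hrsch v (hsparse v hv)
  · rw [← hΔ, pi_norm_le_iff_of_nonneg (by rw [hc₃]; positivity)]
    exact hinf'

end Deterministic

/-! ### The Fisher information -/

section Fisher

variable {p : ℕ} {ψ : ℝ → ℝ} {P : Measure (Fin p → ℝ)} {M σ κ : ℝ}

lemma fisherInfo_symm (ψ : ℝ → ℝ) (P : Measure (Fin p → ℝ)) (β : Fin p → ℝ) (i j : Fin p) :
    fisherInfo ψ P β i j = fisherInfo ψ P β j i := by
  simp only [fisherInfo, Matrix.of_apply, mul_comm (_ : ℝ) (_ : ℝ)]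

variable [IsProbabilityMeasure P]

lemma continuous_weight (hψ : ContDiff ℝ 2 ψ) (β : Fin p → ℝ) :
    Continuous fun x : Fin p → ℝ => iteratedDeriv 2 ψ (x ⬝ᵥ β) :=
  (hψ.continuous_iteratedDeriv 2 le_rfl).comp (continuous_dotProduct_left β)

/-- On |xᵀβ| ≤ T the weight ψ'' is at least c, and the square dominates twice the pseudo-Huber
function; hence the truncated risk bounds the Fisher information below. -/
lemma le_integral_fisher (hψ : ContDiff ℝ 2 ψ) (h0 : ∀ t, 0 ≤ iteratedDeriv 2 ψ t)
    (hM : ∀ᵐ x ∂P, ‖x‖ ≤ M) {β : Fin p → ℝ} {T e c : ℝ} (hc : 0 ≤ c)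
    (hcT : ∀ t, |t| ≤ T → c ≤ iteratedDeriv 2 ψ t)
    (he : ∀ v : Fin p → ℝ, l2Norm v = 1 →
      e ≤ ∫ x, truncWeight β T x * pseudoHuber (x ⬝ᵥ v) ∂P) (v : Fin p → ℝ) :
    2 * c * e * l2Norm v ^ 2 ≤ ∫ x, iteratedDeriv 2 ψ (x ⬝ᵥ β) * (x ⬝ᵥ v) ^ 2 ∂P := by
  rcases (l2Norm_nonneg v).eq_or_lt with h | h
  · have : v = 0 := l2Norm_eq_zero.1 h.symm
    simp [this, l2Norm]
  obtain ⟨w, hw⟩ : ∃ w, w = (l2Norm v)⁻¹ • v := ⟨_, rfl⟩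
  have hvw : v = l2Norm v • w := by rw [hw, smul_smul, mul_inv_cancel₀ h.ne', one_smul]
  have hw1 : l2Norm w = 1 := by
    rw [hw, l2Norm_smul, abs_of_pos (inv_pos.2 h), inv_mul_cancel₀ h.ne']
  have hWc := continuous_weight hψ β
  have hwc := continuous_dotProduct_left w
  have h1 := integral_mono ((integrable_truncWeight_mul hM β T w).const_mul (2 * c))
    (integrable_of_continuous_of_norm_le hM (hWc.mul (hwc.pow 2))) fun x => by
      have h2 := pseudoHuber_le_half_sq (x ⬝ᵥ w)
      simp only [Pi.mul_apply, Pi.pow_apply]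
      unfold truncWeight
      split_ifs with hx
      · have h3 := mul_le_mul_of_nonneg_right (hcT _ hx) (sq_nonneg (x ⬝ᵥ w))
        have h4 := mul_le_mul_of_nonneg_left h2 hc
        linarith
      · have := mul_nonneg (h0 (x ⬝ᵥ β)) (sq_nonneg (x ⬝ᵥ w))
        linarith
  rw [integral_const_mul] at h1
  have h2 : 2 * c * e ≤ ∫ x, iteratedDeriv 2 ψ (x ⬝ᵥ β) * (x ⬝ᵥ w) ^ 2 ∂P :=
    (mul_le_mul_of_nonneg_left (he w hw1) (by positivity)).trans h1
  have h3 := mul_le_mul_of_nonneg_right h2 (sq_nonneg (l2Norm v))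
  rw [← integral_mul_const] at h3
  refine h3.trans (le_of_eq (integral_congr_ae (ae_of_all _ fun x => ?_)))
  have e1 : x ⬝ᵥ v = l2Norm v * (x ⬝ᵥ w) := by
    conv_lhs => rw [hvw]
    rw [dotProduct_smul, smul_eq_mul]
  simp only
  rw [e1]; ring

/-- The projections of the coordinates on the support have bounded `ℓ₂`-norm. -/
lemma exists_projection (hψ : ContDiff ℝ 2 ψ) (h0 : ∀ t, 0 ≤ iteratedDeriv 2 ψ t)
    (hκ : ∀ t, |iteratedDeriv 2 ψ t| ≤ κ) (hM : ∀ᵐ x ∂P, ‖x‖ ≤ M) (hσ : 0 < σ)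
    (hsub : IsSubGaussianVector P σ) {β : Fin p → ℝ} {a : ℝ} (ha : 0 < a)
    (hlow : ∀ v : Fin p → ℝ,
      a * l2Norm v ^ 2 ≤ ∫ x, iteratedDeriv 2 ψ (x ⬝ᵥ β) * (x ⬝ᵥ v) ^ 2 ∂P)
    {S : Finset (Fin p)} (hdet : IsUnit (principalSub (fisherInfo ψ P β) S).det) (j : Fin p) :
    ∃ u : Fin p → ℝ, (∀ i, i ∉ S → u i = 0) ∧
      (∀ l ∈ S, ∑ i, fisherInfo ψ P β l i * u i = fisherInfo ψ P β l j) ∧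
      l2Norm u ≤ Real.sqrt (κ * σ ^ 2 / a) := by
  set Q := fisherInfo ψ P β with hQ
  set y : S → ℝ := (principalSub Q S)⁻¹.mulVec fun l : S => Q l j with hy
  have hQy : (principalSub Q S).mulVec y = fun l : S => Q l j := by
    rw [hy, Matrix.mulVec_mulVec, Matrix.mul_nonsing_inv _ hdet, Matrix.one_mulVec]
  set u : Fin p → ℝ := fun i => if h : i ∈ S then y ⟨i, h⟩ else 0 with hu
  have hu0 : ∀ i, i ∉ S → u i = 0 := fun i hi => by simp [hu, hi]
  have huS : ∀ l ∈ S, ∑ i, Q l i * u i = Q l j := by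
    intro l hl
    have h1 : ∑ i, Q l i * u i = ∑ i : S, Q l i * u i := by
      rw [Finset.sum_coe_sort S fun i => Q l i * u i]
      exact (Finset.sum_subset (Finset.subset_univ S) fun i _ hi => by simp [hu0 i hi]).symm
    rw [h1]
    have h2 := congrFun hQy ⟨l, hl⟩
    refine Eq.trans (Finset.sum_congr rfl fun i _ => ?_) h2
    simp [hu, principalSub]
  refine ⟨u, hu0, huS, ?_⟩
  have hWc := continuous_weight hψ β
  have huc := continuous_dotProduct_left u
  have e1 : ∑ l, u l * Q l j = ∫ x, iteratedDeriv 2 ψ (x ⬝ᵥ β) * (x ⬝ᵥ u) ^ 2 ∂P := by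
    have h1 := sum_mul_sum_mul_integral_eq hM hWc u u
    simp_rw [← sq] at h1
    rw [← h1]
    refine Finset.sum_congr rfl fun l _ => ?_
    by_cases hl : l ∈ S
    · rw [← huS l hl]; rfl
    · simp [hu0 l hl]
  have e2 : ∑ l, u l * Q l j = ∫ x, iteratedDeriv 2 ψ (x ⬝ᵥ β) * (x j * (x ⬝ᵥ u)) ∂P := by
    rw [← sum_mul_integral_eq hM hWc]
    refine Finset.sum_congr rfl fun l _ => ?_
    rw [mul_comm, hQ, fisherInfo_symm]; rfl
  have i1 : Integrable (fun x : Fin p → ℝ => iteratedDeriv 2 ψ (x ⬝ᵥ β) * (x ⬝ᵥ u) ^ 2) P :=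
    integrable_of_continuous_of_norm_le hM (by fun_prop)
  have i2 : Integrable (fun x : Fin p → ℝ => κ * x j ^ 2) P :=
    integrable_of_continuous_of_norm_le hM (by fun_prop)
  -- Since u is the weighted projection of x_j, uᵀQu equals the cross moment of x_j and xᵀu. The
  -- inequality 2ab ≤ a² + b² then gives uᵀQu ≤ κσ².
  have h1 : ∫ x, iteratedDeriv 2 ψ (x ⬝ᵥ β) * (x j * (x ⬝ᵥ u)) ∂P ≤
      (∫ x, iteratedDeriv 2 ψ (x ⬝ᵥ β) * (x ⬝ᵥ u) ^ 2 ∂P + ∫ x, κ * x j ^ 2 ∂P) / 2 := by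
    rw [← integral_add i1 i2, ← integral_div]
    refine integral_mono (integrable_of_continuous_of_norm_le hM (by fun_prop))
      ((i1.add i2).div_const 2) fun x => ?_
    have h2 := h0 (x ⬝ᵥ β)
    have h3 := (abs_le.1 (hκ (x ⬝ᵥ β))).2
    have h4 := mul_nonneg h2 (sq_nonneg (x j - x ⬝ᵥ u))
    have h5 := mul_le_mul_of_nonneg_right h3 (sq_nonneg (x j))
    simp only
    nlinarith
  have h2 : ∫ x, κ * x j ^ 2 ∂P ≤ κ * σ ^ 2 := by
    rw [integral_const_mul]
    have h3 := hsub.integral_sq_le hσ hM (Pi.single j (1 : ℝ))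
    simp only [dotProduct_single_one, l2Norm_single, one_pow, mul_one] at h3
    exact mul_le_mul_of_nonneg_left h3 ((abs_nonneg _).trans (hκ 0))
  rw [← e2, e1] at h1
  apply Real.le_sqrt_of_sq_le
  rw [le_div_iff₀ ha, mul_comm]
  linarith [hlow u]

end Fisher

/-! ### Good samples are likely -/

section Probability

variable {n p : ℕ} {ψ : ℝ → ℝ} {ν : Measure ℝ} {s : ℝ} {P : Measure (Fin p → ℝ)}
  [IsProbabilityMeasure P] {κ M σ : ℝ}

lemma measure_iUnion_le_card_mul {Ω ι : Type*} [MeasurableSpace Ω] [Fintype ι] {m : Measure Ω}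
    {A : ι → Set Ω} {x : ℝ} (h : ∀ i, m (A i) ≤ ENNReal.ofReal x) :
    m (⋃ i, A i) ≤ ENNReal.ofReal (Fintype.card ι * x) := by
  refine (measure_iUnion_fintype_le _ _).trans ((Finset.sum_le_sum fun i _ => h i).trans ?_)
  rw [Finset.sum_const, nsmul_eq_mul, ← ENNReal.ofReal_natCast,
    ← ENNReal.ofReal_mul (Nat.cast_nonneg _)]
  rfl

/-- The margin 3 in the conditions on C makes each deviation event cost 2p⁻³, which absorbs a union
over up to p² events. Four such families contribute 2/p each and restricted strong convexity
contributes 1/p, whence 9. -/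
lemma glmSampleLaw_not_isGoodSample_le (h : IsGLMFamily ψ ν s) (hs : 0 < s) (hψ : ContDiff ℝ 2 ψ)
    (hκ : ∀ t, |iteratedDeriv 2 ψ t| ≤ κ) (hM0 : 0 < M) (hM : ∀ᵐ x ∂P, ‖x‖ ≤ M) (hσ : 0 < σ)
    (hsub : IsSubGaussianVector P σ) (β : Fin p → ℝ) {T e : ℝ} (he0 : 0 < e)
    (he : ∀ v : Fin p → ℝ, l2Norm v = 1 →
      e ≤ ∫ x, truncWeight β T x * pseudoHuber (x ⬝ᵥ v) ∂P) (hn : 0 < n) (hp : 2 ≤ p)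
    {U : Fin p → Fin p → ℝ} {V : ℝ} (hV : 0 < V) (hU : ∀ j, l2Norm (U j) ≤ V)
    {ε c r C : ℝ} (hε : 0 < ε) (hεn : n * ε ^ 2 = Real.log p)
    (hc : c = e ^ 2 / (8 * (2 * σ ^ 4 + σ ^ 2))) (hεc : 4 * ε ^ 2 ≤ c)
    (hr : 160 * M ^ 2 * r ^ 2 ≤ e * c)
    (h1 : κ * s * 1 ^ 2 * σ ^ 2 / 2 * ε ^ 2 ≤ 1) (h2 : κ * s * V ^ 2 * σ ^ 2 / 2 * ε ^ 2 ≤ 1)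
    (h3 : ε * (2 * (κ * M ^ 2)) ≤ 1) (h4 : ε * (2 * M ^ 2) ≤ 1)
    (hC1 : κ * s * 1 ^ 2 * σ ^ 2 / 2 + 3 ≤ C) (hC2 : κ * s * V ^ 2 * σ ^ 2 / 2 + 3 ≤ C)
    (hC3 : (2 * (κ * M ^ 2)) ^ 2 + 3 ≤ C) (hC4 : (2 * M ^ 2) ^ 2 + 3 ≤ C) :
    glmSampleLaw n ψ ν s P β {z | ¬ IsGoodSample ψ z β (fisherInfo ψ P β) (covMatrix P) U M
        (C * ε) T (r / ε) (e / 10)} ≤ ENNReal.ofReal (9 * Real.exp (-Real.log p)) := by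
  set m := glmSampleLaw n ψ ν s P β with hm
  set X := Real.exp (-Real.log p) with hX
  have hp' : (2 : ℝ) ≤ p := by exact_mod_cast hp
  have hlog : 0 < Real.log p := Real.log_pos (by linarith)
  have hexp : ∀ K, K + 3 ≤ C → 2 * Real.exp ((K - C) * (n * ε ^ 2)) ≤ 2 * X ^ 3 := by
    intro K hK
    rw [hX, ← Real.exp_nat_mul, hεn]
    have : (K - C) * Real.log p ≤ (3 : ℕ) * -Real.log p := by push_cast; nlinarith
    have := Real.exp_le_exp.2 this
    linarith
  have hpX : p * X = 1 := by
    rw [hX, Real.exp_neg, Real.exp_log (by linarith), mul_inv_cancel₀ (by linarith)]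
  have hX0 : 0 < X := Real.exp_pos _
  have hX1 : X ≤ 1 := by nlinarith
  have hκ0 : 0 ≤ κ := (abs_nonneg _).trans (hκ 0)
  have hent : ∀ᵐ x ∂P, ∀ j l, |x j * x l| ≤ M ^ 2 := by
    filter_upwards [hM] with x hx j l
    rw [abs_mul, sq]
    exact mul_le_mul ((norm_le_pi_norm x j).trans hx) ((norm_le_pi_norm x l).trans hx)
      (abs_nonneg _) hM0.le
  have hWc := continuous_weight hψ β
  set E0 : Set (Fin n → (Fin p → ℝ) × ℝ) := {z | ¬ ∀ i, ‖(z i).1‖ ≤ M}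
  set E1 : Fin p → Set (Fin n → (Fin p → ℝ) × ℝ) := fun j => {z | C * ε < |1 / (n : ℝ) *
    ∑ i, ((z i).1 ⬝ᵥ Pi.single j 1) * ((z i).2 - deriv ψ ((z i).1 ⬝ᵥ β))|}
  set E2 : Fin p → Set (Fin n → (Fin p → ℝ) × ℝ) := fun j => {z | C * ε < |1 / (n : ℝ) *
    ∑ i, ((z i).1 ⬝ᵥ U j) * ((z i).2 - deriv ψ ((z i).1 ⬝ᵥ β))|}
  set E3 : Fin p × Fin p → Set (Fin n → (Fin p → ℝ) × ℝ) := fun q => {z | C * ε < |1 / (n : ℝ) *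
    ∑ i, iteratedDeriv 2 ψ ((z i).1 ⬝ᵥ β) * ((z i).1 q.1 * (z i).1 q.2) -
      fisherInfo ψ P β q.1 q.2|}
  set E4 : Fin p × Fin p → Set (Fin n → (Fin p → ℝ) × ℝ) := fun q => {z | C * ε < |1 / (n : ℝ) *
    ∑ i, (z i).1 q.1 * (z i).1 q.2 - covMatrix P q.1 q.2|}
  set E5 : Set (Fin n → (Fin p → ℝ) × ℝ) := {z | (∀ i, ‖(z i).1‖ ≤ M) ∧ ¬ ∀ v : Fin p → ℝ,
    l1Norm v ≤ r / ε * l2Norm v → e / 10 * huberRate (l2Norm v) ≤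
      huberRisk (fun i => truncWeight β T (z i).1) (fun i => (z i).1) v}
  have m0 : m E0 = 0 := ae_iff.1 (ae_glmSampleLaw_norm_le h hψ.continuous β hM n)
  have m1 : m (⋃ j, E1 j) ≤ ENNReal.ofReal (2 * X) := by
    refine (measure_iUnion_le_card_mul fun j => (glmSampleLaw_score_gt_le h hs hψ hκ hσ hsub β
      one_pos (l2Norm_single j).le hn hε h1 C).trans
      (ENNReal.ofReal_le_ofReal (hexp _ hC1))).trans (ENNReal.ofReal_le_ofReal ?_)
    rw [Fintype.card_fin]
    nlinarith [mul_pos hX0 hX0]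
  have m2 : m (⋃ j, E2 j) ≤ ENNReal.ofReal (2 * X) := by
    refine (measure_iUnion_le_card_mul fun j => (glmSampleLaw_score_gt_le h hs hψ hκ hσ hsub β
      hV (hU j) hn hε h2 C).trans
      (ENNReal.ofReal_le_ofReal (hexp _ hC2))).trans (ENNReal.ofReal_le_ofReal ?_)
    rw [Fintype.card_fin]
    nlinarith [mul_pos hX0 hX0]
  have hcard : ((Fintype.card (Fin p × Fin p) : ℕ) : ℝ) * (2 * X ^ 3) ≤ 2 * X := by
    rw [Fintype.card_prod, Fintype.card_fin]
    push_cast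
    have e1 : (p : ℝ) * p * (2 * X ^ 3) = 2 * X * (p * X) * (p * X) := by ring
    rw [e1, hpX, mul_one, mul_one]
  have m3 : m (⋃ q, E3 q) ≤ ENNReal.ofReal (2 * X) := by
    refine (measure_iUnion_le_card_mul fun q => ?_).trans (ENNReal.ofReal_le_ofReal hcard)
    refine le_trans ?_ (ENNReal.ofReal_le_ofReal (hexp _ hC3))
    refine glmSampleLaw_bounded_gt_le h hψ.continuous β
      (f := fun x => iteratedDeriv 2 ψ (x ⬝ᵥ β) * (x q.1 * x q.2))
      (Continuous.measurable (by fun_prop)) ?_ hn hε h3 C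
    filter_upwards [hent] with x hx
    rw [abs_mul]
    exact mul_le_mul (hκ _) (hx _ _) (abs_nonneg _) hκ0
  have m4 : m (⋃ q, E4 q) ≤ ENNReal.ofReal (2 * X) := by
    refine (measure_iUnion_le_card_mul fun q => ?_).trans (ENNReal.ofReal_le_ofReal hcard)
    refine le_trans ?_ (ENNReal.ofReal_le_ofReal (hexp _ hC4))
    exact glmSampleLaw_bounded_gt_le h hψ.continuous β (f := fun x => x q.1 * x q.2)
      (Continuous.measurable (by fun_prop)) (hent.mono fun x hx => hx _ _) hn hε h4 C
  have m5 : m E5 ≤ ENNReal.ofReal X :=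
    glmSampleLaw_not_rsc_le h hψ.continuous β hM hσ hsub he0 he hn hp hε hεn hc hεc hr
  have hcover : {z | ¬ IsGoodSample ψ z β (fisherInfo ψ P β) (covMatrix P) U M
      (C * ε) T (r / ε) (e / 10)} ⊆
      E0 ∪ ((⋃ j, E1 j) ∪ ((⋃ j, E2 j) ∪ ((⋃ q, E3 q) ∪ ((⋃ q, E4 q) ∪ E5)))) := by
    intro z hz
    by_contra hcon
    simp only [Set.mem_union, Set.mem_iUnion, not_or, not_exists] at hcon
    obtain ⟨z0, z1, z2, z3, z4, z5⟩ := hcon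
    have z0' : ∀ i, ‖(z i).1‖ ≤ M := not_not.1 z0
    exact hz ⟨z0', fun j => not_lt.1 (z1 j), fun j => not_lt.1 (z2 j),
      fun j l => not_lt.1 (z3 (j, l)), fun j l => not_lt.1 (z4 (j, l)),
      by_contra fun z6 => z5 ⟨z0', z6⟩⟩
  refine (measure_mono hcover).trans ((measure_union_le _ _).trans ?_)
  rw [m0, zero_add]
  refine ((measure_union_le _ _).trans (add_le_add m1 ((measure_union_le _ _).trans
    (add_le_add m2 ((measure_union_le _ _).trans (add_le_add m3
    ((measure_union_le _ _).trans (add_le_add m4 m5)))))))).trans ?_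
  rw [← ENNReal.ofReal_add (by positivity) (by positivity),
    ← ENNReal.ofReal_add (by positivity) (by positivity),
    ← ENNReal.ofReal_add (by positivity) (by positivity),
    ← ENNReal.ofReal_add (by positivity) (by positivity)]
  exact ENNReal.ofReal_le_ofReal (by linarith)

end Probability

/-! ### Degenerate cumulants and the main theorem -/

lemma not_isUnit_det_of_iteratedDeriv_two_eq_zero {p : ℕ} {ψ : ℝ → ℝ}
    (h : ∀ t, iteratedDeriv 2 ψ t = 0) (P : Measure (Fin p → ℝ)) (β : Fin p → ℝ)
    {S : Finset (Fin p)} (hS : S.Nonempty) : ¬ IsUnit (principalSub (fisherInfo ψ P β) S).det := by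
  have e : principalSub (fisherInfo ψ P β) S = 0 := by
    ext i j
    simp [principalSub, fisherInfo, h]
  have : Nonempty S := hS.to_subtype
  rw [e, Matrix.det_zero]
  exact not_isUnit_zero

lemma exists_pos_le_iteratedDeriv_two {ψ : ℝ → ℝ} (hψ : ContDiff ℝ 2 ψ)
    (h : ∀ t, 0 < iteratedDeriv 2 ψ t) {T : ℝ} (hT : 0 ≤ T) :
    ∃ c, 0 < c ∧ ∀ t, |t| ≤ T → c ≤ iteratedDeriv 2 ψ t := by
  obtain ⟨t₀, -, ht₀⟩ := (isCompact_Icc (a := -T) (b := T)).exists_isMinOn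
    ⟨0, by simp [hT]⟩ (hψ.continuous_iteratedDeriv 2 le_rfl).continuousOn
  exact ⟨_, h t₀, fun t ht => ht₀ (abs_le.1 ht)⟩

theorem mainTheorem5
    (ψ : ℝ → ℝ) (κ₂ κ₃ : ℝ) (hψ : ContDiff ℝ 3 ψ)
    (hκ₂ : ∀ t, |iteratedDeriv 2 ψ t| ≤ κ₂) (hκ₃ : ∀ t, |iteratedDeriv 3 ψ t| ≤ κ₃)
    (σx lam₀ B : ℝ) (hσx : 0 < σx) (hlam₀ : 0 < lam₀) (hB : 0 < B) :
    ∃ cψ : ℝ, 0 < cψ ∧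
    ∀ (ν : Measure ℝ) (s M cInf : ℝ), 0 < s → 0 < M → 0 < cInf → IsGLMFamily ψ ν s →
    ∃ c₀ c₁ c₂ c₃ cl cu : ℝ,
      0 < c₀ ∧ 0 < c₁ ∧ 0 < c₂ ∧ 0 < c₃ ∧ 0 < cl ∧ 0 < cu ∧
      ∀ (n p k : ℕ) (P : Measure (Fin p → ℝ)) (βs : Fin p → ℝ)
        (ρ : ℝ → ℝ) (lam R μ γ : ℝ),
        IsProbabilityMeasure P →
        (∀ᵐ x ∂P, ‖x‖ ≤ M) →
        IsSubGaussianVector P σx →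
        lam₀ ≤ lambdaMin (covMatrix P) →
        l2Norm βs ≤ B →
        (suppSet βs).Nonempty →
        (suppSet βs).card ≤ k →
        c₀ * (k : ℝ) ^ 3 * Real.log p ≤ n →
        IsAmenable ρ lam μ γ →
        μ < cψ * lambdaMin (covMatrix P) →
        l1Norm βs ≤ R / 2 →
        cl * Real.sqrt (Real.log p / n) ≤ lam →
        lam ≤ cu / R →
        IsUnit (principalSub (fisherInfo ψ P βs) (suppSet βs)).det →
        LinftyOpNormLE (principalSub (fisherInfo ψ P βs) (suppSet βs))⁻¹ cInf →
        (∀ j ∈ suppSet βs,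
          lam * (γ + 2 * cInf) + c₃ * Real.sqrt (Real.log p / n) ≤ |βs j|) →
        glmSampleLaw n ψ ν s P βs
          {z | ¬ ∃ βh : Fin p → ℝ,
            (∀ β, IsStationaryPoint (glmLoss ψ z) ρ R β ↔ β = βh) ∧
            (∀ β, IsOracle (glmLoss ψ z) (suppSet βs) β ↔ β = βh) ∧
            ‖βh - βs‖ ≤ c₃ * Real.sqrt (Real.log p / n)}
          ≤ ENNReal.ofReal (c₁ * Real.exp (-c₂ * min (k : ℝ) (Real.log p))) := by
  have hψ2 : ContDiff ℝ 2 ψ := hψ.of_le (by norm_num)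
  by_cases hpos : ∀ t, 0 < iteratedDeriv 2 ψ t
  swap
  -- If ψ'' has a zero or negative value, the model forces ψ'' = 0 everywhere; the Fisher
  -- information vanishes and its invertibility is contradictory.
  · refine ⟨1, one_pos, fun ν s M cInf hs _ _ hν =>
      ⟨1, 1, 1, 1, 1, 1, one_pos, one_pos, one_pos, one_pos, one_pos, one_pos, ?_⟩⟩
    intro n p k P βs ρ lam R μ γ _ _ _ _ _ hne _ _ _ _ _ _ _ hdet
    obtain ⟨hn0, hz⟩ := hν.iteratedDeriv_two_nonneg_and hs hψ2
    obtain ⟨t, ht⟩ := not_forall.1 hpos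
    exact absurd hdet (not_isUnit_det_of_iteratedDeriv_two_eq_zero
      (hz ⟨t, le_antisymm (not_lt.1 ht) (hn0 t)⟩) P βs hne)
  have h0 : ∀ t, 0 ≤ iteratedDeriv 2 ψ t := fun t => (hpos t).le
  obtain ⟨T, e, hT, he, hTe⟩ := exists_le_integral_truncWeight hσx hlam₀ B
  obtain ⟨c, hc, hcT⟩ := exists_pos_le_iteratedDeriv_two hψ2 hpos
    (show 0 ≤ T + 2 by linarith)
  obtain ⟨α₁, hα₁⟩ : ∃ α₁, α₁ = c / 2 * (e / 10) := ⟨_, rfl⟩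
  have hα₁0 : 0 < α₁ := by rw [hα₁]; positivity
  -- Fixed before ν, s and M: α₁ comes from c, T and e alone, and λ_min(Σ_x) ≤ σx² turns the
  -- hypothesis on μ into μ < α₁.
  refine ⟨α₁ / σx ^ 2, by positivity, ?_⟩
  intro ν s M cInf hs hM0 hcInf hν
  have hκ₂0 : 0 < κ₂ := (hpos 0).trans_le ((le_abs_self _).trans (hκ₂ 0))
  have hκ₃0 : 0 ≤ κ₃ := (abs_nonneg _).trans (hκ₃ 0)
  obtain ⟨V, hV⟩ : ∃ V, V = Real.sqrt (κ₂ * σx ^ 2 / (2 * c * e)) := ⟨_, rfl⟩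
  have hV0 : 0 < V := by rw [hV]; exact Real.sqrt_pos.2 (by positivity)
  obtain ⟨K₁, hK₁⟩ : ∃ K₁, K₁ = κ₂ * s * 1 ^ 2 * σx ^ 2 / 2 := ⟨_, rfl⟩
  obtain ⟨K₂, hK₂⟩ : ∃ K₂, K₂ = κ₂ * s * V ^ 2 * σx ^ 2 / 2 := ⟨_, rfl⟩
  obtain ⟨K₃, hK₃⟩ : ∃ K₃, K₃ = 2 * (κ₂ * M ^ 2) := ⟨_, rfl⟩
  obtain ⟨K₄, hK₄⟩ : ∃ K₄, K₄ = 2 * M ^ 2 := ⟨_, rfl⟩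
  have hK₁0 : 0 ≤ K₁ := by rw [hK₁]; positivity
  have hK₂0 : 0 ≤ K₂ := by rw [hK₂]; positivity
  have hK₃0 : 0 ≤ K₃ := by rw [hK₃]; positivity
  have hK₄0 : 0 ≤ K₄ := by rw [hK₄]; positivity
  have hK₃2 : 0 ≤ K₃ ^ 2 := sq_nonneg _
  have hK₄2 : 0 ≤ K₄ ^ 2 := sq_nonneg _
  obtain ⟨C, hC⟩ : ∃ C, C = K₁ + K₂ + K₃ ^ 2 + K₄ ^ 2 + 3 := ⟨_, rfl⟩
  have hC0 : 0 < C := by rw [hC]; positivity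
  obtain ⟨b, hb⟩ : ∃ b, b = e ^ 2 / (8 * (2 * σx ^ 4 + σx ^ 2)) := ⟨_, rfl⟩
  have hb0 : 0 < b := by rw [hb]; positivity
  obtain ⟨r, hr⟩ : ∃ r, r = Real.sqrt (e * b / (160 * M ^ 2)) := ⟨_, rfl⟩
  have hr0 : 0 < r := by rw [hr]; exact Real.sqrt_pos.2 (by positivity)
  have hr2 : 160 * M ^ 2 * r ^ 2 ≤ e * b := by
    rw [hr, Real.sq_sqrt (by positivity)]
    apply le_of_eq; field_simp
  obtain ⟨Cr, hCr⟩ : ∃ Cr, Cr = M * κ₃ / 2 * (σx ^ 2 + C) * (C / α₁) ^ 2 + C ^ 2 / α₁ := ⟨_, rfl⟩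
  have hCr0 : 0 ≤ Cr := by rw [hCr]; positivity
  -- D dominates every quantity whose product with ε or η must be at most 1; η = 1/D and c₀ = D²
  -- then enforce all smallness conditions at once.
  obtain ⟨D, hD⟩ : ∃ D, D = 1 + 2 * C / α₁ + M * C / α₁ + 2 / r + K₁ + K₂ + K₃ + K₄ + 4 / b :=
    ⟨_, rfl⟩
  have q1 : 0 ≤ 2 * C / α₁ := by positivity
  have q2 : 0 ≤ M * C / α₁ := by positivity
  have q3 : 0 ≤ 2 / r := by positivity
  have q4 : 0 ≤ 4 / b := by positivity
  have hD1 : 1 ≤ D := by linarith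
  have hDinv : ∀ x, x ≤ D → x * (1 / D) ≤ 1 := fun x hx => by
    rw [mul_one_div, div_le_one (by linarith)]; exact hx
  obtain ⟨η, hη⟩ : ∃ η, η = 1 / D := ⟨_, rfl⟩
  rw [← hη] at hDinv
  have hη0 : 0 < η := by rw [hη]; positivity
  -- In c_ℓ the first summand gives strict dual feasibility and the second excludes stationary
  -- points outside the cone; c_u = α₁/3 handles those in the cone at distance more than 1.
  refine ⟨D ^ 2, 9, 1, cInf * (C + Cr), 2 * (2 * C + Cr + V * Cr) + 2 * α₁ / r, α₁ / 3,
    by positivity, by norm_num, one_pos, by positivity, by positivity, by positivity, ?_⟩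
  intro n p k P βs ρ lam R μ γ hP hM hsub hlam hβB hne hcard hn hρ hμ hR hlam1 hlam2 hdet hinv
    hmin
  have hk1 : 1 ≤ k := (Finset.card_pos.2 hne).trans_le hcard
  have hk1' : (1 : ℝ) ≤ k := by exact_mod_cast hk1
  obtain ⟨j₀, hj₀⟩ := hne
  have hlogp : 0 ≤ Real.log p := Real.log_natCast_nonneg p
  rcases Nat.lt_or_ge p 2 with hp | hp
  -- Here log p = 0, so the asserted bound is 9 and exceeds any probability.
  · have hp1 : p = 1 := by have := j₀.pos; omega
    have hprob := isProbabilityMeasure_glmLaw (P := P) hν hψ.continuous βs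
    have hprob' : IsProbabilityMeasure (glmSampleLaw n ψ ν s P βs) := by
      unfold glmSampleLaw; infer_instance
    refine prob_le_one.trans ?_
    rw [← ENNReal.ofReal_one]
    apply ENNReal.ofReal_le_ofReal
    rw [hp1, Nat.cast_one, Real.log_one, min_eq_right (by positivity), mul_zero, Real.exp_zero]
    norm_num
  have hp' : (2 : ℝ) ≤ p := by exact_mod_cast hp
  have hlog : 0 < Real.log p := Real.log_pos (by linarith)
  have hn0' : (0 : ℝ) < n := lt_of_lt_of_le (by positivity) hn
  have hn0 : 0 < n := by exact_mod_cast hn0'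
  obtain ⟨ε, hε⟩ : ∃ ε, ε = Real.sqrt (Real.log p / n) := ⟨_, rfl⟩
  rw [← hε] at hlam1 hmin
  rw [← hε]
  have hε0 : 0 < ε := by rw [hε]; exact Real.sqrt_pos.2 (by positivity)
  have hεn : n * ε ^ 2 = Real.log p := by
    rw [hε, Real.sq_sqrt (by positivity)]; field_simp
  have hkε : k * Real.sqrt k * ε ≤ η := by
    apply le_of_sq_le_sq _ hη0.le
    rw [mul_pow, mul_pow, Real.sq_sqrt (by positivity), hη, div_pow, one_pow,
      le_div_iff₀ (by positivity)]
    rw [← hεn] at hn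
    have h1 : n * (D ^ 2 * (k : ℝ) ^ 3 * ε ^ 2) ≤ n * 1 := by linarith
    have h2 := le_of_mul_le_mul_left h1 hn0'
    linarith
  have hsk1 : 1 ≤ Real.sqrt k := Real.one_le_sqrt.2 hk1'
  have hεη : ε ≤ η := by
    have h1 : 1 ≤ k * Real.sqrt k := one_le_mul_of_one_le_of_one_le hk1' hsk1
    exact (le_mul_of_one_le_left hε0.le h1).trans hkε
  have hη1 : η ≤ 1 := by simpa using hDinv 1 hD1
  have hmul : ∀ x, 0 ≤ x → x ≤ D → x * ε ≤ 1 := fun x hx hxD =>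
    (mul_le_mul_of_nonneg_left hεη hx).trans (hDinv x hxD)
  have hmul2 : ∀ x, 0 ≤ x → x ≤ D → x * ε ^ 2 ≤ 1 := fun x hx hxD => by
    have h1 := hmul x hx hxD
    have h2 : x * ε ^ 2 = x * ε * ε := by ring
    rw [h2]
    exact mul_le_one₀ h1 hε0.le (hεη.trans hη1)
  have hunit := hTe hM hsub hlam βs hβB
  have hlow := le_integral_fisher hψ2 h0 hM hc.le (fun t ht => hcT t (by linarith)) hunit
  have hproj := exists_projection hψ2 h0 hκ₂ hM hσx hsub (by positivity : 0 < 2 * c * e) hlow hdet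
  choose U hU0 hU hUV using hproj
  rw [← hV] at hUV
  have hprob := glmSampleLaw_not_isGoodSample_le hν hs hψ2 hκ₂ hM0 hM hσx hsub βs he hunit hn0 hp
    hV0 hUV hε0 hεn hb (c := b) (r := r) (C := C)
    (by
      have := hmul2 (4 / b) q4 (by linarith)
      rwa [div_mul_eq_mul_div, div_le_one hb0] at this) hr2
    (by rw [← hK₁]; exact hmul2 K₁ hK₁0 (by linarith))
    (by rw [← hK₂]; exact hmul2 K₂ hK₂0 (by linarith))
    (by rw [← hK₃, mul_comm]; exact hmul K₃ hK₃0 (by linarith))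
    (by rw [← hK₄, mul_comm]; exact hmul K₄ hK₄0 (by linarith))
    (by rw [← hK₁, hC]; linarith) (by rw [← hK₂, hC]; linarith)
    (by rw [← hK₃, hC]; linarith) (by rw [← hK₄, hC]; linarith)
  have hα : 0 < 2 * α₁ / r := by positivity
  have hbase : 0 ≤ 2 * (2 * C + Cr + V * Cr) := by positivity
  have hlampos : 0 < lam := lt_of_lt_of_le (by positivity) hlam1
  have hl1pos : 0 < l1Norm βs := by
    refine lt_of_lt_of_le (abs_pos.2 (Finset.mem_filter.1 hj₀).2)
      (Finset.single_le_sum (f := fun j => |βs j|) (fun _ _ => abs_nonneg _) (Finset.mem_univ j₀))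
  have hR0 : 0 < R := by linarith
  have hlamR : lam * R ≤ α₁ / 3 := by rwa [le_div_iff₀ hR0] at hlam2
  have hlamε : 2 * α₁ * ε ≤ lam * r := by
    have h1 : 2 * α₁ / r * ε ≤ lam := by
      have := mul_nonneg hbase hε0.le
      linarith
    rw [div_mul_eq_mul_div, div_le_iff₀ hr0] at h1
    exact h1
  -- Combine 4α₁²ε² ≤ λ²r² with λR ≤ α₁/3 and cancel one factor λ.
  have hrR : 8 * α₁ * R ≤ lam * (r / ε) ^ 2 := by
    rw [div_pow, mul_div_assoc', le_div_iff₀ (by positivity)]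
    have h1 := pow_le_pow_left₀ (by positivity) hlamε 2
    have h2 : 8 * α₁ * ε ^ 2 * (lam * R) ≤ 8 * α₁ * ε ^ 2 * (α₁ / 3) :=
      mul_le_mul_of_nonneg_left hlamR (by positivity)
    have h3 : 0 ≤ α₁ ^ 2 * ε ^ 2 := by positivity
    have h4 : lam * (8 * α₁ * R * ε ^ 2) ≤ lam * (lam * r ^ 2) := by linarith
    exact le_of_mul_le_mul_left h4 hlampos
  have hμ' : μ < α₁ := by
    refine hμ.trans_le ?_
    rw [div_mul_eq_mul_div, div_le_iff₀ (by positivity)]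
    exact mul_le_mul_of_nonneg_left (lambdaMin_covMatrix_le hM hσx hsub j₀) hα₁0.le
  have hSg : ∀ v : Fin p → ℝ, ∑ j, v j * ∑ l, covMatrix P j l * v l ≤
      σx ^ 2 * l2Norm v ^ 2 := fun v => by
    have h1 := sum_mul_sum_mul_integral_eq hM (continuous_const (y := (1 : ℝ))) v v
    simp_rw [← covMatrix_apply, one_mul, ← sq] at h1
    rw [h1]
    exact hsub.integral_sq_le hσx hM v
  refine (measure_mono fun z hz => ?_).trans (hprob.trans (ENNReal.ofReal_le_ofReal ?_))
  · refine fun hgood => hz ?_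
    exact hgood.exists_unique_stationary hψ hκ₃0 hκ₃ h0 hc.le hcT hM0.le hC0 hε0 hr0 hα₁ hα₁0
      hV0.le (sq_nonneg σx) hSg (fisherInfo_symm ψ P βs) hdet hcInf hinv hU0 hU hUV hk1'
      (by exact_mod_cast hcard) hkε hη1
      (by
        have h1 := hDinv (2 * C / α₁) (by linarith)
        rw [div_mul_eq_mul_div, div_le_one hα₁0] at h1
        have := mul_pos hC0 hη0
        linarith)
      (by
        have h1 := hDinv (M * C / α₁) (by linarith)
        rwa [div_mul_eq_mul_div, div_le_one hα₁0] at h1)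
      (by
        have h1 := hDinv (2 / r) (by linarith)
        rwa [div_mul_eq_mul_div, div_le_one hr0] at h1)
      hCr rfl hρ hμ' hR hlampos
      (by
        have := mul_nonneg hα.le hε0.le
        linarith)
      (by linarith) hrR hmin
  · have h1 : Real.exp (-Real.log p) ≤ Real.exp (-1 * min (k : ℝ) (Real.log p)) :=
      Real.exp_le_exp.2 (by linarith [min_le_right (k : ℝ) (Real.log p)])
    linarith
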